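/- Let $K$ be an algebraically closed field of characteristic $p>2$ and let $\mathfrak g=\mathfrak q(n)$ be the queer Lie superalgebra over $K$, consisting of the $2n\times 2n$ matrices $\begin{pmatrix}A&B\\B&A\end{pmatrix}$ with $A,B\in\mathfrak{gl}(n)$; its even part $\mathfrak g_{\bar 0}\cong\mathfrak{gl}(n)$ is given by $B=0$, its odd part $\mathfrak g_{\bar 1}$ by $A=0$, and the $p$-th power map $x\mapsto x^{[p]}$ on $\mathfrak g_{\bar 0}$ is the $p$-th matrix power. Let $\mathfrak h$ be the subalgebra in which $A$ and $B$ are diagonal, let $h_i\in\mathfrak h_{\bar 0}$ be the element for which $A$ is the $i$-th diagonal matrix unit, fix any system of positive roots for $\mathfrak h_{\bar 0}$ (for example the one for which $\mathfrak n^+$ consists of the elements with $A,B$ strictly upper triangular), let $\mathfrak g=\mathfrak n^-\oplus\mathfrak h\oplus\mathfrak n^+$ be the corresponding triangular decomposition, and put $\mathfrak b=\mathfrak h\oplus\mathfrak n^+$. For $\chi\in\mathfrak g_{\bar 0}^*$ and a restricted Lie sub-superalgebra $\mathfrak s\subseteq\mathfrak g$ let $U_\chi(\mathfrak s)$ be the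 quotient of the universal enveloping superalgebra $U(\mathfrak s)$ by the ideal generated by all $x^p-x^{[p]}-\chi(x)^p$ with $x\in\mathfrak s_{\bar 0}$. Assume that $\chi$ is semisimple (that is, $GL(n)$-conjugate to a functional vanishing on $\mathfrak n^+_{\bar 0}$ and $\mathfrak n^-_{\bar 0}$) and that $\chi(\mathfrak n^+_{\bar 0})=\chi(\mathfrak n^-_{\bar 0})=0$. Let $$\lambda\in\Lambda_\chi=\{\lambda\in\mathfrak h_{\bar 0}^*\mid \lambda(h)^p-\lambda(h^{[p]})=\chi(h)^p\ \text{for all } h\in\mathfrak h_{\bar 0}\},$$ and put $\lambda_i=\lambda(h_i)$. Let $\mathfrak h_{\bar 1}'\subseteq\mathfrak h_{\bar 1}$ be any maximal isotropic subspace for the symmetric bilinear form $(a,b)\mapsto\lambda([a,b])$ on $\mathfrak h_{\bar 1}$, let $K_\lambda$ be the one-dimensional (even) $U_\chi(\mathfrak h_{\bar 0}\oplus\mathfrak h_{\bar 1}')$-module on which $\mathfrak h_{\bar 0}$ acts by $\lambda$ and $\mathfrak h_{\bar 1}'$ acts by $0$, let $V_\chi(\lambda)=U_\chi(\mathfrak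 h)\otimes_{U_\chi(\mathfrak h_{\bar 0}\oplus\mathfrak h_{\bar 1}')}K_\lambda$, regarded as a $U_\chi(\mathfrak b)$-module on which $\mathfrak n^+$ acts trivially, and let $Z_\chi(\lambda)=U_\chi(\mathfrak g)\otimes_{U_\chi(\mathfrak b)}V_\chi(\lambda)$ be the baby Verma module. Then $Z_\chi(\lambda)$ is irreducible as a supermodule (it is nonzero and its only $\mathbb Z/2$-graded $U_\chi(\mathfrak g)$-submodules are $0$ and $Z_\chi(\lambda)$) if and only if $$\Phi(\lambda)=\prod_{1\le i<j\le n}(\lambda_i+\lambda_j)(\lambda_i-\lambda_j-1)(\lambda_i-\lambda_j-2)\cdots(\lambda_i-\lambda_j-(p-1))\neq 0 .$$ -/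

import Mathlib

open scoped TensorProduct

noncomputable section

namespace Queer

/-- The square matrices of size `n` over `K`. -/
abbrev Mat (K : Type*) (n : ℕ) := Matrix (Fin n) (Fin n) K

/-- The queer Lie superalgebra `q(n)` consists of the block matrices `(A B; B A)`; such a matrix is
encoded by its even part `A` and its odd part `B`. By this rule for the associative product, the
superbracket is `A A' - A' A` on two even elements, `A B - B A` (an odd element) on an even and an
odd element, and `B B' + B' B` (an even element) on two odd elements; the `p`-th power map on even
elements is `A ↦ A ^ p`. -/
theorem block_mul {K : Type*} [Field K] {n : ℕ} (A B A' B' : Mat K n) :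
    Matrix.fromBlocks A B B A * Matrix.fromBlocks A' B' B' A' =
      Matrix.fromBlocks (A * A' + B * B') (A * B' + B * A')
        (A * B' + B * A') (A * A' + B * B') := by
  rw [Matrix.fromBlocks_multiply]
  congr 1 <;> abel

/-- A restricted (graded) Lie sub-superalgebra of `q(n)`, with even part `even` and odd part `odd`:
graded subspace closed under the superbracket and under the `p`-th power map. -/
structure SubSuper (K : Type*) [Field K] (n p : ℕ) where
  /-- the matrices `A` of the even elements `(A 0; 0 A)` -/
  even : Submodule K (Mat K n)
  /-- the matrices `B` of the odd elements `(0 B; B 0)` -/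
  odd : Submodule K (Mat K n)
  even_even : ∀ x ∈ even, ∀ y ∈ even, x * y - y * x ∈ even
  even_odd : ∀ x ∈ even, ∀ y ∈ odd, x * y - y * x ∈ odd
  odd_odd : ∀ x ∈ odd, ∀ y ∈ odd, x * y + y * x ∈ even
  pow_mem : ∀ x ∈ even, x ^ p ∈ even

section Enveloping

variable {K : Type*} [Field K] {n p : ℕ}

/-- The bracket of two even elements. -/
def SubSuper.br₀₀ (s : SubSuper K n p) (x y : s.even) : s.even :=
  ⟨x * y - y * x, s.even_even x x.2 y y.2⟩

/-- The bracket of an even and an odd element. -/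
def SubSuper.br₀₁ (s : SubSuper K n p) (x : s.even) (y : s.odd) : s.odd :=
  ⟨x * y - y * x, s.even_odd x x.2 y y.2⟩

/-- The bracket of two odd elements. -/
def SubSuper.br₁₁ (s : SubSuper K n p) (x y : s.odd) : s.even :=
  ⟨x * y + y * x, s.odd_odd x x.2 y y.2⟩

/-- The `p`-th power map `x ↦ x^[p]` on even elements. -/
def SubSuper.pmap (s : SubSuper K n p) (x : s.even) : s.even :=
  ⟨(x : Mat K n) ^ p, s.pow_mem x x.2⟩

/-- An even generator of the tensor algebra of the superspace `s`. -/
def t₀ (s : SubSuper K n p) (x : s.even) : TensorAlgebra K (s.even × s.odd) :=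
  TensorAlgebra.ι K (x, 0)

/-- An odd generator of the tensor algebra of the superspace `s`. -/
def t₁ (s : SubSuper K n p) (y : s.odd) : TensorAlgebra K (s.even × s.odd) :=
  TensorAlgebra.ι K (0, y)

/-- The defining relations `x y - (-1)^(|x||y|) y x = [x, y]` of the enveloping superalgebra. -/
inductive EnvRel (s : SubSuper K n p) :
    TensorAlgebra K (s.even × s.odd) → TensorAlgebra K (s.even × s.odd) → Prop
  | even_even (x y : s.even) :
      EnvRel s (t₀ s x * t₀ s y) (t₀ s y * t₀ s x + t₀ s (s.br₀₀ x y))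
  | even_odd (x : s.even) (y : s.odd) :
      EnvRel s (t₀ s x * t₁ s y) (t₁ s y * t₀ s x + t₁ s (s.br₀₁ x y))
  | odd_odd (x y : s.odd) :
      EnvRel s (t₁ s x * t₁ s y + t₁ s y * t₁ s x) (t₀ s (s.br₁₁ x y))

/-- The universal enveloping superalgebra `U(s)`. -/
def Env (s : SubSuper K n p) := RingQuot (EnvRel s)

instance (s : SubSuper K n p) : Ring (Env s) := inferInstanceAs (Ring (RingQuot (EnvRel s)))

instance (s : SubSuper K n p) : Algebra K (Env s) :=
  inferInstanceAs (Algebra K (RingQuot (EnvRel s)))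

/-- The quotient map from the tensor algebra to `U(s)`. -/
def mkEnv (s : SubSuper K n p) : TensorAlgebra K (s.even × s.odd) →ₐ[K] Env s :=
  RingQuot.mkAlgHom K (EnvRel s)

/-- The relations `x^p = x^[p] + χ(x)^p` for even `x`. -/
inductive RedRel (χ : Module.Dual K (Mat K n)) (s : SubSuper K n p) : Env s → Env s → Prop
  | mk (x : s.even) :
      RedRel χ s (mkEnv s (t₀ s x) ^ p)
        (mkEnv s (t₀ s (s.pmap x)) +
          algebraMap K (Env s) (χ (x : Mat K n) ^ p))

/-- The reduced enveloping superalgebra `U_χ(s)`, the quotient of `U(s)` by the two-sided ideal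
generated by the elements `x^p - x^[p] - χ(x)^p` with `x` even. Here `χ` is a linear functional on
the even part of `q(n)`, restricted to the even part of `s`. -/
def Red (χ : Module.Dual K (Mat K n)) (s : SubSuper K n p) := RingQuot (RedRel χ s)

instance (χ : Module.Dual K (Mat K n)) (s : SubSuper K n p) : Ring (Red χ s) :=
  inferInstanceAs (Ring (RingQuot (RedRel χ s)))

instance (χ : Module.Dual K (Mat K n)) (s : SubSuper K n p) : Algebra K (Red χ s) :=
  inferInstanceAs (Algebra K (RingQuot (RedRel χ s)))

/-- The quotient map from `U(s)` to `U_χ(s)`. -/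
def mkRed (χ : Module.Dual K (Mat K n)) (s : SubSuper K n p) : Env s →ₐ[K] Red χ s :=
  RingQuot.mkAlgHom K (RedRel χ s)

/-- The canonical map from the even part of `s` to `U_χ(s)`. -/
def ι₀ (χ : Module.Dual K (Mat K n)) (s : SubSuper K n p) : s.even →ₗ[K] Red χ s :=
  (mkRed χ s).toLinearMap ∘ₗ (mkEnv s).toLinearMap ∘ₗ
      TensorAlgebra.ι K ∘ₗ LinearMap.inl K s.even s.odd

/-- The canonical map from the odd part of `s` to `U_χ(s)`. -/
def ι₁ (χ : Module.Dual K (Mat K n)) (s : SubSuper K n p) : s.odd →ₗ[K] Red χ s :=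
  (mkRed χ s).toLinearMap ∘ₗ (mkEnv s).toLinearMap ∘ₗ
      TensorAlgebra.ι K ∘ₗ LinearMap.inr K s.even s.odd

theorem mkEnv_rel {s : SubSuper K n p} {a b : TensorAlgebra K (s.even × s.odd)}
    (h : EnvRel s a b) : mkEnv s a = mkEnv s b :=
  RingQuot.mkAlgHom_rel K h

theorem mkRed_rel {χ : Module.Dual K (Mat K n)} {s : SubSuper K n p} {a b : Env s}
    (h : RedRel χ s a b) : mkRed χ s a = mkRed χ s b :=
  RingQuot.mkAlgHom_rel K h

theorem ι₀_mul_ι₀ (χ : Module.Dual K (Mat K n)) (s : SubSuper K n p) (x y : s.even) :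
    ι₀ χ s x * ι₀ χ s y = ι₀ χ s y * ι₀ χ s x + ι₀ χ s (s.br₀₀ x y) := by
  have h := congrArg (mkRed χ s) (mkEnv_rel (EnvRel.even_even x y))
  simpa [t₀, ι₀] using h

theorem ι₀_mul_ι₁ (χ : Module.Dual K (Mat K n)) (s : SubSuper K n p) (x : s.even) (y : s.odd) :
    ι₀ χ s x * ι₁ χ s y = ι₁ χ s y * ι₀ χ s x + ι₁ χ s (s.br₀₁ x y) := by
  have h := congrArg (mkRed χ s) (mkEnv_rel (EnvRel.even_odd x y))
  simpa [t₀, t₁, ι₀, ι₁] using h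

theorem ι₁_mul_ι₁ (χ : Module.Dual K (Mat K n)) (s : SubSuper K n p) (x y : s.odd) :
    ι₁ χ s x * ι₁ χ s y + ι₁ χ s y * ι₁ χ s x = ι₀ χ s (s.br₁₁ x y) := by
  have h := congrArg (mkRed χ s) (mkEnv_rel (EnvRel.odd_odd x y))
  simpa [t₀, t₁, ι₀, ι₁] using h

theorem ι₀_pow (χ : Module.Dual K (Mat K n)) (s : SubSuper K n p) (x : s.even) :
    ι₀ χ s x ^ p = ι₀ χ s (s.pmap x) + algebraMap K (Red χ s) (χ (x : Mat K n) ^ p) := by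
  have h := mkRed_rel (RedRel.mk (χ := χ) x)
  rw [map_pow, map_add, AlgHom.commutes] at h
  exact h

/-- The universal property of `U(s)`. -/
def liftEnv (s : SubSuper K n p) {A : Type*} [Ring A] [Algebra K A]
    (f₀ : s.even →ₗ[K] A) (f₁ : s.odd →ₗ[K] A)
    (h₀₀ : ∀ x y, f₀ x * f₀ y = f₀ y * f₀ x + f₀ (s.br₀₀ x y))
    (h₀₁ : ∀ x y, f₀ x * f₁ y = f₁ y * f₀ x + f₁ (s.br₀₁ x y))
    (h₁₁ : ∀ x y, f₁ x * f₁ y + f₁ y * f₁ x = f₀ (s.br₁₁ x y)) :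
    Env s →ₐ[K] A :=
  RingQuot.liftAlgHom K ⟨TensorAlgebra.lift K (f₀.coprod f₁), by
    rintro _ _ (⟨x, y⟩ | ⟨x, y⟩ | ⟨x, y⟩)
    · simpa [t₀] using h₀₀ x y
    · simpa [t₀, t₁] using h₀₁ x y
    · simpa [t₀, t₁] using h₁₁ x y⟩

theorem liftEnv_mkEnv (s : SubSuper K n p) {A : Type*} [Ring A] [Algebra K A]
    (f₀ : s.even →ₗ[K] A) (f₁ : s.odd →ₗ[K] A)
    (h₀₀ : ∀ x y, f₀ x * f₀ y = f₀ y * f₀ x + f₀ (s.br₀₀ x y))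
    (h₀₁ : ∀ x y, f₀ x * f₁ y = f₁ y * f₀ x + f₁ (s.br₀₁ x y))
    (h₁₁ : ∀ x y, f₁ x * f₁ y + f₁ y * f₁ x = f₀ (s.br₁₁ x y))
    (a : TensorAlgebra K (s.even × s.odd)) :
    liftEnv s f₀ f₁ h₀₀ h₀₁ h₁₁ (mkEnv s a) = TensorAlgebra.lift K (f₀.coprod f₁) a :=
  RingQuot.liftAlgHom_mkAlgHom_apply K _ _ a

/-- The universal property of `U_χ(s)`: linear maps on the even and odd parts that satisfy the
relations extend to an algebra homomorphism. -/
def lift (χ : Module.Dual K (Mat K n)) (s : SubSuper K n p) {A : Type*} [Ring A] [Algebra K A]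
    (f₀ : s.even →ₗ[K] A) (f₁ : s.odd →ₗ[K] A)
    (h₀₀ : ∀ x y, f₀ x * f₀ y = f₀ y * f₀ x + f₀ (s.br₀₀ x y))
    (h₀₁ : ∀ x y, f₀ x * f₁ y = f₁ y * f₀ x + f₁ (s.br₀₁ x y))
    (h₁₁ : ∀ x y, f₁ x * f₁ y + f₁ y * f₁ x = f₀ (s.br₁₁ x y))
    (hp : ∀ x, f₀ x ^ p = f₀ (s.pmap x) + algebraMap K A (χ (x : Mat K n) ^ p)) :
    Red χ s →ₐ[K] A :=
  RingQuot.liftAlgHom K ⟨liftEnv s f₀ f₁ h₀₀ h₀₁ h₁₁, by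
    rintro _ _ ⟨x⟩
    rw [map_pow, map_add, AlgHom.commutes, liftEnv_mkEnv, liftEnv_mkEnv]
    simpa [t₀] using hp x⟩

/-- Monomials of parity `i` in the homogeneous generators of `U_χ(s)`. -/
inductive Mono (χ : Module.Dual K (Mat K n)) (s : SubSuper K n p) : ZMod 2 → Red χ s → Prop
  | one : Mono χ s 0 1
  | even_mul (x : s.even) (i : ZMod 2) (u : Red χ s) (h : Mono χ s i u) :
      Mono χ s i (ι₀ χ s x * u)
  | odd_mul (y : s.odd) (i : ZMod 2) (u : Red χ s) (h : Mono χ s i u) :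
      Mono χ s (i + 1) (ι₁ χ s y * u)

/-- The `ℤ/2`-grading of `U_χ(s)`. -/
def grading (χ : Module.Dual K (Mat K n)) (s : SubSuper K n p) (i : ZMod 2) :
    Submodule K (Red χ s) :=
  Submodule.span K {u | Mono χ s i u}

/-- The algebra homomorphism `U_χ(s) → U_χ(t)` induced by an inclusion `s ⊆ t`. -/
def incl (χ : Module.Dual K (Mat K n)) {s t : SubSuper K n p}
    (h₀ : s.even ≤ t.even) (h₁ : s.odd ≤ t.odd) : Red χ s →ₐ[K] Red χ t :=
  lift χ s (ι₀ χ t ∘ₗ Submodule.inclusion h₀) (ι₁ χ t ∘ₗ Submodule.inclusion h₁)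
    (fun x y => ι₀_mul_ι₀ χ t (Submodule.inclusion h₀ x) (Submodule.inclusion h₀ y))
    (fun x y => ι₀_mul_ι₁ χ t (Submodule.inclusion h₀ x) (Submodule.inclusion h₁ y))
    (fun x y => ι₁_mul_ι₁ χ t (Submodule.inclusion h₁ x) (Submodule.inclusion h₁ y))
    (fun x => ι₀_pow χ t (Submodule.inclusion h₀ x))

end Enveloping

section Induction

variable {K A B : Type*} [Field K] [Ring A] [Algebra K A] [Ring B] [Algebra K B]

/-- The relations `a b ⊗ m = a ⊗ b m` of a tensor product over `B`. -/
def balanced (f : B →ₐ[K] A) {M : Type*} [AddCommGroup M] [Module K M]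
    (ρ : B →ₐ[K] Module.End K M) : Submodule A (A ⊗[K] M) :=
  Submodule.span A {z | ∃ (a : A) (b : B) (m : M), z = (a * f b) ⊗ₜ[K] m - a ⊗ₜ[K] (ρ b m)}

/-- The induced left `A`-module `A ⊗_B M`, where `A` is a right `B`-module through `f` and `M` is
the left `B`-module given by the representation `ρ`. -/
abbrev Ind (f : B →ₐ[K] A) {M : Type*} [AddCommGroup M] [Module K M]
    (ρ : B →ₐ[K] Module.End K M) : Type _ :=
  (A ⊗[K] M) ⧸ balanced f ρ

/-- The `ℤ/2`-grading of `A ⊗_B M` for a grading `gA` of `A` and a grading `gM` of `M`: the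
element `a ⊗ m` has parity `|a| + |m|`. -/
def indGrading (f : B →ₐ[K] A) {M : Type*} [AddCommGroup M] [Module K M]
    (ρ : B →ₐ[K] Module.End K M) (gA : ZMod 2 → Submodule K A) (gM : ZMod 2 → Submodule K M)
    (i : ZMod 2) : Submodule K (Ind f ρ) :=
  Submodule.span K {z | ∃ (j k : ZMod 2) (a : A) (m : M), j + k = i ∧ a ∈ gA j ∧ m ∈ gM k ∧
    z = (balanced f ρ).mkQ (a ⊗ₜ[K] m)}

/-- A submodule is graded if it contains the homogeneous components of its elements. -/
def IsGradedSubmodule {M : Type*} [AddCommGroup M] [Module K M] [Module A M]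
    (gM : ZMod 2 → Submodule K M) (N : Submodule A M) : Prop :=
  ∀ x ∈ N, ∃ y ∈ N, ∃ z ∈ N, y ∈ gM 0 ∧ z ∈ gM 1 ∧ x = y + z

/-- A supermodule is irreducible if it is nonzero and its only graded submodules are `0` and
itself. -/
def IsIrreducibleSuper (A : Type*) [Ring A] [Algebra K A] {M : Type*} [AddCommGroup M] [Module K M]
    [Module A M] (gM : ZMod 2 → Submodule K M) : Prop :=
  Nontrivial M ∧ ∀ N : Submodule A M, IsGradedSubmodule gM N → N = ⊥ ∨ N = ⊤

end Induction

section Subalgebras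

variable (K : Type*) [Field K] (n p : ℕ)

/-- The diagonal matrices. -/
def diagSub : Submodule K (Mat K n) where
  carrier := {M | ∀ i j, i ≠ j → M i j = 0}
  add_mem' := fun ha hb i j h => by simp [ha i j h, hb i j h]
  zero_mem' := fun _ _ _ => rfl
  smul_mem' := fun c x hx i j h => by simp [hx i j h]

variable {n}

/-- The part of the Borel subalgebra of a given parity. The permutation `σ` fixes the positive
system: the root `ε_i - ε_j` is positive if and only if `σ i < σ j`. For `σ = 1` these are the
upper triangular matrices. -/
def borelSub (σ : Equiv.Perm (Fin n)) : Submodule K (Mat K n) where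
  carrier := {M | ∀ i j, σ j < σ i → M i j = 0}
  add_mem' := fun ha hb i j h => by simp [ha i j h, hb i j h]
  zero_mem' := fun _ _ _ => rfl
  smul_mem' := fun c x hx i j h => by simp [hx i j h]

/-- The part of `n⁺` of a given parity, spanned by the positive root vectors. -/
def posSub (σ : Equiv.Perm (Fin n)) : Submodule K (Mat K n) where
  carrier := {M | ∀ i j, σ j ≤ σ i → M i j = 0}
  add_mem' := fun ha hb i j h => by simp [ha i j h, hb i j h]
  zero_mem' := fun _ _ _ => rfl
  smul_mem' := fun c x hx i j h => by simp [hx i j h]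

/-- The part of `n⁻` of a given parity, spanned by the negative root vectors. -/
def negSub (σ : Equiv.Perm (Fin n)) : Submodule K (Mat K n) where
  carrier := {M | ∀ i j, σ i ≤ σ j → M i j = 0}
  add_mem' := fun ha hb i j h => by simp [ha i j h, hb i j h]
  zero_mem' := fun _ _ _ => rfl
  smul_mem' := fun c x hx i j h => by simp [hx i j h]

variable {K}

theorem diag_mul_mem {x y : Mat K n} (hx : x ∈ diagSub K n) (hy : y ∈ diagSub K n) :
    x * y ∈ diagSub K n := by
  intro i j hij
  rw [Matrix.mul_apply]
  refine Finset.sum_eq_zero fun k _ => ?_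
  by_cases hik : i = k
  · rw [hy k j (hik ▸ hij), mul_zero]
  · rw [hx i k hik, zero_mul]

theorem diag_mul_comm {x y : Mat K n} (hx : x ∈ diagSub K n) (hy : y ∈ diagSub K n) :
    x * y = y * x := by
  ext i j
  rw [Matrix.mul_apply, Matrix.mul_apply]
  refine Finset.sum_congr rfl fun k _ => ?_
  by_cases hik : i = k
  · by_cases hkj : k = j
    · subst hik; subst hkj; exact mul_comm _ _
    · rw [hy k j hkj, hx k j hkj, mul_zero, mul_zero]
  · rw [hx i k hik, hy i k hik, zero_mul, zero_mul]

theorem diag_one_mem : (1 : Mat K n) ∈ diagSub K n := fun _ _ h => Matrix.one_apply_ne h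

theorem diag_pow_mem {x : Mat K n} (hx : x ∈ diagSub K n) (k : ℕ) : x ^ k ∈ diagSub K n := by
  induction k with
  | zero => rw [pow_zero]; exact diag_one_mem
  | succ k ih => rw [pow_succ]; exact diag_mul_mem ih hx

theorem borel_mul_mem {σ : Equiv.Perm (Fin n)} {x y : Mat K n} (hx : x ∈ borelSub K σ)
    (hy : y ∈ borelSub K σ) : x * y ∈ borelSub K σ := by
  intro i j hij
  rw [Matrix.mul_apply]
  refine Finset.sum_eq_zero fun k _ => ?_
  rcases lt_or_ge (σ k) (σ i) with h | h
  · rw [hx i k h, zero_mul]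
  · rw [hy k j (lt_of_lt_of_le hij h), mul_zero]

theorem diag_le_borel (σ : Equiv.Perm (Fin n)) : diagSub K n ≤ borelSub K σ :=
  fun _ hx i j h => hx i j fun e => by subst e; exact lt_irrefl _ h

theorem borel_pow_mem {σ : Equiv.Perm (Fin n)} {x : Mat K n} (hx : x ∈ borelSub K σ) (k : ℕ) :
    x ^ k ∈ borelSub K σ := by
  induction k with
  | zero => rw [pow_zero]; exact diag_le_borel σ diag_one_mem
  | succ k ih => rw [pow_succ]; exact borel_mul_mem ih hx

variable (K n)

/-- The whole queer Lie superalgebra `q(n)`. -/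
def queer : SubSuper K n p where
  even := ⊤
  odd := ⊤
  even_even := fun _ _ _ _ => trivial
  even_odd := fun _ _ _ _ => trivial
  odd_odd := fun _ _ _ _ => trivial
  pow_mem := fun _ _ => trivial

/-- The standard Cartan subalgebra `h` of `q(n)`. -/
def cartan : SubSuper K n p where
  even := diagSub K n
  odd := diagSub K n
  even_even := fun _ hx _ hy => sub_mem (diag_mul_mem hx hy) (diag_mul_mem hy hx)
  even_odd := fun _ hx _ hy => sub_mem (diag_mul_mem hx hy) (diag_mul_mem hy hx)
  odd_odd := fun _ hx _ hy => add_mem (diag_mul_mem hx hy) (diag_mul_mem hy hx)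
  pow_mem := fun _ hx => diag_pow_mem hx p

variable {n}

/-- The Borel subalgebra `b = h ⊕ n⁺` of `q(n)` attached to a positive system. -/
def borel (σ : Equiv.Perm (Fin n)) : SubSuper K n p where
  even := borelSub K σ
  odd := borelSub K σ
  even_even := fun _ hx _ hy => sub_mem (borel_mul_mem hx hy) (borel_mul_mem hy hx)
  even_odd := fun _ hx _ hy => sub_mem (borel_mul_mem hx hy) (borel_mul_mem hy hx)
  odd_odd := fun _ hx _ hy => add_mem (borel_mul_mem hx hy) (borel_mul_mem hy hx)
  pow_mem := fun _ hx => borel_pow_mem hx p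

variable {K}

/-- The sub-superalgebra `h_0 ⊕ h_1'` of the Cartan subalgebra, for a subspace `h_1'` of `h_1`. -/
def cartanSub (H : Submodule K (diagSub K n)) : SubSuper K n p where
  even := diagSub K n
  odd := H.map (diagSub K n).subtype
  even_even := fun _ hx _ hy => sub_mem (diag_mul_mem hx hy) (diag_mul_mem hy hx)
  even_odd := fun _ hx y hy => by
    rw [diag_mul_comm hx (Submodule.map_subtype_le _ H hy), sub_self]; exact zero_mem _
  odd_odd := fun _ hx _ hy =>
    add_mem (diag_mul_mem (Submodule.map_subtype_le _ H hx) (Submodule.map_subtype_le _ H hy))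
      (diag_mul_mem (Submodule.map_subtype_le _ H hy) (Submodule.map_subtype_le _ H hx))
  pow_mem := fun _ hx => diag_pow_mem hx p

/-- The projection of matrices onto their diagonal parts. -/
def diagPart : Mat K n →ₗ[K] diagSub K n where
  toFun x := ⟨Matrix.diagonal x.diag, fun _ _ h => Matrix.diagonal_apply_ne _ h⟩
  map_add' x y := by
    ext i j
    by_cases h : i = j <;> simp [h]
  map_smul' c x := by
    ext i j
    by_cases h : i = j <;> simp [h]

theorem diagPart_mul {σ : Equiv.Perm (Fin n)} {x y : Mat K n} (hx : x ∈ borelSub K σ)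
    (hy : y ∈ borelSub K σ) :
    (diagPart (x * y) : Mat K n) = (diagPart x : Mat K n) * (diagPart y : Mat K n) := by
  have key : ∀ i, (x * y) i i = x i i * y i i := fun i => by
    rw [Matrix.mul_apply]
    refine Finset.sum_eq_single i (fun k _ hk => ?_) (fun h => absurd (Finset.mem_univ i) h)
    rcases lt_trichotomy (σ k) (σ i) with h | h | h
    · rw [hx i k h, zero_mul]
    · exact absurd (σ.injective h) hk
    · rw [hy k i h, mul_zero]
  ext i j
  simp only [diagPart, LinearMap.coe_mk, AddHom.coe_mk, Matrix.diagonal_mul_diagonal,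
    Matrix.diagonal_apply, Matrix.diag_apply, key]

theorem diagPart_one : (diagPart (1 : Mat K n) : Mat K n) = 1 := by
  ext i j
  by_cases h : i = j
  · subst h; simp [diagPart]
  · simp [diagPart, h]

theorem diagPart_pow {σ : Equiv.Perm (Fin n)} {x : Mat K n} (hx : x ∈ borelSub K σ) (k : ℕ) :
    (diagPart (x ^ k) : Mat K n) = (diagPart x : Mat K n) ^ k := by
  induction k with
  | zero => rw [pow_zero, pow_zero, diagPart_one]
  | succ k ih => rw [pow_succ, pow_succ, diagPart_mul (borel_pow_mem hx k) hx, ih]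

theorem sub_diagPart_mem {σ : Equiv.Perm (Fin n)} {x : Mat K n} (hx : x ∈ borelSub K σ) :
    x - (diagPart x : Mat K n) ∈ posSub K σ := by
  intro i j hij
  by_cases h : i = j
  · subst h; simp [diagPart]
  · have : σ j < σ i := lt_of_le_of_ne hij fun e => h (σ.injective e).symm
    simp [diagPart, hx i j this, Matrix.diagonal_apply_ne _ h]

end Subalgebras

section BabyVerma

variable {K : Type*} [Field K] {n : ℕ} (p : ℕ)

/-- Let `n⁺` act trivially: the homomorphism `U_χ(b) → U_χ(h)` induced by `b → b / n⁺ = h`. It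
exists because `χ` vanishes on the even part of `n⁺`. -/
def inflate (σ : Equiv.Perm (Fin n)) (χ : Module.Dual K (Mat K n))
    (hχ : ∀ x ∈ posSub K σ, χ x = 0) :
    Red χ (borel K p σ) →ₐ[K] Red χ (cartan K n p) :=
  lift χ (borel K p σ)
    (ι₀ χ (cartan K n p) ∘ₗ diagPart ∘ₗ (borelSub K σ).subtype)
    (ι₁ χ (cartan K n p) ∘ₗ diagPart ∘ₗ (borelSub K σ).subtype)
    (fun x y => by
      have e : (cartan K n p).br₀₀ (diagPart (x : Mat K n)) (diagPart (y : Mat K n)) =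
          diagPart (x.1 * y.1 - y.1 * x.1) := Subtype.ext <| by
        simp only [map_sub, Submodule.coe_sub, diagPart_mul x.2 y.2, diagPart_mul y.2 x.2]; rfl
      have h := ι₀_mul_ι₀ χ (cartan K n p) (diagPart (x : Mat K n)) (diagPart (y : Mat K n))
      rw [e] at h; exact h)
    (fun x y => by
      have e : (cartan K n p).br₀₁ (diagPart (x : Mat K n)) (diagPart (y : Mat K n)) =
          diagPart (x.1 * y.1 - y.1 * x.1) := Subtype.ext <| by
        simp only [map_sub, Submodule.coe_sub, diagPart_mul x.2 y.2, diagPart_mul y.2 x.2]; rfl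
      have h := ι₀_mul_ι₁ χ (cartan K n p) (diagPart (x : Mat K n)) (diagPart (y : Mat K n))
      rw [e] at h; exact h)
    (fun x y => by
      have e : (cartan K n p).br₁₁ (diagPart (x : Mat K n)) (diagPart (y : Mat K n)) =
          diagPart (x.1 * y.1 + y.1 * x.1) := Subtype.ext <| by
        simp only [map_add, Submodule.coe_add, diagPart_mul x.2 y.2, diagPart_mul y.2 x.2]; rfl
      have h := ι₁_mul_ι₁ χ (cartan K n p) (diagPart (x : Mat K n)) (diagPart (y : Mat K n))
      rw [e] at h; exact h)
    (fun x => by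
      have e : (cartan K n p).pmap (diagPart (x : Mat K n)) = diagPart ((x : Mat K n) ^ p) :=
        Subtype.ext (diagPart_pow x.2 p).symm
      have hx : χ (diagPart (x : Mat K n) : Mat K n) = χ (x : Mat K n) := by
        have := hχ _ (sub_diagPart_mem x.2)
        rw [map_sub, sub_eq_zero] at this; exact this.symm
      have h := ι₀_pow χ (cartan K n p) (diagPart (x : Mat K n))
      rw [e, hx] at h; exact h)

/-- The set `Λ_χ` of the weights `wt` with `wt(h)^p - wt(h^[p]) = χ(h)^p` for all even `h` in the
Cartan subalgebra. -/
def weights (χ : Module.Dual K (Mat K n)) : Set (Module.Dual K (diagSub K n)) :=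
  {wt | ∀ h : diagSub K n, wt h ^ p - wt ((cartan K n p).pmap h) = χ (h : Mat K n) ^ p}

/-- The subspace `H` of the odd part of the Cartan subalgebra is isotropic for the symmetric
bilinear form `(a | b) = wt([a, b])`. -/
def IsIsotropic (wt : Module.Dual K (diagSub K n)) (H : Submodule K (diagSub K n)) : Prop :=
  ∀ a ∈ H, ∀ b ∈ H, wt ((cartan K n p).br₁₁ a b) = 0

/-- The one-dimensional representation `K_wt` of `h_0 ⊕ h_1'`: even elements act by `wt` and
odd elements act by zero. -/
def oneDim (χ : Module.Dual K (Mat K n)) (wt : Module.Dual K (diagSub K n))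
    (hwt : wt ∈ weights p χ) (H : Submodule K (diagSub K n)) (hH : IsIsotropic p wt H) :
    Red χ (cartanSub p H) →ₐ[K] Module.End K K :=
  (Algebra.lsmul K K K).comp <| lift χ (cartanSub p H) (A := K) wt 0
    (fun x y => by
      have e : (cartanSub p H).br₀₀ x y = 0 :=
        Subtype.ext (sub_eq_zero.2 (diag_mul_comm x.2 y.2))
      rw [e]
      exact (mul_comm _ _).trans (add_eq_left.2 (map_zero wt)).symm)
    (fun x y => by simp)
    (fun x y => by
      obtain ⟨_, a, ha, rfl⟩ := x
      obtain ⟨_, b, hb, rfl⟩ := y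
      have h := hH a ha b hb
      simp only [LinearMap.zero_apply, mul_zero, add_zero]
      exact h.symm)
    (fun x => by
      have h := hwt x
      rw [Algebra.algebraMap_self_apply]
      exact sub_eq_iff_eq_add'.1 h)

/-- The inclusion `U_χ(h_0 ⊕ h_1') → U_χ(h)`. -/
def inclCartan (χ : Module.Dual K (Mat K n)) (H : Submodule K (diagSub K n)) :
    Red χ (cartanSub p H) →ₐ[K] Red χ (cartan K n p) :=
  incl χ (le_refl (diagSub K n)) (Submodule.map_subtype_le (diagSub K n) H)

/-- The `U_χ(h)`-module `V_χ(wt)`, induced from the representation `K_wt` of `h_0 ⊕ h_1'`. -/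
abbrev HighWeight (χ : Module.Dual K (Mat K n)) (wt : Module.Dual K (diagSub K n))
    (hwt : wt ∈ weights p χ) (H : Submodule K (diagSub K n)) (hH : IsIsotropic p wt H) : Type _ :=
  Ind (inclCartan p χ H) (oneDim p χ wt hwt H hH)

/-- The `ℤ/2`-grading of `V_χ(wt)`, where `K_wt` is even. -/
def highWeightGrading (χ : Module.Dual K (Mat K n)) (wt : Module.Dual K (diagSub K n))
    (hwt : wt ∈ weights p χ) (H : Submodule K (diagSub K n)) (hH : IsIsotropic p wt H) :
    ZMod 2 → Submodule K (HighWeight p χ wt hwt H hH) :=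
  indGrading (inclCartan p χ H) (oneDim p χ wt hwt H hH) (grading χ (cartan K n p))
    (fun i => if i = 0 then ⊤ else ⊥)

/-- The action of `U_χ(b)` on `V_χ(wt)`, with `n⁺` acting trivially. -/
def highWeightRep (σ : Equiv.Perm (Fin n)) (χ : Module.Dual K (Mat K n))
    (hχ : ∀ x ∈ posSub K σ, χ x = 0) (wt : Module.Dual K (diagSub K n))
    (hwt : wt ∈ weights p χ) (H : Submodule K (diagSub K n)) (hH : IsIsotropic p wt H) :
    Red χ (borel K p σ) →ₐ[K] Module.End K (HighWeight p χ wt hwt H hH) :=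
  (Algebra.lsmul K K (HighWeight p χ wt hwt H hH)).comp (inflate p σ χ hχ)

/-- The inclusion `U_χ(b) → U_χ(q(n))`. -/
def inclBorel (σ : Equiv.Perm (Fin n)) (χ : Module.Dual K (Mat K n)) :
    Red χ (borel K p σ) →ₐ[K] Red χ (queer K n p) :=
  incl χ (s := borel K p σ) (t := queer K n p) le_top le_top

/-- The baby Verma module `Z_χ(wt) = U_χ(q(n)) ⊗_{U_χ(b)} V_χ(wt)`. -/
abbrev BabyVerma (σ : Equiv.Perm (Fin n)) (χ : Module.Dual K (Mat K n))
    (hχ : ∀ x ∈ posSub K σ, χ x = 0) (wt : Module.Dual K (diagSub K n))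
    (hwt : wt ∈ weights p χ) (H : Submodule K (diagSub K n)) (hH : IsIsotropic p wt H) : Type _ :=
  Ind (inclBorel p σ χ) (highWeightRep p σ χ hχ wt hwt H hH)

/-- The `ℤ/2`-grading of the baby Verma module. -/
def babyVermaGrading (σ : Equiv.Perm (Fin n)) (χ : Module.Dual K (Mat K n))
    (hχ : ∀ x ∈ posSub K σ, χ x = 0) (wt : Module.Dual K (diagSub K n))
    (hwt : wt ∈ weights p χ) (H : Submodule K (diagSub K n)) (hH : IsIsotropic p wt H) :
    ZMod 2 → Submodule K (BabyVerma p σ χ hχ wt hwt H hH) :=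
  indGrading (inclBorel p σ χ) (highWeightRep p σ χ hχ wt hwt H hH) (grading χ (queer K n p))
    (highWeightGrading p χ wt hwt H hH)

/-- A `p`-character is semisimple if it is `GL(n)`-conjugate to one that vanishes on the even parts
of `n⁺` and `n⁻`. -/
def IsSemisimpleChar (σ : Equiv.Perm (Fin n)) (χ : Module.Dual K (Mat K n)) : Prop :=
  ∃ (g : GL (Fin n) K) (ξ : Module.Dual K (Mat K n)),
    (∀ x ∈ posSub K σ, ξ x = 0) ∧ (∀ x ∈ negSub K σ, ξ x = 0) ∧
    ∀ x : Mat K n, χ x = ξ ((g⁻¹ : GL (Fin n) K).val * x * g.val)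

/-- The coordinate `wt_i = wt(h_i)`, where `h_i` is the `i`-th diagonal matrix unit. -/
def coord (wt : Module.Dual K (diagSub K n)) (i : Fin n) : K :=
  wt (diagPart (Matrix.single i i 1))

/-- The polynomial `φ(x, y) = (x + y) (x - y - 1) ⋯ (x - y - (p - 1))`. -/
def phi (x y : K) : K :=
  (x + y) * ∏ k ∈ Finset.Ico 1 p, (x - y - (k : K))

/-- The product `Φ(wt)` of the `φ(wt_i, wt_j)` over `i < j`. -/
def Phi (wt : Module.Dual K (diagSub K n)) : K :=
  ∏ i : Fin n, ∏ j ∈ Finset.Ioi i, phi p (coord wt i) (coord wt j)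

end BabyVerma

end Queer

end

/-! Let `V` be the highest weight module of the Cartan subalgebra and `Z` the baby Verma module. By
the PBW theorem, `Z` is the direct sum of the copies `y V`, where `y` runs over the restricted
ordered monomials in the negative root vectors. Let `y_top` and `e_top` be the products of all
negative and of all positive root vectors with their largest exponents (`p - 1` for an even vector,
`1` for an odd one). Irreducibility is decided by one scalar: `e_top y_top` acts on `V` as a nonzero
constant times a product of factors `phi`, one for each positive root.

The scalar comes from a rank one computation repeated along the roots (`rankOne`,
`posTop_smul_negTop_smul`). For a root with even and odd vectors `e`, `E` and negatives `f`, `F`,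
the operator `E e^(p-1) f^(p-1) F` multiplies a highest weight vector by a constant times `phi`.
Moreover `f^(p-1) F v` has the same weight as `v`, since the shift is `p` times a root, and it is a
highest weight vector for the positive system reflected in that root (`IsChainVector.step`). The
lexicographic order presents each root at a moment when it is simple, so the factors multiply with
no shift of the weight. Nonvanishing of `phi` is symmetric in its two arguments, so the condition
does not depend on the positive system.

If the scalar is nonzero, let `N` be a nonzero graded submodule. Multiplying a nonzero element by
suitable negative root vectors yields `y_top v` in `N` with `v ≠ 0` in `V`
(`exists_topMono_smul_mem`); applying `e_top` gives `v` itself. So `N` meets `V` in a nonzero graded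
submodule. Since `V` is a Clifford module induced from a maximal isotropic subspace, it is an
irreducible supermodule (`mem_of_maximal_isotropic`); hence `N` contains `V`, which generates `Z`.

If the scalar is zero, the submodule generated by `y_top V` is graded and nonzero. Negative root
vectors kill `y_top V` and the Cartan part preserves it, so it is spanned by positive monomials
applied to `y_top V`. There are exactly as many such monomials as negative ones; if they filled `Z`,
a dimension count would make them independent, contradicting `e_top y_top V = 0`.

The linear independence half of PBW is obtained from an explicit oscillator representation on
truncated polynomials tensored with an exterior algebra. Its `p`-th power relations reduce to matrix
units by Jacobson's formula. -/

set_option linter.unusedSectionVars false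
open scoped TensorProduct
noncomputable section
namespace Queer

/-! ### Jacobson's formula for `p`-th powers of sums. -/

section Jacobson

open Polynomial

/-- By Pascal's rule, two consecutive entries of row `p - 1` add up to an entry of row `p`, which is
divisible by `p`. -/
theorem cast_choose_pred {A : Type*} [Ring A] (p : ℕ) [hp : Fact p.Prime] [CharP A p] {i : ℕ}
    (hi : i < p) : ((p - 1).choose i : A) = (-1) ^ i := by
  induction i with
  | zero => simp
  | succ i ih =>
    have h : (p.choose (i + 1) : A) = 0 :=
      (CharP.cast_eq_zero_iff A p _).2 (hp.out.dvd_choose_self (Nat.succ_ne_zero i) hi)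
    have h2 : p.choose (i + 1) = (p - 1).choose i + (p - 1).choose (i + 1) := by
      obtain ⟨q, rfl⟩ : ∃ q, p = q + 1 := ⟨p - 1, by omega⟩
      rfl
    rw [h2, Nat.cast_add, ih (by omega)] at h
    rw [pow_succ, mul_neg_one]
    exact eq_neg_of_add_eq_zero_right h

/-- In odd characteristic `p`, `(a - b)^(p-1) = ∑ a^i b^(p-1-i)` for commuting elements. -/
theorem sub_pow_pred_of_commute {A : Type*} [Ring A] (p : ℕ) [hp : Fact p.Prime] [CharP A p]
    (hodd : Odd p) {a b : A} (h : Commute a b) :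
    (a - b) ^ (p - 1) = ∑ i ∈ Finset.range p, a ^ i * b ^ (p - 1 - i) := by
  rw [sub_eq_add_neg, (h.neg_right).add_pow, Nat.sub_add_cancel hp.out.one_le]
  refine Finset.sum_congr rfl fun i hi => ?_
  have hi := Finset.mem_range.1 hi
  have hev : Even (p - 1) := by obtain ⟨k, hk⟩ := hodd; exact ⟨k, by omega⟩
  have : (-1 : A) ^ (p - 1 - i) * (-1) ^ i = 1 := by
    rw [← pow_add, Nat.sub_add_cancel (by omega), hev.neg_one_pow]
  rw [cast_choose_pred p hi, neg_pow b, mul_assoc, mul_assoc,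
    (((Commute.neg_one_left b).pow_left i).pow_right (p - 1 - i)).symm.eq, ← mul_assoc ((-1) ^ _), this, one_mul]

theorem derivative_pow_eq_sum {A : Type*} [Ring A] (u : A[X]) (m : ℕ) :
    derivative (u ^ m) =
      ∑ i ∈ Finset.range m, u ^ i * derivative u * u ^ (m - 1 - i) := by
  induction m with
  | zero => simp
  | succ m ih =>
    rw [pow_succ, derivative_mul, ih, Finset.sum_range_succ, Finset.sum_mul]
    congr 1
    · refine Finset.sum_congr rfl fun i hi => ?_
      have : m + 1 - 1 - i = (m - 1 - i) + 1 := by have := Finset.mem_range.1 hi; omega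
      rw [this, pow_succ]; noncomm_ring
    · simp

/-- In odd characteristic `p`, the derivative of `u^p` is `ad(u)^(p-1)` of the derivative of `u`. -/
theorem derivative_pow_char {A : Type*} [Ring A] (p : ℕ) [hp : Fact p.Prime] [CharP A p]
    (hodd : Odd p) (u : A[X]) :
    derivative (u ^ p) = (fun v => u * v - v * u)^[p - 1] (derivative u) := by
  have : CharP (Module.End ℤ A[X]) p := by
    refine ⟨fun x => ?_⟩
    rw [← CharP.cast_eq_zero_iff A[X] p x]
    constructor
    · intro h
      have := LinearMap.congr_fun h 1
      simpa using this
    · intro h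
      ext v
      rw [← nsmul_one, LinearMap.smul_apply, Module.End.one_apply, nsmul_eq_mul, h, zero_mul, LinearMap.zero_apply]
  -- Left and right multiplication by `u` commute, so `ad(u)^(p-1) = (L - R)^(p-1) = ∑ L^i
  -- R^(p-1-i)`. Applied to `u'`, this is the Leibniz expansion of the derivative of `u^p`.
  have hc : Commute (LinearMap.mulLeft ℤ u) (LinearMap.mulRight ℤ u) :=
    LinearMap.ext fun v => (mul_assoc u v u).symm
  have h := sub_pow_pred_of_commute p hodd hc
  have h := LinearMap.congr_fun h (derivative u)
  rw [derivative_pow_eq_sum]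
  have e : ∀ k (v : A[X]), ((LinearMap.mulLeft ℤ u - LinearMap.mulRight ℤ u) ^ k) v =
      (fun v => u * v - v * u)^[k] v := by
    intro k
    induction k with
    | zero => intro v; rfl
    | succ k ih =>
      intro v
      rw [pow_succ, Module.End.mul_apply, ih, Function.iterate_succ_apply]
      rfl
  rw [← e, h, LinearMap.sum_apply]
  refine Finset.sum_congr rfl fun i _ => ?_
  rw [Module.End.mul_apply, LinearMap.pow_mulLeft, LinearMap.pow_mulRight]
  simp [mul_assoc]

/-- Jacobson's formula: the defect of additivity of `x ↦ x^p` lies in every subspace that contains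
`x` and `y` and is closed under commutators. -/
theorem add_pow_sub_mem {K A : Type*} [Field K] [Ring A] [Algebra K A] (p : ℕ) [hp : Fact p.Prime]
    [CharP A p] (hodd : Odd p) (S : Submodule K A)
    (hS : ∀ x ∈ S, ∀ y ∈ S, x * y - y * x ∈ S) {x y : A} (hx : x ∈ S) (hy : y ∈ S) :
    (x + y) ^ p - x ^ p - y ^ p ∈ S := by
  rcases subsingleton_or_nontrivial A with hA | hA
  · rw [Subsingleton.elim ((x + y) ^ p - x ^ p - y ^ p) 0]; exact zero_mem S
  -- The coefficients of the derivative of `(x + X y)^p` are iterated commutators, hence lie in `S`.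
  -- Dividing by `i + 1`, which is invertible for `i + 1 < p`, puts all middle coefficients of `u^p`
  -- in `S`. The extreme ones are `x^p` and `y^p`, and evaluation at `X = 1` gives `(x + y)^p`.
  set u : A[X] := C x + X * C y with hu
  have hdu : derivative u = C y := by simp [hu]
  have hco : ∀ n, ((fun v => u * v - v * u)^[p - 1] (derivative u)).coeff n ∈ S := by
    rw [hdu]
    generalize p - 1 = k
    induction k with
    | zero =>
      intro n
      rw [Function.iterate_zero_apply, coeff_C]
      split_ifs
      · exact hy
      · exact zero_mem S
    | succ k ih =>
      intro n
      rw [Function.iterate_succ_apply']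
      set v := (fun v => u * v - v * u)^[k] (C y)
      have e : u * v - v * u = (C x * v - v * C x) + X * (C y * v - v * C y) := by
        rw [hu, add_mul, mul_add, mul_sub, ← mul_assoc v X, ← X_mul (p := v), mul_assoc, mul_assoc]
        abel
      rw [e, coeff_add, coeff_sub, coeff_C_mul, coeff_mul_C]
      refine add_mem (hS _ hx _ (ih n)) ?_
      cases n with
      | zero => simp
      | succ n =>
        rw [coeff_X_mul, coeff_sub, coeff_C_mul, coeff_mul_C]
        exact hS _ hy _ (ih n)
  rw [← derivative_pow_char p hodd u] at hco
  have hmid : ∀ i, i + 1 < p → (u ^ p).coeff (i + 1) ∈ S := by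
    intro i hi
    have h := hco i
    rw [coeff_derivative] at h
    have hc : CharP K p := (RingHom.charP_iff (algebraMap K A) (algebraMap K A).injective p).2 inferInstance
    have hne : ((i + 1 : ℕ) : K) ≠ 0 := fun h0 =>
      Nat.not_dvd_of_pos_of_lt (Nat.succ_pos i) hi ((CharP.cast_eq_zero_iff K p _).1 h0)
    have h2 := S.smul_mem (((i + 1 : ℕ) : K)⁻¹) h
    have e : (u ^ p).coeff (i + 1) * ((i : A) + 1) = ((i + 1 : ℕ) : K) • (u ^ p).coeff (i + 1) := by
      rw [Nat.cast_smul_eq_nsmul, nsmul_eq_mul, (Nat.cast_commute _ _).eq]; push_cast; rfl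
    rwa [e, smul_smul, inv_mul_cancel₀ hne, one_smul] at h2
  have hdeg : u.natDegree ≤ 1 := by
    rw [hu, X_mul]
    refine (natDegree_add_le _ _).trans (max_le (by simp) (natDegree_mul_le.trans (by simp)))
  have hdp : (u ^ p).natDegree < p + 1 :=
    Nat.lt_succ_of_le ((natDegree_pow_le_of_le p hdeg).trans (by simp))
  have hev : (u ^ p).eval 1 = (x + y) ^ p := by
    have h : ∀ v : A[X], v.eval 1 =
      eval₂RingHom' (RingHom.id A) 1 (fun a => Commute.one_right a) v := fun v => rfl
    rw [h, map_pow, ← h]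
    congr 1
    rw [hu, X_mul]; simp
  have h0 : (u ^ p).coeff 0 = x ^ p := by
    have h : ∀ v : A[X], v.coeff 0 = constantCoeff v := fun v => rfl
    rw [h, map_pow, ← h]
    simp [hu]
  have h1 : (u ^ p).coeff p = y ^ p := by
    have h := coeff_pow_of_natDegree_le (m := p) hdeg
    rw [mul_one] at h
    rw [h, hu, X_mul]; simp [coeff_C]
  rw [← hev, eval_eq_sum_range' hdp]
  simp only [one_pow, mul_one]
  rw [Finset.sum_range_succ, h1]
  obtain ⟨q, hq⟩ : ∃ q, p = q + 1 := ⟨p - 1, by have := hp.out.pos; omega⟩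
  have : ∑ i ∈ Finset.range p, (u ^ p).coeff i =
      ∑ i ∈ Finset.range q, (u ^ p).coeff (i + 1) + x ^ p := by
    rw [← h0]
    conv_lhs => rw [show Finset.range p = Finset.range (q + 1) by rw [hq]]
    exact Finset.sum_range_succ' _ _
  rw [this]
  have : ∑ i ∈ Finset.range q, (u ^ p).coeff (i + 1) + x ^ p + y ^ p - x ^ p - y ^ p =
      ∑ i ∈ Finset.range q, (u ^ p).coeff (i + 1) := by abel
  rw [this]
  exact sum_mem fun i hi => hmid i (by have := Finset.mem_range.1 hi; omega)

/-- A linear map compatible with commutators is compatible with the defect of additivity of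
`x ↦ x^p`. -/
theorem map_pow_add {K A B : Type*} [Field K] [Ring A] [Algebra K A] [Ring B] [Algebra K B] (p : ℕ)
    [hp : Fact p.Prime] [CharP A p] [CharP B p] (hodd : Odd p) (f : B →ₗ[K] A)
    (hf : ∀ x y, f (x * y - y * x) = f x * f y - f y * f x) (x y : B) :
    f (x + y) ^ p - f ((x + y) ^ p) = (f x ^ p - f (x ^ p)) + (f y ^ p - f (y ^ p)) := by
  -- The graph of `f` is closed under commutators in `A × B`, so Jacobson's formula holds inside it
  -- and expresses the defect in `A` as `f` of the defect in `B`.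
  let G : B →ₗ[K] A × B := f.prod LinearMap.id
  have : CharP (A × B) p := Prod.charP A B p
  have h := add_pow_sub_mem p hodd (LinearMap.range G) (by
    rintro _ ⟨a, rfl⟩ _ ⟨b, rfl⟩
    exact ⟨a * b - b * a, Prod.ext (hf a b) rfl⟩) ⟨x, rfl⟩ ⟨y, rfl⟩
  obtain ⟨z, hz⟩ := h
  have h1 : f z = (f x + f y) ^ p - f x ^ p - f y ^ p := congrArg Prod.fst hz
  have h2 : z = (x + y) ^ p - x ^ p - y ^ p := congrArg Prod.snd hz
  rw [h2, map_sub, map_sub] at h1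
  rw [map_add]
  have : (f x + f y) ^ p = f ((x + y) ^ p) - f (x ^ p) - f (y ^ p) + f x ^ p + f y ^ p := by
    rw [h1]; abel
  rw [this]; abel

end Jacobson

/-! ### The spanning half of the PBW theorem. -/

section Spanning

/-- The ordered monomial with exponents `a` along the list `l`. -/
def mono {J R : Type*} [Monoid R] (g : J → R) (l : List J) (a : J → ℕ) : R :=
  (l.map fun j => g j ^ a j).prod

@[simp]
theorem mono_nil {J R : Type*} [Monoid R] (g : J → R) (a : J → ℕ) : mono g [] a = 1 := rfl

theorem mono_cons {J R : Type*} [Monoid R] (g : J → R) (j : J) (l : List J) (a : J → ℕ) :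
    mono g (j :: l) a = g j ^ a j * mono g l a := by
  simp [mono]

theorem mono_append {J R : Type*} [Monoid R] (g : J → R) (l l' : List J) (a : J → ℕ) :
    mono g (l ++ l') a = mono g l a * mono g l' a := by
  simp [mono]

theorem mono_map {J J' R : Type*} [Monoid R] (g : J' → R) (q : J → J') (l : List J) (a : J' → ℕ) :
    mono g (l.map q) a = mono (g ∘ q) l (a ∘ q) := by
  simp [mono, Function.comp_def]

theorem map_mono {J R R' : Type*} [Monoid R] [Monoid R'] (f : R →* R') (g : J → R) (l : List J)
    (a : J → ℕ) : f (mono g l a) = mono (f ∘ g) l a := by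
  simp [mono, map_list_prod, Function.comp_def]

variable {K R J : Type*} [Field K] [Ring R] [Algebra K R] (g : J → R)

/-- The span of the products of at most `k` generators. -/
def wordSpan (K : Type*) [Field K] [Algebra K R] (k : ℕ) : Submodule K R :=
  Submodule.span K {x | ∃ w : List J, w.length ≤ k ∧ x = (w.map g).prod}

theorem word_mem_wordSpan {w : List J} {k : ℕ} (h : w.length ≤ k) :
    (w.map g).prod ∈ wordSpan g K k :=
  Submodule.subset_span ⟨w, h, rfl⟩

theorem wordSpan_mono {k l : ℕ} (h : k ≤ l) : wordSpan g K k ≤ wordSpan g K l :=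
  Submodule.span_mono fun _ ⟨w, hw, e⟩ => ⟨w, hw.trans h, e⟩

theorem wordSpan_mul {k l : ℕ} {x y : R} (hx : x ∈ wordSpan g K k) (hy : y ∈ wordSpan g K l) :
    x * y ∈ wordSpan g K (k + l) := by
  have h := Submodule.mul_mem_mul hx hy
  rw [wordSpan, wordSpan, Submodule.span_mul_span] at h
  refine Submodule.span_mono ?_ h
  rintro _ ⟨_, ⟨w, hw, rfl⟩, _, ⟨w', hw', rfl⟩, rfl⟩
  exact ⟨w ++ w', by simp; omega, by simp⟩

/-- Swapping two adjacent letters costs a scalar and a shorter word, so straightening changes a word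
only by lower terms. -/
theorem word_perm
    (h1 : ∀ i j, ∃ s : K, g i * g j - s • (g j * g i) ∈ wordSpan g K 1)
    {w w' : List J} (h : w.Perm w') :
    ∃ s : K, (w.map g).prod - s • (w'.map g).prod ∈ wordSpan g K (w.length - 1) := by
  induction h with
  | nil => exact ⟨1, by simp⟩
  | @cons x l l' hl ih =>
    rcases l with _ | ⟨y, l⟩
    · have := hl.nil_eq; subst this
      exact ⟨1, by simp⟩
    · obtain ⟨s, hs⟩ := ih
      refine ⟨s, ?_⟩
      have := wordSpan_mul g (word_mem_wordSpan (K := K) g (w := [x]) le_rfl) hs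
      simp only [List.map_cons, List.prod_cons, List.map_nil, List.prod_nil, mul_one, mul_sub, mul_smul_comm] at this ⊢
      exact wordSpan_mono g (by simp; omega) this
  | swap x y l =>
    obtain ⟨s, hs⟩ := h1 y x
    refine ⟨s, ?_⟩
    have := wordSpan_mul g hs (word_mem_wordSpan (K := K) g (w := l) le_rfl)
    simp only [List.map_cons, List.prod_cons, sub_mul, smul_mul_assoc, mul_assoc] at this ⊢
    exact wordSpan_mono g (by simp; omega) this
  | trans h h' ih ih' =>
    obtain ⟨s, hs⟩ := ih
    obtain ⟨s', hs'⟩ := ih'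
    refine ⟨s * s', ?_⟩
    rw [← h.length_eq] at hs'
    have := add_mem hs (Submodule.smul_mem _ s hs')
    rwa [smul_sub, smul_smul, sub_add_sub_cancel] at this

theorem mono_eq_word (l : List J) (a : J → ℕ) :
    mono g l a = ((l.flatMap fun j => List.replicate (a j) j).map g).prod := by
  induction l with
  | nil => rfl
  | cons j l ih => rw [mono_cons, ih]; simp

theorem count_flatMap_replicate [DecidableEq J] (l : List J) (hl : l.Nodup) (a : J → ℕ) (i : J)
    (hi : i ∈ l) : (l.flatMap fun j => List.replicate (a j) j).count i = a i := by
  induction l with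
  | nil => simp at hi
  | cons j l ih =>
    rw [List.flatMap_cons, List.count_append, List.count_replicate]
    obtain ⟨hj, hl⟩ := List.nodup_cons.1 hl
    by_cases h : j = i
    · subst h
      have : (l.flatMap fun k => List.replicate (a k) k).count j = 0 := by
        rw [List.count_eq_zero]
        intro hm
        obtain ⟨k, hk, hjk⟩ := List.mem_flatMap.1 hm
        exact hj ((List.mem_replicate.1 hjk).2 ▸ hk)
      simp [this]
    · rw [ih hl ((List.mem_cons.1 hi).resolve_left fun e => h e.symm)]
      simp [h]

/-- If the generators commute up to scalars and lower terms, and the `m j`-th power of the `j`-th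
generator is a lower term, then the ordered monomials with exponents below `m j` span the
subalgebra generated by the generators. -/
theorem wordSpan_le_span_mono (m : J → ℕ) (hm : ∀ j, 2 ≤ m j)
    (h1 : ∀ i j, ∃ s : K, g i * g j - s • (g j * g i) ∈ wordSpan g K 1)
    (h2 : ∀ j, g j ^ m j ∈ wordSpan g K 1) (l : List J) (hl : l.Nodup) (hl' : ∀ j, j ∈ l) (k : ℕ) :
    wordSpan g K k ≤ Submodule.span K (Set.range fun a : (j : J) → Fin (m j) =>
      mono g l fun j => a j) := by
  classical
  set S := Submodule.span K (Set.range fun a : (j : J) → Fin (m j) => mono g l fun j => a j)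
  induction k with
  | zero =>
    refine Submodule.span_le.2 ?_
    rintro _ ⟨w, hw, rfl⟩
    obtain rfl := List.length_eq_zero_iff.1 (Nat.le_zero.1 hw)
    refine Submodule.subset_span ⟨fun j => ⟨0, by have := hm j; omega⟩, ?_⟩
    simp [mono]
  | succ k ih =>
    refine Submodule.span_le.2 ?_
    rintro _ ⟨w, hw, rfl⟩
    have hlow : ∀ w', w.Perm w' → (w'.map g).prod ∈ S → (w.map g).prod ∈ S := by
      intro w' hp h
      obtain ⟨s, hs⟩ := word_perm g h1 hp
      have := add_mem (ih (wordSpan_mono g (by omega) hs)) (S.smul_mem s h)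
      rwa [sub_add_cancel] at this
    by_cases hc : ∀ j, w.count j < m j
    · refine hlow (l.flatMap fun j => List.replicate (w.count j) j) ?_ ?_
      · rw [List.perm_iff_count]
        intro i
        rw [count_flatMap_replicate l hl _ i (hl' i)]
      · rw [← mono_eq_word]
        exact Submodule.subset_span ⟨fun j => ⟨w.count j, hc j⟩, rfl⟩
    · push Not at hc
      -- A letter that occurs too often is collected at the front. Its `m j`-th power is a
      -- combination of words of length at most one, so the word gets shorter because `m j ≥ 2`.
      obtain ⟨j, hj⟩ := hc
      obtain ⟨r, hr⟩ := (List.replicate_sublist_iff.2 hj).exists_perm_append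
      refine hlow _ hr (ih ?_)
      rw [List.map_append, List.prod_append, List.map_replicate, List.prod_replicate]
      have hlen := hr.length_eq
      rw [List.length_append, List.length_replicate] at hlen
      refine wordSpan_mono g ?_ (wordSpan_mul g (h2 j) (word_mem_wordSpan g le_rfl))
      have := hm j
      omega

theorem adjoin_le_wordSpan {x : R} (hx : x ∈ Algebra.adjoin K (Set.range g)) :
    ∃ k, x ∈ wordSpan g K k := by
  induction hx using Algebra.adjoin_induction with
  | mem x hx =>
    obtain ⟨j, rfl⟩ := hx
    exact ⟨1, Submodule.subset_span ⟨[j], by simp, by simp⟩⟩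
  | algebraMap r =>
    refine ⟨0, ?_⟩
    rw [Algebra.algebraMap_eq_smul_one]
    exact Submodule.smul_mem _ _ (Submodule.subset_span ⟨[], by simp, by simp⟩)
  | add x y _ _ hx hy =>
    obtain ⟨k, hk⟩ := hx
    obtain ⟨l, hl⟩ := hy
    exact ⟨max k l, add_mem (wordSpan_mono g (le_max_left _ _) hk)
      (wordSpan_mono g (le_max_right _ _) hl)⟩
  | mul x y _ _ hx hy =>
    obtain ⟨k, hk⟩ := hx
    obtain ⟨l, hl⟩ := hy
    exact ⟨k + l, wordSpan_mul g hk hl⟩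

theorem span_mono_eq_top (m : J → ℕ) (hm : ∀ j, 2 ≤ m j)
    (h1 : ∀ i j, ∃ s : K, g i * g j - s • (g j * g i) ∈ wordSpan g K 1)
    (h2 : ∀ j, g j ^ m j ∈ wordSpan g K 1) (l : List J) (hl : l.Nodup) (hl' : ∀ j, j ∈ l)
    (hg : Algebra.adjoin K (Set.range g) = ⊤) :
    Submodule.span K (Set.range fun a : (j : J) → Fin (m j) => mono g l fun j => a j) = ⊤ := by
  rw [eq_top_iff]
  intro x _
  have hx : x ∈ Algebra.adjoin K (Set.range g) := hg ▸ Algebra.mem_top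
  obtain ⟨k, hk⟩ := adjoin_le_wordSpan g hx
  exact wordSpan_le_span_mono g m hm h1 h2 l hl hl' k hk

end Spanning
-- Products with maximal exponents, and the submodules that contain them.
section Socle

variable {K R J : Type*} [Field K] [Ring R] [Algebra K R] (g : J → R) (m : J → ℕ)

/-- Any two entries of the list commute up to a nonzero scalar and a combination of the entries
strictly between them. -/
def Conv (K : Type*) [Field K] [Algebra K R] : List J → Prop
  | [] => True
  | j :: L => Conv K L ∧ ∀ M z post, L = M ++ z :: post → ∃ s : K, s ≠ 0 ∧
      g z * g j - s • (g j * g z) ∈ Submodule.span K (g '' {k | k ∈ M})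

variable {g}

theorem Conv.of_append {L L' : List J} (h : Conv g K (L ++ L')) : Conv g K L := by
  induction L with
  | nil => trivial
  | cons j L ih => exact ⟨ih h.1, fun M z post e => h.2 M z (post ++ L') (by simp [e])⟩

/-- The ordered monomial with the largest exponents. -/
def topMono (g : J → R) (m : J → ℕ) (L : List J) : R := mono g L fun j => m j - 1

/-- Moving an entry `g k` of the tail past `g j` leaves, up to scalars, entries between `j` and `k`.
These lie in the tail again, so induction on the power of `g j` reduces everything to the
annihilation of the top monomial of the tail. -/
theorem span_mul_pow_mul_topMono {j : J} {L : List J} (hC : Conv g K (j :: L))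
    (hL : ∀ k ∈ L, g k * topMono g m L = 0) (t : ℕ) {x : R}
    (hx : x ∈ Submodule.span K (g '' {k | k ∈ L})) : x * (g j ^ t * topMono g m L) = 0 := by
  induction t generalizing x with
  | zero =>
    induction hx using Submodule.span_induction with
    | mem x hx => obtain ⟨k, hk, rfl⟩ := hx; rw [pow_zero, one_mul]; exact hL k hk
    | zero => rw [zero_mul]
    | add x y _ _ hx hy => rw [add_mul, hx, hy, add_zero]
    | smul a x _ hx => rw [smul_mul_assoc, hx, smul_zero]
  | succ t ih =>
    induction hx using Submodule.span_induction with
    | mem x hx =>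
      obtain ⟨k, hk, rfl⟩ := hx
      obtain ⟨M, post, rfl⟩ := List.append_of_mem (Set.mem_ofPred_eq ▸ hk)
      obtain ⟨s, -, hs⟩ := hC.2 M k post rfl
      have h1 := ih (Submodule.span_mono (Set.image_mono fun i hi => by
        simp only [Set.mem_ofPred_eq] at hi ⊢; simp [hi]) hs)
      have h2 := ih (Submodule.subset_span ⟨k, hk, rfl⟩)
      rw [sub_mul, smul_mul_assoc, mul_assoc (g j), h2, mul_zero, smul_zero, sub_zero] at h1
      rw [pow_succ', mul_assoc, ← mul_assoc (g k)]
      exact h1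
    | zero => rw [zero_mul]
    | add x y _ _ hx hy => rw [add_mul, hx, hy, add_zero]
    | smul a x _ hx => rw [smul_mul_assoc, hx, smul_zero]

theorem mul_topMono_eq_zero (hm : ∀ j, 2 ≤ m j) (hg : ∀ j, g j ^ m j = 0) {L : List J}
    (hC : Conv g K L) : ∀ k ∈ L, g k * topMono g m L = 0 := by
  induction L with
  | nil => simp
  | cons j L ih =>
    intro k hk
    have e : topMono g m (j :: L) = g j ^ (m j - 1) * topMono g m L := mono_cons _ _ _ _
    rw [e]
    rcases List.mem_cons.1 hk with rfl | hk
    · rw [← mul_assoc, ← pow_succ', Nat.sub_add_cancel (by have := hm k; omega), hg, zero_mul]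
    · exact span_mul_pow_mul_topMono m hC (ih hC.1) _ (Submodule.subset_span ⟨k, hk, rfl⟩)

/-- Each exchange of `g z` with an entry of `L` has an error spanned by later entries of `L`, and
such errors are annihilated by the previous lemmas. The surviving scalar is a product of nonzero
ones. -/
theorem mul_topMono_comm (hm : ∀ j, 2 ≤ m j) (hg : ∀ j, g j ^ m j = 0) {L : List J} {z : J}
    (hC : Conv g K (L ++ [z])) :
    ∃ s : K, s ≠ 0 ∧ g z * topMono g m L = s • (topMono g m L * g z) := by
  induction L with
  | nil => exact ⟨1, one_ne_zero, by simp [topMono]⟩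
  | cons j L ih =>
    have e : topMono g m (j :: L) = g j ^ (m j - 1) * topMono g m L := mono_cons _ _ _ _
    obtain ⟨s, hs, h⟩ := ih hC.1
    obtain ⟨s', hs', h'⟩ := hC.2 L z [] rfl
    have hC' : Conv g K (j :: L) := Conv.of_append hC
    have key : ∀ t, g z * (g j ^ t * topMono g m L) = s' ^ t • (g j ^ t * (g z * topMono g m L)) := by
      intro t
      induction t with
      | zero => simp
      | succ t ih =>
        have h1 := span_mul_pow_mul_topMono m hC'
          (mul_topMono_eq_zero m hm hg hC'.1) t h'
        rw [sub_mul, sub_eq_zero, smul_mul_assoc, mul_assoc (g j), ih] at h1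
        rw [pow_succ' (g j), mul_assoc, ← mul_assoc (g z), h1, mul_smul_comm, smul_smul, pow_succ',
          mul_assoc]
    refine ⟨s' ^ (m j - 1) * s, mul_ne_zero (pow_ne_zero _ hs') hs, ?_⟩
    rw [e, key, h, mul_smul_comm, smul_smul, mul_assoc]

variable {M : Type*} [AddCommGroup M] [Module K M] [Module R M] [IsScalarTower K R M]

/-- The combinations of ordered monomials along the list with coefficients in `V`. -/
def monoSpan (g : J → R) (m : J → ℕ) (V : Submodule K M) : List J → Submodule K M
  | [] => V
  | j :: L =>
    { carrier := {x | ∃ y : ℕ → M, (∀ k, y k ∈ monoSpan g m V L) ∧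
        x = ∑ k ∈ Finset.range (m j), g j ^ k • y k}
      add_mem' := by
        rintro _ _ ⟨y, hy, rfl⟩ ⟨y', hy', rfl⟩
        exact ⟨y + y', fun k => add_mem (hy k) (hy' k), by simp [Finset.sum_add_distrib]⟩
      zero_mem' := ⟨0, fun _ => zero_mem _, by simp⟩
      smul_mem' := by
        rintro c _ ⟨y, hy, rfl⟩
        refine ⟨c • y, fun k => Submodule.smul_mem _ c (hy k), ?_⟩
        rw [Finset.smul_sum]
        refine Finset.sum_congr rfl fun k _ => ?_
        rw [Pi.smul_apply, ← algebraMap_smul R c (y k), ← algebraMap_smul R c (_ • y k), smul_smul,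
          smul_smul, Algebra.commutes] }

theorem mono_smul_mem_monoSpan (V : Submodule K M) {v : M} (hv : v ∈ V) (L : List J) (a : J → ℕ)
    (ha : ∀ j, a j < m j) : mono g L a • v ∈ monoSpan g m V L := by
  induction L with
  | nil => simpa [monoSpan] using hv
  | cons j L ih =>
    refine ⟨Pi.single (a j) (mono g L a • v), fun k => ?_, ?_⟩
    · by_cases h : k = a j
      · subst h; rw [Pi.single_eq_same]; exact ih
      · rw [Pi.single_eq_of_ne h]; exact zero_mem _
    · rw [Finset.sum_eq_single (a j), Pi.single_eq_same, mono_cons, mul_smul]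
      · intro k _ h; rw [Pi.single_eq_of_ne h, smul_zero]
      · intro h; exact absurd (Finset.mem_range.2 (ha j)) h

/-- Every submodule that contains a nonzero combination of ordered monomials contains a nonzero
element of the form `topMono • v`. -/
theorem exists_topMono_smul_mem (hm : ∀ j, 2 ≤ m j) (hg : ∀ j, g j ^ m j = 0)
    (N : Submodule R M) (V : Submodule K M) (Q P : List J) (hC : Conv g K (P ++ Q)) {x : M}
    (hx : x ∈ monoSpan g m V Q) (hx0 : x ≠ 0) (hN : topMono g m P • x ∈ N) :
    ∃ v ∈ V, v ≠ 0 ∧ topMono g m (P ++ Q) • v ∈ N := by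
  classical
  induction Q generalizing P x with
  | nil => exact ⟨x, hx, hx0, by simpa using hN⟩
  | cons j Q ih =>
    obtain ⟨y, hy, rfl⟩ := hx
    have hex : ∃ k, k < m j ∧ y k ≠ 0 := by
      by_contra hcon
      push Not at hcon
      exact hx0 (Finset.sum_eq_zero fun k hk => by
        rw [hcon k (Finset.mem_range.1 hk), smul_zero])
    -- With `k` the least exponent whose coefficient is nonzero, multiplication by `g j ^ (m j - 1 -
    -- k)` raises that term to the exponent `m j - 1` and kills all higher ones. The same power
    -- passes the prefix `topMono P` at the cost of a nonzero scalar.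
    obtain ⟨hk, hk0⟩ := Nat.find_spec hex
    set k := Nat.find hex
    have hlt : ∀ i < k, y i = 0 := fun i hi => by
      by_contra h
      exact Nat.find_min hex hi ⟨hi.trans hk, h⟩
    have hP : P ++ j :: Q = (P ++ [j]) ++ Q := by simp
    rw [hP] at hC ⊢
    obtain ⟨s, hs, hcomm⟩ := mul_topMono_comm m hm hg hC.of_append
    have hpow : ∀ t, g j ^ t * topMono g m P = s ^ t • (topMono g m P * g j ^ t) := by
      intro t
      induction t with
      | zero => simp
      | succ t ih =>
        rw [pow_succ', mul_assoc, ih, mul_smul_comm, ← mul_assoc, hcomm, smul_mul_assoc, smul_smul,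
          mul_assoc, ← pow_succ', ← pow_succ]
    refine ih (P ++ [j]) hC (hy k) hk0 ?_
    have h1 := N.smul_mem (g j ^ (m j - 1 - k)) hN
    have h2 : g j ^ (m j - 1 - k) • ∑ i ∈ Finset.range (m j), g j ^ i • y i =
        g j ^ (m j - 1) • y k := by
      rw [Finset.smul_sum, Finset.sum_eq_single k]
      · rw [smul_smul, ← pow_add]; congr 2; omega
      · intro i hi hik
        rcases lt_or_gt_of_ne hik with h | h
        · rw [hlt i h, smul_zero, smul_zero]
        · rw [smul_smul, ← pow_add, show m j - 1 - k + i = m j + (i - 1 - k) by omega, pow_add, hg,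
            zero_mul, zero_smul]
      · intro h; exact absurd (Finset.mem_range.2 hk) h
    rw [smul_smul, hpow, ← algebraMap_smul R, smul_eq_mul, mul_smul, mul_smul, h2] at h1
    have h3 := N.smul_mem (algebraMap K R (s ^ (m j - 1 - k))⁻¹) h1
    rw [smul_smul, ← map_mul, inv_mul_cancel₀ (pow_ne_zero _ hs), map_one, one_smul] at h3
    rw [topMono, mono_append, mul_smul]
    simpa [topMono, mono] using h3

/-- A list is convex if it is sorted by a key and commutators are combinations of generators with
keys in between. -/
theorem conv_of_pairwise {ι : Type*} [LinearOrder ι] (key : J → ι) (L : List J)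
    (hs : L.Pairwise fun i j => key j < key i)
    (h : ∀ i ∈ L, ∀ j ∈ L, key i < key j → ∃ s : K, s ≠ 0 ∧ g i * g j - s • (g j * g i) ∈
      Submodule.span K (g '' {k | k ∈ L ∧ key i < key k ∧ key k < key j})) : Conv g K L := by
  suffices H : ∀ Q P, L = P ++ Q → Conv g K Q from H L [] rfl
  intro Q
  induction Q with
  | nil => intro _ _; trivial
  | cons j Q ih =>
    intro P hP
    refine ⟨ih (P ++ [j]) (by simp [hP]), ?_⟩
    rintro M z post rfl
    subst hP
    have hs1 := List.pairwise_append.1 hs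
    have hs2 := List.pairwise_cons.1 hs1.2.1
    have hs3 := List.pairwise_append.1 hs2.2
    obtain ⟨s, hs0, hsp⟩ := h z (by simp) j (by simp) (hs2.1 z (by simp))
    refine ⟨s, hs0, Submodule.span_mono (Set.image_mono ?_) hsp⟩
    rintro k ⟨hk, h1, h2⟩
    rcases List.mem_append.1 hk with hk | hk
    · exact absurd (hs1.2.2 k hk j (by simp)) (not_lt_of_gt h2)
    · rcases List.mem_cons.1 hk with rfl | hk
      · exact absurd h2 (lt_irrefl _)
      · rcases List.mem_append.1 hk with hk | hk
        · exact hk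
        · rcases List.mem_cons.1 hk with rfl | hk
          · exact absurd h1 (lt_irrefl _)
          · exact absurd ((List.pairwise_cons.1 hs3.2.1).1 k hk) (not_lt_of_gt h1)

end Socle

/-! ### Fock representations and independence of perturbed raising operators. -/

section Fock

/-- The sign `(-1)^(s t)` for two parities, `true` being odd. -/
def sg (K : Type*) [Field K] (s t : Bool) : K := if s = true ∧ t = true then -1 else 1

theorem sg_ne_zero (K : Type*) [Field K] (s t : Bool) : sg K s t ≠ 0 := by
  unfold sg; split_ifs <;> simp

theorem sg_comm (K : Type*) [Field K] (s t : Bool) : sg K s t = sg K t s := by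
  unfold sg; simp [and_comm]

/-- The exclusive bound for the exponents of a generator of the given parity in a restricted
monomial. -/
def bd (p : ℕ) (s : Bool) : ℕ := if s then 2 else p

theorem two_le_bd {p : ℕ} (hp : 2 < p) (s : Bool) : 2 ≤ bd p s := by
  unfold bd; split_ifs <;> omega

/-- A representation of the canonical (anti)commutation relations with a vacuum vector, in which
the `p`-th powers of the even raising and lowering operators vanish. -/
structure Fock (K : Type*) [Field K] (p : ℕ) (I : Type*) [DecidableEq I] (F : Type*)
    [AddCommGroup F] [Module K F] where
  /-- raising operators -/
  y : Bool × I → Module.End K F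
  /-- lowering operators -/
  d : Bool × I → Module.End K F
  /-- the vacuum -/
  vac : F
  vac_ne : vac ≠ 0
  d_vac : ∀ a, d a vac = 0
  d_y : ∀ a b, d a * y b = sg K a.1 b.1 • (y b * d a) + if a = b then 1 else 0
  y_y : ∀ a b, y a * y b = sg K a.1 b.1 • (y b * y a)
  d_d : ∀ a b, d a * d b = sg K a.1 b.1 • (d b * d a)
  y_pow : ∀ i, y (false, i) ^ p = 0
  d_pow : ∀ i, d (false, i) ^ p = 0

namespace Fock

variable {K : Type*} [Field K] {p : ℕ} {I : Type*} [DecidableEq I] {F : Type*}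
    [AddCommGroup F] [Module K F] (φ : Fock K p I F)

/-- The vectors killed by all products of `k` lowering operators. -/
def fil : ℕ → Submodule K F
  | 0 => ⊥
  | k + 1 => ⨅ a, (fil k).comap (φ.d a)

theorem mem_fil_succ {k : ℕ} {w : F} : w ∈ φ.fil (k + 1) ↔ ∀ a, φ.d a w ∈ φ.fil k := by
  simp [fil]

theorem fil_le_succ (k : ℕ) : φ.fil k ≤ φ.fil (k + 1) := by
  induction k with
  | zero => exact bot_le
  | succ k ih =>
    intro w hw
    rw [mem_fil_succ] at hw ⊢
    exact fun a => ih (hw a)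

theorem d_mem_fil {k : ℕ} {w : F} (hw : w ∈ φ.fil k) (a) : φ.d a w ∈ φ.fil (k - 1) := by
  cases k with
  | zero => rw [(Submodule.mem_bot K).1 hw, map_zero]; exact zero_mem _
  | succ k => exact (φ.mem_fil_succ.1 hw) a

theorem d_y_apply (a b) (w : F) :
    φ.d a (φ.y b w) = sg K a.1 b.1 • φ.y b (φ.d a w) + if a = b then w else 0 := by
  have := LinearMap.congr_fun (φ.d_y a b) w
  rw [Module.End.mul_apply] at this
  rw [this]
  split_ifs <;> simp

/-- The space `fil k` plays the role of the vectors of degree less than `k`; by the commutation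
relations a raising operator increases the degree by at most one. -/
theorem y_mem_fil {k : ℕ} {w : F} (hw : w ∈ φ.fil k) (b) : φ.y b w ∈ φ.fil (k + 1) := by
  induction k generalizing w with
  | zero => rw [(Submodule.mem_bot K).1 hw, map_zero]; exact zero_mem _
  | succ k ih =>
    rw [mem_fil_succ]
    intro a
    rw [d_y_apply]
    refine add_mem (Submodule.smul_mem _ _ (ih (φ.mem_fil_succ.1 hw a))) ?_
    split_ifs
    · exact hw
    · exact zero_mem _

theorem vac_mem_fil : φ.vac ∈ φ.fil 1 := by
  rw [mem_fil_succ]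
  intro a
  rw [d_vac]; exact zero_mem _

variable {J : Type*} (q : J → Bool × I)

/-- The product of powers of lowering operators, in the reverse order of the list. -/
def low (a : J → ℕ) : List J → Module.End K F
  | [] => 1
  | j :: l => low a l * φ.d (q j) ^ a j

theorem low_mem_fil (a : J → ℕ) (l : List J) {k : ℕ} {w : F} (hw : w ∈ φ.fil k) :
    φ.low q a l w ∈ φ.fil (k - (l.map a).sum) := by
  have hpow : ∀ (b) (t k : ℕ) (w : F), w ∈ φ.fil k → (φ.d b ^ t) w ∈ φ.fil (k - t) := by
    intro b t
    induction t with
    | zero => intro k w hw; simpa using hw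
    | succ t ih =>
      intro k w hw
      rw [pow_succ, Module.End.mul_apply, show k - (t + 1) = k - 1 - t by omega]
      exact ih _ _ (φ.d_mem_fil hw b)
  induction l generalizing k w with
  | nil => simpa [low] using hw
  | cons j l ih =>
    rw [low, Module.End.mul_apply, List.map_cons, List.sum_cons, Nat.sub_add_eq]
    exact ih (hpow _ _ _ _ hw)

theorem low_eq_zero (a : J → ℕ) (l : List J) {k : ℕ} {w : F} (hw : w ∈ φ.fil k)
    (hk : k ≤ (l.map a).sum) : φ.low q a l w = 0 := by
  have := φ.low_mem_fil q a l hw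
  rw [Nat.sub_eq_zero_of_le hk] at this
  exact (Submodule.mem_bot K).1 this

/-- The coefficient of `y^(b-1)` in the commutator of `d` and `y^b`. -/
def kap (K : Type*) [Field K] (s : Bool) (b : ℕ) : K := ∑ i ∈ Finset.range b, sg K s s ^ i

theorem kap_succ (s : Bool) (b : ℕ) : kap K s (b + 1) = sg K s s * kap K s b + 1 := by
  rw [kap, Finset.sum_range_succ', pow_zero, kap, Finset.mul_sum]
  simp_rw [pow_succ']

/-- For an odd index only `b = 1` is below the bound, and the sum is `1`. For an even index the sum
is the integer `b`, nonzero modulo `p` since `0 < b < p`. -/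
theorem kap_ne_zero [CharP K p] (s : Bool) {b : ℕ} (hb : 0 < b) (hb' : b < bd p s) :
    kap K s b ≠ 0 := by
  cases s with
  | true =>
    have : b = 1 := by have : b < 2 := hb'; omega
    simp [kap, this]
  | false =>
    have hb' : b < p := hb'
    have : kap K false b = b := by simp [kap, sg]
    rw [this]
    exact fun h => Nat.not_dvd_of_pos_of_lt hb hb' ((CharP.cast_eq_zero_iff K p b).1 h)

theorem d_y_pow (a) (b : ℕ) {w : F} (hw : φ.d a w = 0) :
    φ.d a ((φ.y a ^ b) w) = kap K a.1 b • (φ.y a ^ (b - 1)) w := by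
  induction b with
  | zero => simp [kap, hw]
  | succ b ih =>
    rw [pow_succ', Module.End.mul_apply, d_y_apply, ih, if_pos rfl, kap_succ, add_smul, one_smul,
      Nat.add_sub_cancel]
    congr 1
    cases b with
    | zero => simp [kap]
    | succ b =>
      rw [map_smul, smul_smul, Nat.add_sub_cancel, ← Module.End.mul_apply, ← pow_succ']

theorem d_pow_y_pow [CharP K p] (a) (k : ℕ) {b : ℕ} (hb : b < bd p a.1) {w : F} (hw : φ.d a w = 0) :
    ∃ c : K, c ≠ 0 ∧ (φ.d a ^ k) ((φ.y a ^ b) w) = if k ≤ b then c • (φ.y a ^ (b - k)) w else 0 := by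
  induction k with
  | zero => exact ⟨1, one_ne_zero, by simp⟩
  | succ k ih =>
    obtain ⟨c, hc, h⟩ := ih
    rw [pow_succ', Module.End.mul_apply, h]
    by_cases hkb : k + 1 ≤ b
    · refine ⟨c * kap K a.1 (b - k), mul_ne_zero hc (kap_ne_zero (p := p) _ (by omega) (by omega)), ?_⟩
      rw [if_pos (by omega), if_pos hkb, map_smul, d_y_pow φ a _ hw, smul_smul]
      rfl
    · refine ⟨1, one_ne_zero, ?_⟩
      rw [if_neg hkb]
      split_ifs with h'
      · rw [show b - k = 0 by omega]; simp [hw]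
      · simp

theorem d_mono_vac (a) (b : J → ℕ) (l : List J) (ha : ∀ j ∈ l, a ≠ q j) :
    φ.d a (mono (φ.y ∘ q) l b φ.vac) = 0 := by
  induction l with
  | nil => simp [d_vac]
  | cons j l ih =>
    rw [mono_cons, Module.End.mul_apply]
    have h0 := ih fun i hi => ha i (List.mem_cons_of_mem _ hi)
    have : ∀ (t : ℕ) (w : F), φ.d a w = 0 → φ.d a ((φ.y (q j) ^ t) w) = 0 := by
      intro t
      induction t with
      | zero => intro w hw; simpa using hw
      | succ t ih =>
        intro w hw
        rw [pow_succ', Module.End.mul_apply, d_y_apply, ih w hw, if_neg (ha j (by simp))]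
        simp
    exact this _ _ h0

theorem exists_mul_pow_eq_smul {A : Type*} [Ring A] [Algebra K A] {x y : A}
    (h : ∃ s : K, x * y = s • (y * x)) (t : ℕ) : ∃ s : K, x * y ^ t = s • (y ^ t * x) := by
  obtain ⟨s, h⟩ := h
  induction t with
  | zero => exact ⟨1, by simp⟩
  | succ t ih =>
    obtain ⟨r, hr⟩ := ih
    refine ⟨r * s, ?_⟩
    rw [pow_succ, ← mul_assoc, hr, smul_mul_assoc, mul_assoc, h, mul_smul_comm, smul_smul, mul_assoc]

theorem exists_pow_mul_eq_smul {A : Type*} [Ring A] [Algebra K A] {x y : A}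
    (h : ∃ s : K, x * y = s • (y * x)) (t : ℕ) : ∃ s : K, x ^ t * y = s • (y * x ^ t) := by
  obtain ⟨s, h⟩ := h
  induction t with
  | zero => exact ⟨1, by simp⟩
  | succ t ih =>
    obtain ⟨r, hr⟩ := ih
    refine ⟨s * r, ?_⟩
    rw [pow_succ, mul_assoc, h, mul_smul_comm, ← mul_assoc, hr, smul_mul_assoc, smul_smul, mul_assoc]

theorem low_y (a : J → ℕ) (b) (t : ℕ) (l : List J) (hb : ∀ j ∈ l, q j ≠ b) {w : F}
    (hw : φ.low q a l w = 0) : φ.low q a l ((φ.y b ^ t) w) = 0 := by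
  have h1 : ∀ (c), c ≠ b → ∃ s : K, φ.d c * φ.y b = s • (φ.y b * φ.d c) := fun c hc =>
    ⟨sg K c.1 b.1, by rw [d_y, if_neg hc, add_zero]⟩
  have h2 : ∃ s : K, φ.low q a l * φ.y b ^ t = s • (φ.y b ^ t * φ.low q a l) := by
    clear hw
    refine exists_mul_pow_eq_smul ?_ t
    induction l with
    | nil => exact ⟨1, by simp [low]⟩
    | cons j l ih =>
      obtain ⟨s, hs⟩ := ih fun i hi => hb i (List.mem_cons_of_mem _ hi)
      obtain ⟨r, hr⟩ := exists_pow_mul_eq_smul (h1 (q j) (hb j (by simp))) (a j)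
      refine ⟨r * s, ?_⟩
      rw [low, mul_assoc, hr, mul_smul_comm, ← mul_assoc, hs, smul_mul_assoc, smul_smul, mul_assoc]
  obtain ⟨s, hs⟩ := h2
  have := LinearMap.congr_fun hs w
  simpa [hw] using this

/-- Distinct indices commute up to sign, so the lowering operators act on one variable at a time,
and one of them is applied more often than its variable occurs. Together with `low_mono_self` this
makes the pairing between lowering and raising monomials of equal total degree diagonal. -/
theorem low_mono_eq_zero [CharP K p] (hq : Function.Injective q) (a b : J → ℕ)
    (hb : ∀ j, b j < bd p (q j).1) (l : List J) (hl : l.Nodup) (h : ∃ j ∈ l, b j < a j) :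
    φ.low q a l (mono (φ.y ∘ q) l b φ.vac) = 0 := by
  induction l with
  | nil => simp at h
  | cons j l ih =>
    obtain ⟨hj, hl⟩ := List.nodup_cons.1 hl
    have hne : ∀ i ∈ l, q i ≠ q j := fun i hi e => hj (hq e ▸ hi)
    obtain ⟨c, hc, hd⟩ := φ.d_pow_y_pow (q j) (a j) (hb j)
      (φ.d_mono_vac q (q j) b l fun i hi => (hne i hi).symm)
    rw [low, mono_cons, Module.End.mul_apply, Module.End.mul_apply, Function.comp_apply, hd]
    split_ifs with hab
    · rw [map_smul, φ.low_y q a _ _ l hne, smul_zero]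
      refine ih hl ?_
      obtain ⟨i, hi, hlt⟩ := h
      rcases List.mem_cons.1 hi with rfl | hi
      · omega
      · exact ⟨i, hi, hlt⟩
    · rw [map_zero]

theorem low_mono_self [CharP K p] (hq : Function.Injective q) (a : J → ℕ)
    (ha : ∀ j, a j < bd p (q j).1) (l : List J) (hl : l.Nodup) :
    φ.low q a l (mono (φ.y ∘ q) l a φ.vac) ≠ 0 := by
  induction l with
  | nil => simpa [low] using φ.vac_ne
  | cons j l ih =>
    obtain ⟨hj, hl⟩ := List.nodup_cons.1 hl
    have hne : ∀ i ∈ l, q i ≠ q j := fun i hi e => hj (hq e ▸ hi)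
    obtain ⟨c, hc, hd⟩ := φ.d_pow_y_pow (q j) (a j) (ha j)
      (φ.d_mono_vac q (q j) a l fun i hi => (hne i hi).symm)
    rw [low, mono_cons, Module.End.mul_apply, Module.End.mul_apply, Function.comp_apply, hd,
      if_pos le_rfl, Nat.sub_self, pow_zero, map_smul]
    exact smul_ne_zero hc (ih hl)

/-- Operators that agree with raising operators up to terms that preserve the filtration have
linearly independent restricted ordered monomials. -/
theorem linearIndependent_mono [CharP K p] [Finite J] (hq : Function.Injective q)
    (g : J → Module.End K F)
    (hg : ∀ j k w, w ∈ φ.fil k → (g j - φ.y (q j)) w ∈ φ.fil k) (l : List J) (hl : l.Nodup)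
    (hl' : ∀ j, j ∈ l) :
    LinearIndependent K fun a : (j : J) → Fin (bd p (q j).1) => mono g l fun j => a j := by
  classical
  have : Fintype J := Fintype.ofFinite J
  have hY : ∀ (a : J → ℕ) (l : List J),
      mono (φ.y ∘ q) l a φ.vac ∈ φ.fil ((l.map a).sum + 1) := by
    intro a l
    have hpow : ∀ (b) (t k : ℕ) (w : F), w ∈ φ.fil k → (φ.y b ^ t) w ∈ φ.fil (t + k) := by
      intro b t
      induction t with
      | zero => intro k w hw; simpa using hw
      | succ t ih =>
        intro k w hw
        rw [pow_succ', Module.End.mul_apply, show t + 1 + k = (t + k) + 1 by omega]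
        exact φ.y_mem_fil (ih k w hw) b
    induction l with
    | nil => simpa using φ.vac_mem_fil
    | cons j l ih =>
      rw [mono_cons, Module.End.mul_apply, List.map_cons, List.sum_cons, add_assoc]
      exact hpow _ _ _ _ ih
  -- The operators `g j` and the raising operators agree in leading degree, so the two vectors built
  -- from the same exponents differ by something of smaller degree.
  have hM : ∀ (a : J → ℕ) (l : List J),
      mono g l a φ.vac - mono (φ.y ∘ q) l a φ.vac ∈ φ.fil ((l.map a).sum) := by
    intro a l
    have hpow : ∀ (j) (t k : ℕ) (w w' : F), w - w' ∈ φ.fil k → w' ∈ φ.fil (k + 1) →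
        (g j ^ t) w - (φ.y (q j) ^ t) w' ∈ φ.fil (t + k) ∧
          (φ.y (q j) ^ t) w' ∈ φ.fil (t + k + 1) := by
      intro j t
      induction t with
      | zero => intro k w w' hw hw'; simpa using ⟨hw, hw'⟩
      | succ t ih =>
        intro k w w' hw hw'
        obtain ⟨h1, h2⟩ := ih k w w' hw hw'
        rw [pow_succ', pow_succ', Module.End.mul_apply, Module.End.mul_apply,
          show t + 1 + k = t + k + 1 by omega]
        refine ⟨?_, φ.y_mem_fil h2 _⟩
        set u := (g j ^ t) w
        set u' := (φ.y (q j) ^ t) w'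
        have e : g j u - φ.y (q j) u' = (g j - φ.y (q j)) u + φ.y (q j) (u - u') := by simp
        rw [e]
        refine add_mem (hg j _ u ?_) (φ.y_mem_fil h1 _)
        have := add_mem (φ.fil_le_succ _ h1) h2
        rwa [sub_add_cancel] at this
    induction l with
    | nil => simp
    | cons j l ih =>
      rw [mono_cons, mono_cons, Module.End.mul_apply, Module.End.mul_apply, List.map_cons, List.sum_cons]
      exact (hpow j _ _ _ _ ih (hY a l)).1
  rw [Fintype.linearIndependent_iff]
  intro c hc
  by_contra hcon
  push Not at hcon
  let sz : ((j : J) → Fin (bd p (q j).1)) → ℕ := fun a => (l.map fun j => (a j : ℕ)).sum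
  -- Among the exponents with nonzero coefficient, `a` has the largest total degree. Applying the
  -- lowering monomial of `a` to the relation on the vacuum kills every other term and keeps this
  -- one.
  obtain ⟨a, ha, hmax⟩ := Finset.exists_max_image (Finset.univ.filter fun a => c a ≠ 0) sz
    (by obtain ⟨a, ha⟩ := hcon; exact ⟨a, by simpa using ha⟩)
  have ha : c a ≠ 0 := by simpa using ha
  have h0 := congrArg (φ.low q (fun j => a j) l) (LinearMap.congr_fun hc φ.vac)
  rw [LinearMap.sum_apply, map_sum, Finset.sum_eq_single a] at h0
  · simp only [LinearMap.smul_apply, map_smul, LinearMap.zero_apply, map_zero] at h0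
    have h1 := (smul_eq_zero.1 h0).resolve_left ha
    have h2 := φ.low_eq_zero q (fun j => a j) l (hM (fun j => a j) l) le_rfl
    rw [map_sub, h1, zero_sub, neg_eq_zero] at h2
    exact φ.low_mono_self q hq _ (fun j => (a j).2) l hl h2
  · intro b _ hba
    by_cases hcb : c b = 0
    · simp [hcb]
    have hle : sz b ≤ sz a := hmax b (by simpa using hcb)
    rw [LinearMap.smul_apply, map_smul]
    have h2 := φ.low_eq_zero q (fun j => a j) l (hM (fun j => b j) l) hle
    rw [map_sub, sub_eq_zero] at h2
    rw [h2]
    rcases hle.lt_or_eq with hlt | heq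
    · rw [φ.low_eq_zero q (fun j => a j) l (hY (fun j => b j) l) hlt, smul_zero]
    · rw [φ.low_mono_eq_zero q hq _ _ (fun j => (b j).2) l hl, smul_zero]
      -- Otherwise `b ≥ a` in every entry; with equal totals this forces `b = a`.
      by_contra hno
      push Not at hno
      apply hba
      funext j
      have hsum : ∑ j, (b j : ℕ) = ∑ j, (a j : ℕ) := by
        have e : ∀ a : ((j : J) → Fin (bd p (q j).1)), sz a = ∑ j, (a j : ℕ) := fun a => by
          have : l.toFinset = Finset.univ := by ext j; simp [hl' j]
          rw [← this, List.sum_toFinset _ hl]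
        rw [← e, ← e, heq]
      exact (Fin.ext ((Finset.sum_eq_sum_iff_of_le fun j _ => hno j (hl' j)).1 hsum.symm j
        (Finset.mem_univ j))).symm
  · intro h; exact absurd (Finset.mem_univ a) h

end Fock

end Fock

/-! ### The Fock model: truncated polynomials tensored with an exterior algebra. -/

section FockModel

variable (K : Type*) [Field K] (p : ℕ) (I : Type*)

/-- The ideal generated by the `p`-th powers of the variables. -/
def powIdeal : Submodule K (MvPolynomial I K) :=
  (Ideal.span (Set.range fun i : I => (MvPolynomial.X i : MvPolynomial I K) ^ p)).restrictScalars K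

/-- The truncated polynomials. -/
abbrev Trunc := MvPolynomial I K ⧸ powIdeal K p I

variable {I}

/-- Multiplication by a variable. -/
def truncMul (i : I) : Module.End K (Trunc K p I) :=
  Submodule.mapQ _ _ (LinearMap.mulLeft K (MvPolynomial.X i)) fun _ hx =>
    Ideal.mul_mem_left _ _ hx

variable [Fact p.Prime] [CharP K p]

/-- The derivative of `X^p` carries the factor `p = 0`, so the ideal is stable under
differentiation. -/
theorem pderiv_mem_powIdeal (i : I) {f : MvPolynomial I K} (hf : f ∈ powIdeal K p I) :
    MvPolynomial.pderiv i f ∈ powIdeal K p I := by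
  change f ∈ Ideal.span _ at hf
  change _ ∈ Ideal.span _
  induction hf using Submodule.span_induction with
  | mem x hx =>
    obtain ⟨j, rfl⟩ := hx
    have : (p : MvPolynomial I K) = 0 := CharP.cast_eq_zero _ p
    rw [Derivation.leibniz_pow, ← Nat.cast_smul_eq_nsmul (MvPolynomial I K), this, zero_smul]
    exact zero_mem _
  | zero => rw [map_zero]; exact zero_mem _
  | add x y _ _ hx hy => rw [map_add]; exact add_mem hx hy
  | smul a x hx h =>
    rw [smul_eq_mul, Derivation.leibniz]
    exact add_mem (Ideal.mul_mem_left _ _ h) (Ideal.mul_mem_right _ _ hx)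

/-- Partial differentiation of truncated polynomials. -/
def truncDeriv (i : I) : Module.End K (Trunc K p I) :=
  Submodule.mapQ _ _ (MvPolynomial.pderiv i).toLinearMap fun _ hx => pderiv_mem_powIdeal K p i hx

theorem truncMul_comm (i j : I) : truncMul K p i * truncMul K p j = truncMul K p j * truncMul K p i := by
  refine Submodule.linearMap_qext _ (LinearMap.ext fun f => ?_)
  change Submodule.Quotient.mk _ = Submodule.Quotient.mk _
  congr 1
  exact mul_left_comm _ _ _

theorem truncDeriv_comm (i j : I) :
    truncDeriv K p i * truncDeriv K p j = truncDeriv K p j * truncDeriv K p i := by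
  refine Submodule.linearMap_qext _ (LinearMap.ext fun f => ?_)
  change Submodule.Quotient.mk _ = Submodule.Quotient.mk _
  congr 1
  change MvPolynomial.pderiv i (MvPolynomial.pderiv j f) = MvPolynomial.pderiv j (MvPolynomial.pderiv i f)
  have h : ⁅(MvPolynomial.pderiv i : Derivation K (MvPolynomial I K) (MvPolynomial I K)),
      (MvPolynomial.pderiv j : Derivation K (MvPolynomial I K) (MvPolynomial I K))⁆ = 0 := by
    classical
    refine MvPolynomial.derivation_ext fun k => ?_
    simp [Derivation.commutator_apply, MvPolynomial.pderiv_X, Pi.single_apply, apply_ite]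
  have := congrArg (fun D : Derivation K (MvPolynomial I K) (MvPolynomial I K) => D f) h
  simpa [Derivation.commutator_apply, sub_eq_zero] using this

theorem truncDeriv_mul [DecidableEq I] (i j : I) : truncDeriv K p i * truncMul K p j =
    truncMul K p j * truncDeriv K p i + if i = j then 1 else 0 := by
  refine Submodule.linearMap_qext _ (LinearMap.ext fun f => ?_)
  have h : MvPolynomial.pderiv i (MvPolynomial.X j * f) =
      MvPolynomial.X j * MvPolynomial.pderiv i f + if i = j then f else 0 := by
    rw [Derivation.leibniz, MvPolynomial.pderiv_X, Pi.single_apply]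
    split_ifs <;> simp_all
  have h2 := congrArg (powIdeal K p I).mkQ h
  rw [map_add] at h2
  refine h2.trans ?_
  split_ifs <;> rfl

theorem truncMul_pow (i : I) : truncMul K p i ^ p = 0 := by
  have h : ∀ k (f : MvPolynomial I K), (truncMul K p i ^ k) ((powIdeal K p I).mkQ f) =
      (powIdeal K p I).mkQ (MvPolynomial.X i ^ k * f) := by
    intro k
    induction k with
    | zero => simp
    | succ k ih =>
      intro f
      rw [pow_succ', Module.End.mul_apply, ih, pow_succ', mul_assoc]
      rfl
  refine Submodule.linearMap_qext _ (LinearMap.ext fun f => ?_)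
  rw [LinearMap.comp_apply, h]
  simp only [LinearMap.zero_comp, LinearMap.zero_apply, Submodule.mkQ_apply, Submodule.Quotient.mk_eq_zero]
  exact Ideal.mul_mem_right _ _ (Ideal.subset_span ⟨i, rfl⟩)

/-- The `p`-fold derivative of a monomial carries a falling factorial of `p` consecutive factors,
which is divisible by `p!` and hence vanishes, even before truncation. -/
theorem truncDeriv_pow (i : I) : truncDeriv K p i ^ p = 0 := by
  have h : ∀ k (f : MvPolynomial I K), (truncDeriv K p i ^ k) ((powIdeal K p I).mkQ f) =
      (powIdeal K p I).mkQ ((MvPolynomial.pderiv i)^[k] f) := by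
    intro k
    induction k with
    | zero => simp
    | succ k ih =>
      intro f
      rw [pow_succ, Module.End.mul_apply, Function.iterate_succ_apply, ← ih]
      rfl
  refine Submodule.linearMap_qext _ (LinearMap.ext fun f => ?_)
  rw [LinearMap.comp_apply, h]
  suffices (MvPolynomial.pderiv i)^[p] f = 0 by rw [this]; simp
  classical
  have h2 : ∀ k (s : I →₀ ℕ) (c : K), (MvPolynomial.pderiv i)^[k] (MvPolynomial.monomial s c) =
      MvPolynomial.monomial (s - Finsupp.single i k) (c * (s i).descFactorial k) := by
    intro k
    induction k with
    | zero => simp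
    | succ k ih =>
      intro s c
      rw [Function.iterate_succ_apply', ih, MvPolynomial.pderiv_monomial, Nat.descFactorial_succ]
      congr 1
      · rw [tsub_tsub, ← Finsupp.single_add]
      · simp; ring
  induction f using MvPolynomial.induction_on' with
  | monomial s c =>
    rw [h2, (CharP.cast_eq_zero_iff K p _).2, mul_zero, map_zero]
    exact (Nat.dvd_factorial (Fact.out : p.Prime).pos le_rfl).trans (Nat.factorial_dvd_descFactorial _ _)
  | add f g hf hg =>
    have : ∀ k, (MvPolynomial.pderiv i)^[k] (f + g) =
        (MvPolynomial.pderiv (R := K) i)^[k] f + (MvPolynomial.pderiv i)^[k] g := by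
      intro k
      induction k with
      | zero => rfl
      | succ k ih => simp only [Function.iterate_succ_apply', ih, map_add]
    rw [this, hf, hg, add_zero]

theorem trunc_one_ne : (powIdeal K p I).mkQ 1 ≠ 0 := by
  intro h
  rw [Submodule.mkQ_apply, Submodule.Quotient.mk_eq_zero] at h
  have h1 : Ideal.span (Set.range fun i : I => (MvPolynomial.X i : MvPolynomial I K) ^ p) ≤
      RingHom.ker (MvPolynomial.constantCoeff (R := K) (σ := I)) := by
    rw [Ideal.span_le]
    rintro _ ⟨i, rfl⟩
    simp [RingHom.mem_ker, (Fact.out : p.Prime).ne_zero]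
  have := h1 h
  simp [RingHom.mem_ker] at this

variable [DecidableEq I]

/-- The exterior product with a basis vector. -/
def extMul (i : I) : Module.End K (ExteriorAlgebra K (I → K)) :=
  LinearMap.mulLeft K (ExteriorAlgebra.ι K (Pi.single i 1))

/-- The contraction with a coordinate function. -/
def extContract (i : I) : Module.End K (ExteriorAlgebra K (I → K)) :=
  CliffordAlgebra.contractLeft (LinearMap.proj i)

theorem extMul_anticomm (i j : I) : extMul K i * extMul K j = -(extMul K j * extMul K i) := by
  refine LinearMap.ext fun w => ?_
  have := ExteriorAlgebra.ι_add_mul_swap (R := K) (Pi.single i 1 : I → K) (Pi.single j 1)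
  change ExteriorAlgebra.ι K _ * (ExteriorAlgebra.ι K _ * w) = -(ExteriorAlgebra.ι K _ * (ExteriorAlgebra.ι K _ * w))
  rw [← mul_assoc, ← mul_assoc, eq_neg_of_add_eq_zero_left this, neg_mul]

theorem extContract_anticomm (i j : I) :
    extContract K i * extContract K j = -(extContract K j * extContract K i) :=
  LinearMap.ext fun _ => CliffordAlgebra.contractLeft_comm _ _ _

theorem extContract_extMul (i j : I) : extContract K i * extMul K j =
    -(extMul K j * extContract K i) + if i = j then 1 else 0 := by
  refine LinearMap.ext fun w => ?_
  refine (CliffordAlgebra.contractLeft_ι_mul (Q := (0 : QuadraticForm K (I → K))) (LinearMap.proj i) (Pi.single j 1) w).trans ?_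
  rw [LinearMap.proj_apply, Pi.single_apply, LinearMap.add_apply, sub_eq_neg_add]
  congr 1
  split_ifs <;> simp

/-- The even operators on the tensor product of truncated polynomials and the exterior algebra. -/
def evenOp : Module.End K (Trunc K p I) →ₐ[K]
    Module.End K (Trunc K p I ⊗[K] ExteriorAlgebra K (I → K)) :=
  (Module.endTensorEndAlgHom (S := K)).comp Algebra.TensorProduct.includeLeft

/-- The odd operators on the tensor product of truncated polynomials and the exterior algebra. -/
def oddOp : Module.End K (ExteriorAlgebra K (I → K)) →ₐ[K]
    Module.End K (Trunc K p I ⊗[K] ExteriorAlgebra K (I → K)) :=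
  (Module.endTensorEndAlgHom (S := K)).comp Algebra.TensorProduct.includeRight

theorem evenOp_comm_oddOp (a : Module.End K (Trunc K p I))
    (b : Module.End K (ExteriorAlgebra K (I → K))) :
    evenOp K p a * oddOp K p b = oddOp K p b * evenOp K p a := by
  simp only [evenOp, oddOp, AlgHom.comp_apply, ← map_mul]
  simp

theorem sg_true_smul {K : Type*} [Field K] {M : Type*} [AddCommGroup M] [Module K M] (x : M) :
    sg K true true • x = -x := by
  simp [sg]

/-- The Fock representation. -/
def fockModel : Fock K p I (Trunc K p I ⊗[K] ExteriorAlgebra K (I → K)) where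
  y
    | (false, i) => evenOp K p (truncMul K p i)
    | (true, i) => oddOp K p (extMul K i)
  d
    | (false, i) => evenOp K p (truncDeriv K p i)
    | (true, i) => oddOp K p (extContract K i)
  vac := (powIdeal K p I).mkQ 1 ⊗ₜ 1
  vac_ne := by
    intro h
    have h1 := mt (Module.forall_dual_apply_eq_zero_iff K _).1 (trunc_one_ne K p (I := I))
    have h2 := mt (Module.forall_dual_apply_eq_zero_iff K _).1
      (one_ne_zero (α := ExteriorAlgebra K (I → K)))
    push Not at h1 h2
    obtain ⟨f, hf⟩ := h1
    obtain ⟨g, hg⟩ := h2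
    have h3 := congrArg ((TensorProduct.lid K K).toLinearMap ∘ₗ TensorProduct.map f g) h
    rw [LinearMap.comp_apply, TensorProduct.map_tmul, map_zero] at h3
    exact mul_ne_zero hf hg (by simpa using h3)
  d_vac := by
    rintro ⟨_ | _, i⟩
    · have : truncDeriv K p i ((powIdeal K p I).mkQ 1) = 0 := by
        change (powIdeal K p I).mkQ (MvPolynomial.pderiv i 1) = 0
        simp
      change (truncDeriv K p i) ((powIdeal K p I).mkQ 1) ⊗ₜ[K] _ = 0
      rw [this, TensorProduct.zero_tmul]
    · have : extContract K i 1 = 0 := CliffordAlgebra.contractLeft_one (Q := (0 : QuadraticForm K (I → K))) _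
      change _ ⊗ₜ[K] extContract K i 1 = 0
      rw [this, TensorProduct.tmul_zero]
  d_y := by
    rintro ⟨_ | _, i⟩ ⟨_ | _, j⟩
    · simp only [← map_mul, truncDeriv_mul, sg]
      by_cases h : i = j <;> simp [h]
    · simp [evenOp_comm_oddOp, sg]
    · simp [evenOp_comm_oddOp, sg]
    · have h1 := congrArg (oddOp K p) (extContract_extMul K i j)
      rw [map_mul, map_add, map_neg, map_mul] at h1
      refine h1.trans ?_
      refine congrArg₂ (· + ·) (sg_true_smul _).symm ?_
      by_cases h : i = j <;> simp [h]
  y_y := by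
    rintro ⟨_ | _, i⟩ ⟨_ | _, j⟩
    · simp only [← map_mul, truncMul_comm K p i j, sg]
      simp
    · simp [evenOp_comm_oddOp, sg]
    · simp [evenOp_comm_oddOp, sg]
    · have h1 := congrArg (oddOp K p) (extMul_anticomm K i j)
      rw [map_mul, map_neg, map_mul] at h1
      exact h1.trans (sg_true_smul _).symm
  d_d := by
    rintro ⟨_ | _, i⟩ ⟨_ | _, j⟩
    · simp only [← map_mul, truncDeriv_comm K p i j, sg]
      simp
    · simp [evenOp_comm_oddOp, sg]
    · simp [evenOp_comm_oddOp, sg]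
    · have h1 := congrArg (oddOp K p) (extContract_anticomm K i j)
      rw [map_mul, map_neg, map_mul] at h1
      exact h1.trans (sg_true_smul _).symm
  y_pow i := by simp only [← map_pow, truncMul_pow, map_zero]
  d_pow i := by simp only [← map_pow, truncDeriv_pow, map_zero]

end FockModel

/-! ### The `p`-th power of `x y` in a Weyl algebra. -/

section CharPAlgebra

open Polynomial in
-- Both sides are monic of degree `p` and vanish at the `p` elements of the prime field, by Fermat's
-- theorem.
theorem prod_X_sub_natCast (K : Type*) [Field K] (p : ℕ) [hp : Fact p.Prime] [CharP K p] :
    ∏ i ∈ Finset.range p, (X - C (i : K)) = (X ^ p - X : K[X]) := by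
  classical
  have hinj : Set.InjOn (fun i : ℕ => (i : K)) (Finset.range p) := by
    intro i hi j hj h
    have := (CharP.natCast_eq_natCast K p).1 h
    rwa [Nat.ModEq, Nat.mod_eq_of_lt (Finset.mem_range.1 hi),
      Nat.mod_eq_of_lt (Finset.mem_range.1 hj)] at this
  have hm1 : (∏ i ∈ Finset.range p, (X - C (i : K))).Monic :=
    monic_prod_of_monic _ _ fun i _ => monic_X_sub_C _
  have hd1 : (∏ i ∈ Finset.range p, (X - C (i : K))).degree = (p : WithBot ℕ) := by
    have h : ∀ i : ℕ, (X - C (i : K)).degree = 1 := fun i => degree_X_sub_C _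
    rw [degree_prod, Finset.sum_congr rfl fun i _ => h i]; simp
  have hd2 : (X ^ p - X : K[X]).degree = p := by
    rw [degree_sub_eq_left_of_degree_lt, degree_X_pow]
    rw [degree_X, degree_X_pow]; exact_mod_cast hp.out.one_lt
  have hm2 : (X ^ p - X : K[X]).Monic :=
    monic_X_pow_sub (by rw [degree_X]; exact_mod_cast hp.out.one_lt)
  refine eq_of_degree_sub_lt_of_eval_finset_eq ((Finset.range p).image fun i : ℕ => (i : K)) ?_ ?_
  · rw [Finset.card_image_of_injOn hinj, Finset.card_range, ← hd1]
    exact degree_sub_lt_left (hd1.trans hd2.symm) hm1.ne_zero (hm1.leadingCoeff.trans hm2.leadingCoeff.symm)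
  · intro x hx
    obtain ⟨i, hi, rfl⟩ := Finset.mem_image.1 hx
    rw [eval_prod, Finset.prod_eq_zero hi (by simp)]
    have : ((i : K)) ^ p = i := map_natCast (frobenius K p) i
    simp [this]

variable {A : Type*} [Ring A] (p : ℕ) [hp : Fact p.Prime]

/-- In characteristic `p`, if `y x - x y = 1`, then `(x y)^p = x y + x^p y^p`. -/
theorem mul_pow_char_of_weyl (K : Type*) [Field K] [Algebra K A] [CharP K p] {x y : A} (h : y * x = x * y + 1) :
    (x * y) ^ p = x * y + x ^ p * y ^ p := by
  have h1 : ∀ k : ℕ, x ^ k * (x * y) = (x * y - (k : A)) * x ^ k := by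
    intro k
    induction k with
    | zero => simp
    | succ k ih =>
      rw [pow_succ, mul_assoc, show x * (x * y) = (x * y - 1) * x by
        rw [sub_mul, one_mul, mul_assoc, h, mul_add, mul_one, add_sub_cancel_right], ← mul_assoc,
        mul_sub, mul_one, ih, Nat.cast_succ]
      have : (x * y - (k + 1 : A)) = x * y - k - 1 := by abel
      rw [this, sub_mul _ (1 : A), one_mul, sub_mul, mul_assoc, sub_mul]
  -- Normal ordering turns `x^k y^k` into the falling factorial of `x y`. For `k = p` the falling
  -- factorial is `(x y)^p - x y`.
  have h2 : ∀ k : ℕ, x ^ k * y ^ k =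
      Polynomial.aeval (x * y) (∏ i ∈ Finset.range k, (Polynomial.X - Polynomial.C (i : K))) := by
    intro k
    induction k with
    | zero => simp
    | succ k ih =>
      rw [Finset.prod_range_succ_comm, map_mul, ← ih, pow_succ, pow_succ' y,
        show x ^ k * x * (y * y ^ k) = x ^ k * (x * y) * y ^ k by noncomm_ring, h1, mul_assoc]
      simp
  rw [h2, prod_X_sub_natCast]
  simp

theorem sum_pow_char_of_commute [CharP A p] {ι : Type*} (s : Finset ι) (f : ι → A)
    (h : ∀ i ∈ s, ∀ j ∈ s, Commute (f i) (f j)) : (∑ i ∈ s, f i) ^ p = ∑ i ∈ s, f i ^ p := by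
  classical
  induction s using Finset.induction_on with
  | empty => simp [hp.out.ne_zero]
  | insert a s ha ih =>
    rw [Finset.sum_insert ha, Finset.sum_insert ha, add_pow_char_of_commute, ih]
    · exact fun i hi j hj => h i (Finset.mem_insert_of_mem hi) j (Finset.mem_insert_of_mem hj)
    · exact Commute.sum_right _ _ _ fun j hj =>
        h a (Finset.mem_insert_self _ _) j (Finset.mem_insert_of_mem hj)

end CharPAlgebra

/-! ### Oscillator operators for the matrix units of `q(n)`. -/

section Oscillator

variable {K : Type*} [Field K] {p n : ℕ} {F : Type*}
  [AddCommGroup F] [Module K F] (φ : Fock K p (Fin n × Fin n) F) (χ : Module.Dual K (Mat K n))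

/-- The operators `x_ik = δ_ik - d_ik` (even) and the odd lowering operators. -/
def opA (s : Bool) (i k : Fin n) : Module.End K F :=
  if s then φ.d (true, (i, k)) else (if i = k then 1 else 0) - φ.d (false, (i, k))

/-- The operators `y_jk + χ(E_kj)` (even) and the odd raising operators. -/
def opB (s : Bool) (j k : Fin n) : Module.End K F :=
  if s then φ.y (true, (j, k)) else
    φ.y (false, (j, k)) + algebraMap K _ (χ (Matrix.single k j 1))

theorem opA_mul_opA (s t : Bool) (i k j l : Fin n) :
    opA φ s i k * opA φ t j l = sg K s t • (opA φ t j l * opA φ s i k) := by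
  have hd := φ.d_d
  cases s <;> cases t <;> simp only [opA, sg]
  · have := hd (false, (i, k)) (false, (j, l))
    simp only [sg] at this
    simp only [Bool.false_eq_true, and_self, if_false, one_smul] at this ⊢
    split_ifs <;> simp only [sub_mul, mul_sub, one_mul, mul_one, zero_mul, mul_zero, this] <;> abel
  · have := hd (false, (i, k)) (true, (j, l))
    simp only [sg] at this
    simp only [Bool.false_eq_true, false_and, if_false, if_true, one_smul] at this ⊢
    split_ifs <;> simp only [sub_mul, mul_sub, one_mul, mul_one, zero_mul, mul_zero, this]
  · have := hd (true, (i, k)) (false, (j, l))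
    simp only [sg] at this
    simp only [Bool.false_eq_true, and_false, if_false, if_true, one_smul] at this ⊢
    split_ifs <;> simp only [sub_mul, mul_sub, one_mul, mul_one, zero_mul, mul_zero, this]
  · exact hd (true, (i, k)) (true, (j, l))

theorem opB_mul_opB (s t : Bool) (i k j l : Fin n) :
    opB φ χ s i k * opB φ χ t j l = sg K s t • (opB φ χ t j l * opB φ χ s i k) := by
  have hd := φ.y_y
  cases s <;> cases t <;> simp only [opB, sg]
  · have := hd (false, (i, k)) (false, (j, l))
    simp only [sg] at this
    simp only [Bool.false_eq_true, and_self, if_false, one_smul] at this ⊢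
    exact ((Commute.add_right this (Algebra.commute_algebraMap_right _ _)).add_left
      (Algebra.commute_algebraMap_left _ _)).eq
  · have := hd (false, (i, k)) (true, (j, l))
    simp only [sg] at this
    simp only [Bool.false_eq_true, false_and, if_false, if_true, one_smul] at this ⊢
    simp only [add_mul, mul_add, this, Algebra.commutes]
  · have := hd (true, (i, k)) (false, (j, l))
    simp only [sg] at this
    simp only [Bool.false_eq_true, and_false, if_false, if_true, one_smul] at this ⊢
    simp only [add_mul, mul_add, this, Algebra.commutes]
  · exact hd (true, (i, k)) (true, (j, l))

theorem opA_mul_opB (s t : Bool) (i k j l : Fin n) :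
    opA φ s i k * opB φ χ t j l = sg K s t • (opB φ χ t j l * opA φ s i k -
      if s = t ∧ i = j ∧ k = l then 1 else 0) := by
  have hd := φ.d_y
  cases s <;> cases t <;> simp only [opA, opB, sg]
  · have := hd (false, (i, k)) (false, (j, l))
    simp only [sg, Prod.mk.injEq, true_and] at this
    simp only [Bool.false_eq_true, and_self, if_false, one_smul, true_and] at this ⊢
    clear hd
    rcases eq_or_ne i k with rfl | h <;> simp only [*, ↓reduceIte, sub_mul, mul_sub, one_mul, mul_one, zero_mul, mul_zero, add_mul, mul_add, Algebra.commutes] <;> abel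
  · have := hd (false, (i, k)) (true, (j, l))
    simp only [sg] at this
    simp at this ⊢
    split_ifs <;> simp only [sub_mul, mul_sub, one_mul, mul_one, zero_mul, mul_zero, this]
  · have := hd (true, (i, k)) (false, (j, l))
    simp only [sg] at this
    simp at this ⊢
    simp only [add_mul, mul_add, this, Algebra.commutes]
  · have := hd (true, (i, k)) (true, (j, l))
    simp only [sg, Prod.mk.injEq, true_and, and_self, if_true, neg_smul, one_smul] at this ⊢
    rw [this]
    abel

/-- In this form the operators `opA` are coordinates of a supermatrix and the `opB` are the matching
partial derivatives. Writing the even coordinates as `δ - d` is an expansion around the identity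
matrix with the roles of raising and lowering operators interchanged. The scalar `χ` added to a
derivative leaves the relations intact and only affects `p`-th powers. -/
theorem opB_mul_opA (s t : Bool) (i k j l : Fin n) :
    opB φ χ t j l * opA φ s i k = sg K s t • (opA φ s i k * opB φ χ t j l) +
      if s = t ∧ i = j ∧ k = l then 1 else 0 := by
  rw [opA_mul_opB, smul_smul]
  have : sg K s t * sg K s t = 1 := by unfold sg; split_ifs <;> simp
  rw [this, one_smul, sub_add_cancel]

theorem sg_xor_left (s t u : Bool) : sg K (s ^^ t) u = sg K s u * sg K t u := by
  cases s <;> cases t <;> cases u <;> simp [sg]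

/-- Normal ordering both products leaves the same quartic term up to the sign of the two total
parities, so their supercommutator is again quadratic. -/
theorem opA_opB_mul (s t u v : Bool) (i j k l a b : Fin n) :
    (opA φ s i a * opB φ χ t j a) * (opA φ u k b * opB φ χ v l b) =
      sg K (s ^^ t) (u ^^ v) • ((opA φ u k b * opB φ χ v l b) * (opA φ s i a * opB φ χ t j a)) +
      (if u = t ∧ k = j ∧ b = a then opA φ s i a * opB φ χ v l b else 0) -
      sg K (s ^^ t) (u ^^ v) •
        (if s = v ∧ i = l ∧ a = b then opA φ u k b * opB φ χ t j a else 0) := by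
  have h1 : (opA φ s i a * opB φ χ t j a) * (opA φ u k b * opB φ χ v l b) =
      sg K u t • ((opA φ s i a * opA φ u k b) * (opB φ χ t j a * opB φ χ v l b)) +
      (if u = t ∧ k = j ∧ b = a then opA φ s i a * opB φ χ v l b else 0) := by
    rw [mul_assoc, ← mul_assoc (opB φ χ t j a), opB_mul_opA, add_mul, mul_add, smul_mul_assoc,
      mul_smul_comm]
    simp only [mul_assoc]
    congr 2
    split_ifs <;> simp
  have h2 : (opA φ u k b * opB φ χ v l b) * (opA φ s i a * opB φ χ t j a) =
      sg K s v • ((opA φ u k b * opA φ s i a) * (opB φ χ v l b * opB φ χ t j a)) +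
      (if s = v ∧ i = l ∧ a = b then opA φ u k b * opB φ χ t j a else 0) := by
    rw [mul_assoc, ← mul_assoc (opB φ χ v l b), opB_mul_opA, add_mul, mul_add, smul_mul_assoc,
      mul_smul_comm]
    simp only [mul_assoc]
    congr 2
    split_ifs <;> simp
  rw [h1, h2, opA_mul_opA φ s u, opB_mul_opB φ χ t v]
  have h3 : sg K u t * (sg K s u * sg K t v) = sg K (s ^^ t) (u ^^ v) * sg K s v := by
    rw [sg_xor_left, sg_comm K s (u ^^ v), sg_comm K t (u ^^ v), sg_xor_left, sg_xor_left,
      sg_comm K u s, sg_comm K v s, sg_comm K u t, sg_comm K v t]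
    have h4 : sg K s v * sg K s v = 1 := by unfold sg; split_ifs <;> simp
    linear_combination -(sg K t u * sg K s u * sg K t v) * h4
  simp only [smul_add, smul_mul_assoc, mul_smul_comm, smul_smul]
  rw [← h3, mul_comm (sg K s u)]
  abel

/-- The operator that represents the matrix unit `E_ij` of the given parity. -/
def opG (s : Bool) (i j : Fin n) : Module.End K F :=
  ∑ x : Fin n × Bool, opA φ x.2 i x.1 * opB φ χ (x.2 ^^ s) j x.1

theorem opG_mul_opG (s t : Bool) (i j k l : Fin n) :
    opG φ χ s i j * opG φ χ t k l = sg K s t • (opG φ χ t k l * opG φ χ s i j) +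
      (if k = j then opG φ χ (s ^^ t) i l else 0) -
      sg K s t • (if i = l then opG φ χ (s ^^ t) k j else 0) := by
  have key : ∀ x y : Fin n × Bool,
      (opA φ x.2 i x.1 * opB φ χ (x.2 ^^ s) j x.1) * (opA φ y.2 k y.1 * opB φ χ (y.2 ^^ t) l y.1) =
      sg K s t • ((opA φ y.2 k y.1 * opB φ χ (y.2 ^^ t) l y.1) *
        (opA φ x.2 i x.1 * opB φ χ (x.2 ^^ s) j x.1)) +
      (if y = (x.1, x.2 ^^ s) then
        (if k = j then opA φ x.2 i x.1 * opB φ χ (y.2 ^^ t) l y.1 else 0) else 0) -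
      sg K s t • (if x = (y.1, y.2 ^^ t) then
        (if i = l then opA φ y.2 k y.1 * opB φ χ (x.2 ^^ s) j x.1 else 0) else 0) := by
    rintro ⟨a, u⟩ ⟨b, v⟩
    have := opA_opB_mul φ χ u (u ^^ s) v (v ^^ t) i j k l a b
    rw [← Bool.xor_assoc, ← Bool.xor_assoc, Bool.xor_self, Bool.xor_self, Bool.false_xor,
      Bool.false_xor] at this
    rw [this]
    simp only [Prod.mk.injEq]
    congr 2
    · by_cases h1 : v = (u ^^ s) <;> by_cases h2 : k = j <;> by_cases h3 : b = a <;> simp [h1, h2, h3]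
    · by_cases h1 : u = (v ^^ t) <;> by_cases h2 : i = l <;> by_cases h3 : a = b <;> simp [h1, h2, h3]
  have h1 : opG φ χ t k l * opG φ χ s i j = ∑ x : Fin n × Bool, ∑ y : Fin n × Bool,
      (opA φ y.2 k y.1 * opB φ χ (y.2 ^^ t) l y.1) * (opA φ x.2 i x.1 * opB φ χ (x.2 ^^ s) j x.1) := by
    rw [opG, opG, Finset.sum_mul_sum, Finset.sum_comm]
  rw [h1, opG, opG, Finset.sum_mul_sum]
  simp only [key, Finset.sum_sub_distrib, Finset.sum_add_distrib, ← Finset.smul_sum]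
  congr 2
  · simp only [Finset.sum_ite_eq', Finset.mem_univ, if_true]
    split_ifs
    · simp only [opG, Bool.xor_assoc]
    · simp
  · rw [Finset.sum_comm]
    simp only [Finset.sum_ite_eq', Finset.mem_univ, if_true]
    split_ifs
    · simp only [opG, Bool.xor_assoc, Bool.xor_comm s t]
    · simp

/-- The summand `δ` of `opA` contributes `opB φ χ s j i`, which is a raising operator up to a
scalar. All other summands are a lowering operator after an operator of degree at most one, so they
do not raise the degree. The indices of the leading term are transposed. -/
theorem opG_sub_mem_fil (s : Bool) (i j : Fin n) (k : ℕ) {w : F} (hw : w ∈ φ.fil k) :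
    (opG φ χ s i j - φ.y (s, (j, i))) w ∈ φ.fil k := by
  have hB : ∀ t a, (opB φ χ t j a) w ∈ φ.fil (k + 1) := by
    intro t a
    cases t
    · refine add_mem (φ.y_mem_fil hw _) ?_
      rw [Module.algebraMap_end_apply]
      exact Submodule.smul_mem _ _ (φ.fil_le_succ _ hw)
    · exact φ.y_mem_fil hw _
  have hG : opG φ χ s i j = opB φ χ s j i + ∑ x : Fin n × Bool,
      (if x.2 = true then (1 : K) else -1) • (φ.d (x.2, (i, x.1)) * opB φ χ (x.2 ^^ s) j x.1) := by
    have : ∀ x : Fin n × Bool, opA φ x.2 i x.1 * opB φ χ (x.2 ^^ s) j x.1 =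
        (if x = (i, false) then opB φ χ s j i else 0) + (if x.2 = true then (1 : K) else -1) •
        (φ.d (x.2, (i, x.1)) * opB φ χ (x.2 ^^ s) j x.1) := by
      rintro ⟨a, t⟩
      cases t
      · rcases eq_or_ne i a with rfl | h
        · simp [opA, sub_mul, ← sub_eq_add_neg]
        · simp [opA, h, h.symm]
      · simp [opA]
    rw [opG, Finset.sum_congr rfl fun x _ => this x, Finset.sum_add_distrib]
    simp
  have h0 : (opB φ χ s j i - φ.y (s, (j, i))) w ∈ φ.fil k := by
    cases s
    · simp only [opB, Bool.false_eq_true, if_false, add_sub_cancel_left, Module.algebraMap_end_apply]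
      exact Submodule.smul_mem _ _ hw
    · simp [opB]
  rw [hG, add_sub_right_comm, LinearMap.add_apply, LinearMap.sum_apply]
  refine add_mem h0 (sum_mem fun x _ => ?_)
  rw [LinearMap.smul_apply, Module.End.mul_apply]
  exact Submodule.smul_mem _ _ (φ.d_mem_fil (hB _ _) _)

variable [Fact p.Prime] [CharP K p]

/-- The summands commute, so the `p`-th power may be taken termwise. An even summand `x y` gives
`δ_ij x y + x^p y^p`, and since `x^p` is `0` or `1`, only the index `a = i` leaves a scalar, equal
to `χ(E_ij)^p`. An odd summand is idempotent for `i = j` and squares to zero otherwise. -/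
theorem opG_pow (hp : 2 < p) (i j : Fin n) : opG φ χ false i j ^ p =
    (if i = j then opG φ χ false i j else 0) +
      algebraMap K _ (χ (Matrix.single i j 1) ^ p) := by
  have hnt : Nontrivial F := ⟨φ.vac, 0, φ.vac_ne⟩
  have hchar : CharP (Module.End K F) p := charP_of_injective_algebraMap (algebraMap K _).injective p
  have h2 : (2 : K) ≠ 0 := by
    have := CharP.cast_eq_zero_iff K p 2
    rw [Nat.cast_ofNat] at this
    exact fun h => absurd (Nat.le_of_dvd two_pos (this.1 h)) (by omega)
  have hA2 : ∀ a, opA φ true i a * opA φ true i a = 0 := by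
    intro a
    have := opA_mul_opA φ true true i a i a
    rw [show sg K true true = -1 by simp [sg], neg_smul, one_smul, eq_neg_iff_add_eq_zero, ← two_smul K] at this
    exact (smul_eq_zero.1 this).resolve_left h2
  have hXp : ∀ a, opA φ false i a ^ p = if i = a then 1 else 0 := by
    intro a
    have hc : Commute (if i = a then (1 : Module.End K F) else 0) (φ.d (false, (i, a))) := by
      split_ifs
      · exact Commute.one_left _
      · exact Commute.zero_left _
    simp only [opA, Bool.false_eq_true, if_false]
    rw [sub_pow_char_of_commute _ hc, φ.d_pow, sub_zero]
    split_ifs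
    · exact one_pow p
    · exact zero_pow (Fact.out : p.Prime).ne_zero
  have hDp : ∀ a, opB φ χ false j a ^ p = algebraMap K _ (χ (Matrix.single a j 1) ^ p) := by
    intro a
    simp only [opB, Bool.false_eq_true, if_false]
    rw [add_pow_char_of_commute _ (Algebra.commute_algebraMap_right _ _), φ.y_pow, zero_add, map_pow]
  have hterm : ∀ x : Fin n × Bool, (opA φ x.2 i x.1 * opB φ χ (x.2 ^^ false) j x.1) ^ p =
      (if i = j then opA φ x.2 i x.1 * opB φ χ (x.2 ^^ false) j x.1 else 0) +
      if x = (i, false) then algebraMap K _ (χ (Matrix.single i j 1) ^ p) else 0 := by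
    rintro ⟨a, t⟩
    cases t
    · have hBA := opB_mul_opA φ χ false false i a j a
      simp only [sg, Bool.false_eq_true, and_self, if_false, one_smul, true_and, and_true] at hBA
      have hend : opA φ false i a ^ p * opB φ χ false j a ^ p =
          if a = i then algebraMap K _ (χ (Matrix.single i j 1) ^ p) else 0 := by
        rw [hXp, hDp]
        rcases eq_or_ne a i with rfl | h
        · simp
        · simp [h, h.symm]
      simp only [Bool.xor_false, Prod.mk.injEq, and_true]
      rw [← hend]
      split_ifs with hij
      · rw [if_pos hij] at hBA
        exact mul_pow_char_of_weyl p K hBA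
      · rw [if_neg hij, add_zero] at hBA
        rw [zero_add]
        exact Commute.mul_pow hBA.symm p
    · have hBA := opB_mul_opA φ χ true true i a j a
      simp only [sg, and_self, if_true, neg_smul, one_smul, true_and, and_true] at hBA
      simp only [Bool.xor_false, Prod.mk.injEq, Bool.true_eq_false, and_false, if_false, add_zero]
      set x := opA φ true i a
      set y := opB φ χ true j a
      have hsq : (x * y) * (x * y) = if i = j then x * y else 0 := by
        rw [mul_assoc, ← mul_assoc y, hBA, add_mul, mul_add, neg_mul, mul_neg, mul_assoc x y y, ← mul_assoc x x, hA2]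
        split_ifs <;> simp
      obtain ⟨q, rfl⟩ : ∃ q, p = q + 2 := ⟨p - 2, by omega⟩
      rw [pow_add, pow_two, hsq]
      split_ifs with hij
      · rw [if_pos hij] at hsq
        rw [← pow_succ]
        exact IsIdempotentElem.pow_succ_eq q hsq
      · rw [mul_zero]
  have hcomm : ∀ x y : Fin n × Bool, Commute (opA φ x.2 i x.1 * opB φ χ (x.2 ^^ false) j x.1)
      (opA φ y.2 i y.1 * opB φ χ (y.2 ^^ false) j y.1) := by
    rintro ⟨a, s⟩ ⟨b, t⟩
    have := opA_opB_mul φ χ s (s ^^ false) t (t ^^ false) i j i j a b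
    simp only [Bool.xor_false, Bool.xor_self] at this ⊢
    rw [show sg K false false = 1 by simp [sg], one_smul, one_smul] at this
    refine this.trans ?_
    rw [add_sub_assoc]
    refine add_eq_left.2 (sub_eq_zero.2 ?_)
    by_cases h : t = s ∧ i = j ∧ b = a
    · obtain ⟨rfl, rfl, rfl⟩ := h
      simp
    · rw [if_neg h, if_neg fun h' => h ⟨h'.1.symm, h'.2.1, h'.2.2.symm⟩]
  rw [opG, sum_pow_char_of_commute p _ _ fun x _ y _ => hcomm x y,
    Finset.sum_congr rfl fun x _ => hterm x, Finset.sum_add_distrib]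
  congr 1
  · split_ifs <;> simp
  · simp

end Oscillator

/-! ### Homomorphisms out of `U_χ(s)` on generators. -/

section LiftGenerators

variable {K : Type*} [Field K] {p n : ℕ} (χ : Module.Dual K (Mat K n))

theorem lift_ι₀ (s : SubSuper K n p) {A : Type*} [Ring A] [Algebra K A]
    (f₀ : s.even →ₗ[K] A) (f₁ : s.odd →ₗ[K] A) (h₀₀ h₀₁ h₁₁ hp) (x : s.even) :
    lift χ s f₀ f₁ h₀₀ h₀₁ h₁₁ hp (ι₀ χ s x) = f₀ x := by
  have h : lift χ s f₀ f₁ h₀₀ h₀₁ h₁₁ hp (ι₀ χ s x) = liftEnv s f₀ f₁ h₀₀ h₀₁ h₁₁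
      (mkEnv s (TensorAlgebra.ι K (x, 0))) := RingQuot.liftAlgHom_mkAlgHom_apply K _ _ _
  rw [h, liftEnv_mkEnv]
  simp

theorem lift_ι₁ (s : SubSuper K n p) {A : Type*} [Ring A] [Algebra K A]
    (f₀ : s.even →ₗ[K] A) (f₁ : s.odd →ₗ[K] A) (h₀₀ h₀₁ h₁₁ hp) (x : s.odd) :
    lift χ s f₀ f₁ h₀₀ h₀₁ h₁₁ hp (ι₁ χ s x) = f₁ x := by
  have h : lift χ s f₀ f₁ h₀₀ h₀₁ h₁₁ hp (ι₁ χ s x) = liftEnv s f₀ f₁ h₀₀ h₀₁ h₁₁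
      (mkEnv s (TensorAlgebra.ι K (0, x))) := RingQuot.liftAlgHom_mkAlgHom_apply K _ _ _
  rw [h, liftEnv_mkEnv]
  simp

end LiftGenerators

/-! ### The oscillator representation of `U_χ(q(n))`. -/

section OscillatorRep

variable {K : Type*} [Field K] {p n : ℕ} {F : Type*}
  [AddCommGroup F] [Module K F] (φ : Fock K p (Fin n × Fin n) F) (χ : Module.Dual K (Mat K n))

/-- The operators that represent the even (`false`) or odd (`true`) elements of `q(n)`. -/
def oscMap (s : Bool) : Mat K n →ₗ[K] Module.End K F where
  toFun M := ∑ i, ∑ j, M i j • opG φ χ s i j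
  map_add' M N := by simp [add_smul, Finset.sum_add_distrib]
  map_smul' c M := by simp [Finset.smul_sum, mul_smul]

theorem oscMap_single (s : Bool) (i j : Fin n) (c : K) :
    oscMap φ χ s (Matrix.single i j c) = c • opG φ χ s i j := by
  simp only [oscMap, LinearMap.coe_mk, AddHom.coe_mk]
  rw [Finset.sum_eq_single i, Finset.sum_eq_single j]
  · simp
  · intro b _ hb; simp [hb.symm]
  · simp
  · intro b _ hb; simp [hb.symm]
  · simp

theorem oscMap_mul (s t : Bool) (M N : Mat K n) :
    oscMap φ χ s M * oscMap φ χ t N = sg K s t • (oscMap φ χ t N * oscMap φ χ s M) +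
      oscMap φ χ (s ^^ t) (M * N - sg K s t • (N * M)) := by
  induction M using Matrix.induction_on' with
  | h_zero => simp
  | h_add M M' h h' =>
    simp only [map_add, add_mul, mul_add, h, h', smul_add, map_sub, map_smul]
    abel
  | h_std_basis i j x =>
    induction N using Matrix.induction_on' with
    | h_zero => simp
    | h_add M M' h h' =>
      simp only [map_add, add_mul, mul_add, h, h', smul_add, map_sub, map_smul]
      abel
    | h_std_basis k l y =>
      have h1 : Matrix.single i j x * Matrix.single k l y = if k = j then Matrix.single i l (x * y) else 0 := by
        split_ifs with h
        · subst h; exact Matrix.single_mul_single_same _ _ _ _ _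
        · exact Matrix.single_mul_single_of_ne _ _ _ _ (fun e => h e.symm) _
      have h2 : Matrix.single k l y * Matrix.single i j x = if i = l then Matrix.single k j (x * y) else 0 := by
        split_ifs with h
        · subst h; rw [mul_comm]; exact Matrix.single_mul_single_same _ _ _ _ _
        · exact Matrix.single_mul_single_of_ne _ _ _ _ (fun e => h e.symm) _
      rw [h1, h2, oscMap_single, oscMap_single, smul_mul_smul_comm, opG_mul_opG, smul_mul_smul_comm, mul_comm y x]
      split_ifs <;> simp only [map_sub, map_neg, map_smul, map_zero, oscMap_single, smul_sub, smul_add, smul_zero, sub_zero, add_zero, zero_sub, smul_comm (x * y)] <;> abel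

variable [Fact p.Prime] [CharP K p]

/-- By `map_pow_add` the defect `f(M)^p - f(M^p)` is additive in `M`, and so is `χ(M)^p` in
characteristic `p`. It therefore suffices to compare them on multiples of matrix units, where
`opG_pow` applies. -/
theorem oscMap_pow (hp : 2 < p) (M : Mat K n) : oscMap φ χ false M ^ p =
    oscMap φ χ false (M ^ p) + algebraMap K _ (χ M ^ p) := by
  have hp0 : p ≠ 0 := by omega
  have hnt : Nontrivial F := ⟨φ.vac, 0, φ.vac_ne⟩
  have hchar : CharP (Module.End K F) p := charP_of_injective_algebraMap (algebraMap K _).injective p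
  rcases n.eq_zero_or_pos with rfl | hn
  · rw [Subsingleton.elim M 0, zero_pow hp0, map_zero, map_zero, zero_pow hp0, zero_pow hp0, map_zero, add_zero]
  have : Nonempty (Fin n) := ⟨⟨0, hn⟩⟩
  have hcharM : CharP (Mat K n) p := Matrix.charP p
  have hodd : Odd p := (Fact.out : p.Prime).odd_of_ne_two (by omega)
  rw [← sub_eq_iff_eq_add']
  induction M using Matrix.induction_on' with
  | h_zero => rw [zero_pow hp0, map_zero, map_zero, zero_pow hp0, zero_pow hp0, map_zero, sub_zero]
  | h_add M N hM hN =>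
    rw [map_pow_add p hodd (oscMap φ χ false) (fun x y => ?_), hM, hN, map_add, add_pow_char, map_add]
    have := oscMap_mul φ χ false false x y
    simp only [sg, Bool.false_eq_true, and_self, if_false, one_smul, Bool.xor_false] at this
    rw [this, add_sub_cancel_left]
  | h_std_basis i j x =>
    have h1 : Matrix.single i j x ^ p = if i = j then Matrix.single i i (x ^ p) else 0 := by
      obtain ⟨q, rfl⟩ : ∃ q, p = q + 2 := ⟨p - 2, by omega⟩
      split_ifs with h
      · subst h
        have : ∀ k, Matrix.single i i x ^ (k + 1) = Matrix.single i i (x ^ (k + 1)) := by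
          intro k
          induction k with
          | zero => simp
          | succ k ih => rw [pow_succ, ih, Matrix.single_mul_single_same, ← pow_succ]
        exact this _
      · rw [pow_add, pow_two, Matrix.single_mul_single_of_ne _ _ _ _ (fun e => h e.symm), mul_zero]
    have h2 : χ (Matrix.single i j x) = x * χ (Matrix.single i j 1) := by
      rw [← smul_eq_mul, ← map_smul, Matrix.smul_single, smul_eq_mul, mul_one]
    rw [oscMap_single, smul_pow, opG_pow φ χ hp, h1, h2, mul_pow, map_mul, smul_add, ← Algebra.smul_def]
    split_ifs with h
    · subst h; rw [oscMap_single, add_sub_cancel_left]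
    · simp

theorem add_eq_of_eq_neg_add' {G : Type*} [AddCommGroup G] {a b c : G} (h : a = -b + c) :
    a + b = c := by
  rw [h]; abel

/-- The oscillator representation of `U_χ(q(n))`. -/
def oscRep (hp : 2 < p) : Red χ (queer K n p) →ₐ[K] Module.End K F :=
  lift χ (queer K n p) (oscMap φ χ false ∘ₗ Submodule.subtype _)
    (oscMap φ χ true ∘ₗ Submodule.subtype _)
    (fun x y => by
      have := oscMap_mul φ χ false false x y
      rw [show sg K false false = 1 by simp [sg], one_smul, one_smul] at this
      exact this)
    (fun x y => by
      have := oscMap_mul φ χ false true x y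
      rw [show sg K false true = 1 by simp [sg], one_smul, one_smul] at this
      exact this)
    (fun x y => by
      have := oscMap_mul φ χ true true x y
      rw [show sg K true true = -1 by simp [sg], neg_smul, neg_smul, one_smul, one_smul, sub_neg_eq_add] at this
      exact add_eq_of_eq_neg_add' this)
    (fun x => oscMap_pow φ χ hp x)

theorem oscRep_ι₀ (hp : 2 < p) (x : (queer K n p).even) :
    oscRep φ χ hp (ι₀ χ _ x) = oscMap φ χ false x :=
  lift_ι₀ χ _ _ _ _ _ _ _ x

theorem oscRep_ι₁ (hp : 2 < p) (x : (queer K n p).odd) :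
    oscRep φ χ hp (ι₁ χ _ x) = oscMap φ χ true x :=
  lift_ι₁ χ _ _ _ _ _ _ _ x

end OscillatorRep

/-! ### Generators of `U_χ(s)` and the PBW theorem. -/

section Generators

variable {K : Type*} [Field K] {p n : ℕ} (χ : Module.Dual K (Mat K n))

theorem adjoin_ι (s : SubSuper K n p) :
    Algebra.adjoin K (Set.range (ι₀ χ s) ∪ Set.range (ι₁ χ s)) = ⊤ := by
  rw [eq_top_iff]
  intro x hx
  clear hx
  obtain ⟨y, rfl⟩ := RingQuot.mkAlgHom_surjective K (RedRel χ s) x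
  obtain ⟨t, rfl⟩ := RingQuot.mkAlgHom_surjective K (EnvRel s) y
  change mkRed χ s (mkEnv s t) ∈ _
  induction t using TensorAlgebra.induction with
  | algebraMap r => rw [AlgHom.commutes, AlgHom.commutes]; exact Subalgebra.algebraMap_mem _ _
  | ι x =>
    have : mkRed χ s (mkEnv s (TensorAlgebra.ι K x)) = ι₀ χ s x.1 + ι₁ χ s x.2 := by
      simp only [ι₀, ι₁, LinearMap.comp_apply, AlgHom.toLinearMap_apply, ← map_add]
      simp
    rw [this]
    exact add_mem (Algebra.subset_adjoin (Or.inl ⟨_, rfl⟩)) (Algebra.subset_adjoin (Or.inr ⟨_, rfl⟩))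
  | mul a b ha hb => rw [map_mul, map_mul]; exact mul_mem ha hb
  | add a b ha hb => rw [map_add, map_add]; exact add_mem ha hb

theorem Red.algHom_ext {s : SubSuper K n p} {A : Type*} [Ring A] [Algebra K A]
    {f g : Red χ s →ₐ[K] A} (h₀ : ∀ x, f (ι₀ χ s x) = g (ι₀ χ s x))
    (h₁ : ∀ x, f (ι₁ χ s x) = g (ι₁ χ s x)) : f = g := by
  refine AlgHom.ext_of_adjoin_eq_top (adjoin_ι χ s) ?_
  rintro _ (⟨x, rfl⟩ | ⟨x, rfl⟩)
  · exact h₀ x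
  · exact h₁ x

/-- A subspace stable under the generators is stable under the algebra. -/
theorem Red.smul_mem_of_stable {s : SubSuper K n p} {M : Type*} [AddCommGroup M] [Module K M]
    [Module (Red χ s) M] [IsScalarTower K (Red χ s) M] (X : Submodule K M)
    (h₀ : ∀ x, ∀ v ∈ X, ι₀ χ s x • v ∈ X) (h₁ : ∀ x, ∀ v ∈ X, ι₁ χ s x • v ∈ X)
    (r : Red χ s) : ∀ v ∈ X, r • v ∈ X := by
  have hr : r ∈ Algebra.adjoin K (Set.range (ι₀ χ s) ∪ Set.range (ι₁ χ s)) :=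
    adjoin_ι χ s ▸ Algebra.mem_top
  induction hr using Algebra.adjoin_induction with
  | mem r hr =>
    rcases hr with ⟨x, rfl⟩ | ⟨x, rfl⟩
    · exact h₀ x
    · exact h₁ x
  | algebraMap c => intro v hv; rw [algebraMap_smul]; exact X.smul_mem c hv
  | add a b _ _ ha hb => intro v hv; rw [add_smul]; exact add_mem (ha v hv) (hb v hv)
  | mul a b _ _ ha hb => intro v hv; rw [mul_smul]; exact ha _ (hb v hv)

/-- A family of matrix units, with parities, that spans a sub-superalgebra. -/
structure UnitFamily (s : SubSuper K n p) (J : Type*) where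
  /-- parity and position of the unit -/
  q : J → Bool × Fin n × Fin n
  mem_even : ∀ j, Matrix.single (q j).2.1 (q j).2.2 1 ∈ s.even
  mem_odd : ∀ j, Matrix.single (q j).2.1 (q j).2.2 1 ∈ s.odd
  cover_even : ∀ x ∈ s.even, ∀ i k, x i k ≠ 0 → ∃ j, q j = (false, i, k)
  cover_odd : ∀ x ∈ s.odd, ∀ i k, x i k ≠ 0 → ∃ j, q j = (true, i, k)

namespace UnitFamily

variable {s : SubSuper K n p} {J : Type*} (u : UnitFamily s J)

/-- The generators of `U_χ(s)` attached to a family of matrix units. -/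
def gen (j : J) : Red χ s :=
  if (u.q j).1 then ι₁ χ s ⟨_, u.mem_odd j⟩ else ι₀ χ s ⟨_, u.mem_even j⟩

theorem mem_of_single_mem {M : Type*} [AddCommGroup M] [Module K M] {E : Submodule K (Mat K n)}
    (f : E →ₗ[K] M) (W : Submodule K M)
    (h : ∀ x ∈ E, ∀ i k, x i k ≠ 0 → ∃ hm : Matrix.single i k 1 ∈ E, f ⟨_, hm⟩ ∈ W) (x : E) :
    f x ∈ W := by
  have hx : (x : Mat K n) ∈ (W.comap f).map E.subtype := by
    rw [Matrix.matrix_eq_sum_single (x : Mat K n)]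
    refine sum_mem fun i _ => sum_mem fun k _ => ?_
    by_cases h0 : (x : Mat K n) i k = 0
    · rw [h0, Matrix.single_zero]; exact zero_mem _
    · obtain ⟨hm, hW⟩ := h x x.2 i k h0
      have : Matrix.single i k ((x : Mat K n) i k) = (x : Mat K n) i k • Matrix.single i k 1 := by
        rw [Matrix.smul_single, smul_eq_mul, mul_one]
      rw [this]
      exact Submodule.smul_mem _ _ ⟨⟨_, hm⟩, hW, rfl⟩
  obtain ⟨y, hy, hxy⟩ := hx
  have : y = x := Subtype.ext hxy
  exact this ▸ hy

theorem ι₀_mem (W : Submodule K (Red χ s)) (hW : ∀ j, u.gen χ j ∈ W) (x : s.even) : ι₀ χ s x ∈ W := by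
  refine mem_of_single_mem (ι₀ χ s) W (fun x hx i k h => ?_) x
  obtain ⟨j, hj⟩ := u.cover_even x hx i k h
  have h1 := u.mem_even j
  have h2 := hW j
  simp only [gen, hj, Bool.false_eq_true, if_false] at h1 h2
  exact ⟨h1, h2⟩

theorem ι₁_mem (W : Submodule K (Red χ s)) (hW : ∀ j, u.gen χ j ∈ W) (x : s.odd) : ι₁ χ s x ∈ W := by
  refine mem_of_single_mem (ι₁ χ s) W (fun x hx i k h => ?_) x
  obtain ⟨j, hj⟩ := u.cover_odd x hx i k h
  have h1 := u.mem_odd j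
  have h2 := hW j
  simp only [gen, hj, if_true] at h1 h2
  exact ⟨h1, h2⟩

theorem adjoin_gen : Algebra.adjoin K (Set.range (u.gen χ)) = ⊤ := by
  rw [eq_top_iff, ← adjoin_ι χ s]
  refine Algebra.adjoin_le ?_
  have h : ∀ j, u.gen χ j ∈ Subalgebra.toSubmodule (Algebra.adjoin K (Set.range (u.gen χ))) :=
    fun j => Algebra.subset_adjoin ⟨j, rfl⟩
  rintro _ (⟨x, rfl⟩ | ⟨x, rfl⟩)
  · exact u.ι₀_mem χ _ h x
  · exact u.ι₁_mem χ _ h x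

variable [Fact p.Prime] [CharP K p]

/-- The restricted ordered monomials in the generators span `U_χ(s)`. -/
theorem span_mono (hp : 2 < p) (l : List J) (hl : l.Nodup) (hl' : ∀ j, j ∈ l) :
    Submodule.span K (Set.range fun a : (j : J) → Fin (bd p (u.q j).1) =>
      mono (u.gen χ) l fun j => a j) = ⊤ := by
  have hg : ∀ j, u.gen χ j ∈ wordSpan (u.gen χ) K 1 := fun j =>
    Submodule.subset_span ⟨[j], by simp, by simp⟩
  have h₀ := u.ι₀_mem χ _ hg
  have h₁ := u.ι₁_mem χ _ hg
  have h2 : (2 : K) ≠ 0 := by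
    have := CharP.cast_eq_zero_iff K p 2
    rw [Nat.cast_ofNat] at this
    exact fun h => absurd (Nat.le_of_dvd two_pos (this.1 h)) (by omega)
  refine span_mono_eq_top (u.gen χ) (fun j => bd p (u.q j).1) (fun j => two_le_bd hp _) ?_ ?_ l hl hl'
    (u.adjoin_gen χ)
  · intro i j
    by_cases hi : (u.q i).1 = true <;> by_cases hj : (u.q j).1 = true <;> simp only [gen, hi, hj]
    · refine ⟨-1, ?_⟩
      have := ι₁_mul_ι₁ χ s ⟨_, u.mem_odd i⟩ ⟨_, u.mem_odd j⟩
      simp only [if_true, neg_smul, one_smul, sub_neg_eq_add]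
      rw [this]; exact h₀ _
    · refine ⟨1, ?_⟩
      have := ι₀_mul_ι₁ χ s ⟨_, u.mem_even j⟩ ⟨_, u.mem_odd i⟩
      simp only [if_true, Bool.false_eq_true, if_false, one_smul]
      rw [this, sub_add_cancel_left]; exact neg_mem (h₁ _)
    · refine ⟨1, ?_⟩
      have := ι₀_mul_ι₁ χ s ⟨_, u.mem_even i⟩ ⟨_, u.mem_odd j⟩
      simp only [if_true, Bool.false_eq_true, if_false, one_smul]
      rw [this, add_sub_cancel_left]; exact h₁ _
    · refine ⟨1, ?_⟩
      have := ι₀_mul_ι₀ χ s ⟨_, u.mem_even i⟩ ⟨_, u.mem_even j⟩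
      simp only [Bool.false_eq_true, if_false, one_smul]
      rw [this, add_sub_cancel_left]; exact h₀ _
  · intro j
    by_cases hj : (u.q j).1 = true <;> simp only [gen, hj, bd]
    · have := ι₁_mul_ι₁ χ s ⟨_, u.mem_odd j⟩ ⟨_, u.mem_odd j⟩
      simp only [if_true]
      -- The square of an odd generator is half of its bracket with itself, hence a combination of
      -- generators.
      rw [← two_smul K, ← pow_two] at this
      have h3 := (wordSpan (u.gen χ) K 1).smul_mem (2 : K)⁻¹ (h₀ (s.br₁₁ ⟨_, u.mem_odd j⟩ ⟨_, u.mem_odd j⟩))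
      rwa [← this, smul_smul, inv_mul_cancel₀ h2, one_smul] at h3
    · simp only [Bool.false_eq_true, if_false]
      rw [ι₀_pow, Algebra.algebraMap_eq_smul_one]
      exact add_mem (h₀ _) (Submodule.smul_mem _ _ (Submodule.subset_span ⟨[], by simp, by simp⟩))

end UnitFamily

variable [Fact p.Prime] [CharP K p]

/-- The Poincaré-Birkhoff-Witt theorem for `U_χ(q(n))`: restricted ordered monomials are linearly
independent. -/
theorem linearIndependent_mono_gen (hp : 2 < p) {J : Type*} [Finite J]
    (u : UnitFamily (queer K n p) J) (hu : Function.Injective u.q) (l : List J) (hl : l.Nodup)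
    (hl' : ∀ j, j ∈ l) :
    LinearIndependent K fun a : (j : J) → Fin (bd p (u.q j).1) => mono (u.gen χ) l fun j => a j := by
  let φ := fockModel (I := Fin n × Fin n) K p
  -- The leading term of the operator for `E_ij` is the raising operator with index `(j, i)`, hence
  -- the transposition.
  let sw : Bool × Fin n × Fin n → Bool × Fin n × Fin n := fun x => (x.1, x.2.2, x.2.1)
  have hsw : Function.Injective sw := by
    rintro ⟨a, b, c⟩ ⟨a', b', c'⟩ h
    simp only [sw, Prod.mk.injEq] at h ⊢
    tauto
  refine LinearIndependent.of_comp (oscRep φ χ hp).toLinearMap ?_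
  have hgen : ∀ j, oscRep φ χ hp (u.gen χ j) = opG φ χ (u.q j).1 (u.q j).2.1 (u.q j).2.2 := by
    intro j
    by_cases hj : (u.q j).1 = true <;> simp only [UnitFamily.gen, hj]
    · simp only [if_true]
      rw [oscRep_ι₁]
      exact (oscMap_single φ χ true _ _ 1).trans (one_smul _ _)
    · simp only [Bool.false_eq_true, if_false]
      rw [oscRep_ι₀]
      exact (oscMap_single φ χ false _ _ 1).trans (one_smul _ _)
  have := φ.linearIndependent_mono (fun j => sw (u.q j)) (hsw.comp hu)
    (fun j => opG φ χ (u.q j).1 (u.q j).2.1 (u.q j).2.2)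
    (fun j k w hw => opG_sub_mem_fil φ χ _ _ _ k hw) l hl hl'
  have e : ((oscRep φ χ hp).toLinearMap ∘ fun a : (j : J) → Fin (bd p (u.q j).1) =>
      mono (u.gen χ) l fun j => a j) =
      fun a => mono (fun j => opG φ χ (u.q j).1 (u.q j).2.1 (u.q j).2.2) l fun j => a j := by
    funext a
    refine (map_mono (oscRep φ χ hp).toRingHom.toMonoidHom _ _ _).trans ?_
    congr 1
    funext j
    exact hgen j
  rw [e]
  exact this

end Generators

/-! ### Induced modules and their parity operators. -/

section Induced

variable {K A B : Type*} [Field K] [Ring A] [Algebra K A] [Ring B] [Algebra K B]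
  (f : B →ₐ[K] A) {M : Type*} [AddCommGroup M] [Module K M] (ρ : B →ₐ[K] Module.End K M)

namespace Ind

/-- The element `a ⊗ m` of the induced module. -/
def mk : A →ₗ[K] M →ₗ[K] Ind f ρ :=
  (TensorProduct.mk K A M).compr₂ ((balanced f ρ).mkQ.restrictScalars K)

theorem mk_mul (a : A) (b : B) (m : M) : mk f ρ (a * f b) m = mk f ρ a (ρ b m) := by
  refine (Submodule.Quotient.eq _).2 (Submodule.subset_span ⟨a, b, m, rfl⟩)

theorem smul_mk (a a' : A) (m : M) : a • mk f ρ a' m = mk f ρ (a * a') m := rfl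

theorem span_mk : Submodule.span K {z | ∃ a m, z = mk f ρ a m} = ⊤ := by
  rw [eq_top_iff]
  rintro z -
  obtain ⟨t, rfl⟩ := (balanced f ρ).mkQ_surjective z
  induction t using TensorProduct.induction_on with
  | zero => rw [map_zero]; exact zero_mem _
  | tmul a m => exact Submodule.subset_span ⟨a, m, rfl⟩
  | add x y hx hy => rw [map_add]; exact add_mem hx hy

variable {f ρ} in
-- The balanced relations generate an `A`-submodule, whereas the lifted map is only `K`-linear. The
-- induction therefore shows that all `A`-multiples of an element are sent to zero.
theorem lift_aux {X : Type*} [AddCommGroup X] [Module K X] (φ : A →ₗ[K] M →ₗ[K] X)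
    (h : ∀ a b m, φ (a * f b) m = φ a (ρ b m)) :
    (balanced f ρ).restrictScalars K ≤ LinearMap.ker (TensorProduct.lift φ) := by
  intro z hz
  have key : ∀ r : A, TensorProduct.lift φ (r • z) = 0 := by
    replace hz : z ∈ balanced f ρ := hz
    induction hz using Submodule.span_induction with
    | mem z hz =>
      obtain ⟨a, b, m, rfl⟩ := hz
      intro r
      rw [smul_sub, TensorProduct.smul_tmul', TensorProduct.smul_tmul', map_sub,
        TensorProduct.lift.tmul, TensorProduct.lift.tmul, smul_eq_mul, smul_eq_mul, ← mul_assoc, h,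
        sub_self]
    | zero => intro r; rw [smul_zero, map_zero]
    | add x y _ _ hx hy => intro r; rw [smul_add, map_add, hx, hy, add_zero]
    | smul a x _ hx => intro r; rw [smul_smul]; exact hx _
  rw [LinearMap.mem_ker, ← one_smul A z]
  exact key 1

variable {f ρ} in
/-- The universal property of the induced module. -/
def lift {X : Type*} [AddCommGroup X] [Module K X] (φ : A →ₗ[K] M →ₗ[K] X)
    (h : ∀ a b m, φ (a * f b) m = φ a (ρ b m)) : Ind f ρ →ₗ[K] X :=
  ((balanced f ρ).restrictScalars K).liftQ (TensorProduct.lift φ) (lift_aux φ h) ∘ₗ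
    (Submodule.Quotient.restrictScalarsEquiv K (balanced f ρ)).symm.toLinearMap

variable {f ρ} in
theorem lift_mk {X : Type*} [AddCommGroup X] [Module K X] (φ : A →ₗ[K] M →ₗ[K] X)
    (h : ∀ a b m, φ (a * f b) m = φ a (ρ b m)) (a : A) (m : M) :
    lift φ h (mk f ρ a m) = φ a m :=
  TensorProduct.lift.tmul _ _

variable {f ρ} in
/-- The parity operator of an induced module. -/
def parity (θA : A →ₐ[K] A) (θB : B →ₐ[K] B) (θM : M →ₗ[K] M)
    (hf : ∀ b, θA (f b) = f (θB b)) (hρ : ∀ b m, θM (ρ b m) = ρ (θB b) (θM m)) :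
    Ind f ρ →ₗ[K] Ind f ρ :=
  lift ((mk f ρ).compl₁₂ θA.toLinearMap θM) fun a b m => by
    simp only [LinearMap.compl₁₂_apply, AlgHom.toLinearMap_apply, map_mul, hf, hρ, mk_mul]

variable {f ρ} in
theorem parity_mk (θA : A →ₐ[K] A) (θB : B →ₐ[K] B) (θM : M →ₗ[K] M) (hf hρ) (a : A) (m : M) :
    parity (f := f) (ρ := ρ) θA θB θM hf hρ (mk f ρ a m) = mk f ρ (θA a) (θM m) :=
  lift_mk _ _ _ _

variable {f ρ} in
theorem parity_smul (θA : A →ₐ[K] A) (θB : B →ₐ[K] B) (θM : M →ₗ[K] M) (hf hρ) (a : A)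
    (z : Ind f ρ) : parity (f := f) (ρ := ρ) θA θB θM hf hρ (a • z) =
      θA a • parity (f := f) (ρ := ρ) θA θB θM hf hρ z := by
  have hz : z ∈ Submodule.span K {z | ∃ a m, z = mk f ρ a m} := span_mk f ρ ▸ Submodule.mem_top
  induction hz using Submodule.span_induction with
  | mem z hz =>
    obtain ⟨a', m, rfl⟩ := hz
    rw [smul_mk, parity_mk, parity_mk, smul_mk, map_mul]
  | zero => simp
  | add x y _ _ hx hy => rw [smul_add, map_add, map_add, hx, hy, smul_add]
  | smul c x _ hx => rw [smul_comm a c x, map_smul, hx, map_smul, smul_comm]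

end Ind

/-- The sign `(-1)^i`. -/
def eps (K : Type*) [Field K] (i : ZMod 2) : K := if i = 0 then 1 else -1

theorem eps_add (i j : ZMod 2) : eps K (i + j) = eps K i * eps K j := by
  have h : ∀ i : ZMod 2, i = 0 ∨ i = 1 := by decide
  have h2 : (1 + 1 : ZMod 2) = 0 := by decide
  rcases h i with rfl | rfl <;> rcases h j with rfl | rfl <;> simp [eps, h2]

/-- The subspaces `gM 0` and `gM 1` span the space, and the operator `θ` acts on them by `1` and
`-1`. -/
def IsParity {M : Type*} [AddCommGroup M] [Module K M] (θ : M →ₗ[K] M)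
    (gM : ZMod 2 → Submodule K M) : Prop :=
  (∀ i, ∀ x ∈ gM i, θ x = eps K i • x) ∧ gM 0 ⊔ gM 1 = ⊤

/-- The homogeneous components of `x` are `(x + θ x) / 2` and `(x - θ x) / 2`, so containing them
amounts to stability under `θ`. -/
theorem isGradedSubmodule_iff (h2 : (2 : K) ≠ 0) {M : Type*} [AddCommGroup M] [Module K M]
    [Module A M] [IsScalarTower K A M] {θ : M →ₗ[K] M} {gM : ZMod 2 → Submodule K M}
    (h : IsParity θ gM) (N : Submodule A M) : IsGradedSubmodule gM N ↔ ∀ x ∈ N, θ x ∈ N := by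
  constructor
  · intro hN x hx
    obtain ⟨y, hy, z, hz, hy0, hz1, rfl⟩ := hN x hx
    rw [map_add, h.1 0 y hy0, h.1 1 z hz1]
    simp only [eps, if_true, one_ne_zero, if_false, one_smul, neg_smul]
    exact add_mem hy (neg_mem hz)
  · intro hN x hx
    have hx' : x ∈ gM 0 ⊔ gM 1 := h.2 ▸ Submodule.mem_top
    obtain ⟨y, hy, z, hz, rfl⟩ := Submodule.mem_sup.1 hx'
    have hθ := hN _ hx
    rw [map_add, h.1 0 y hy, h.1 1 z hz] at hθ
    simp only [eps, if_true, one_ne_zero, if_false, one_smul, neg_smul] at hθ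
    have e1 := N.smul_mem (algebraMap K A 2⁻¹) (add_mem hx hθ)
    have e2 := N.smul_mem (algebraMap K A 2⁻¹) (sub_mem hx hθ)
    rw [algebraMap_smul, show y + z + (y + -z) = (2 : K) • y by rw [two_smul]; abel,
      inv_smul_smul₀ h2] at e1
    rw [algebraMap_smul, show y + z - (y + -z) = (2 : K) • z by rw [two_smul]; abel,
      inv_smul_smul₀ h2] at e2
    exact ⟨y, e1, z, e2, hy, hz, rfl⟩

theorem IsParity.ind {θA : A →ₐ[K] A} {θB : B →ₐ[K] B} {θM : M →ₗ[K] M}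
    {gA : ZMod 2 → Submodule K A} {gM : ZMod 2 → Submodule K M} (hA : IsParity θA.toLinearMap gA)
    (hM : IsParity θM gM) (hf hρ) :
    IsParity (Ind.parity (f := f) (ρ := ρ) θA θB θM hf hρ) (indGrading f ρ gA gM) := by
  refine ⟨fun i x hx => ?_, ?_⟩
  · induction hx using Submodule.span_induction with
    | mem x hx =>
      obtain ⟨j, k, a, m, rfl, ha, hm, rfl⟩ := hx
      have h1 := hA.1 j a ha
      rw [AlgHom.toLinearMap_apply] at h1
      refine (Ind.parity_mk θA θB θM hf hρ a m).trans ?_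
      rw [h1, hM.1 k m hm, map_smul, map_smul, LinearMap.smul_apply, smul_smul, eps_add, mul_comm]
      rfl
    | zero => simp
    | add x y _ _ hx hy => rw [map_add, hx, hy, smul_add]
    | smul c x _ hx => rw [map_smul, hx, smul_comm]
  · rw [eq_top_iff, ← Ind.span_mk f ρ, Submodule.span_le]
    rintro _ ⟨a, m, rfl⟩
    have ha : a ∈ gA 0 ⊔ gA 1 := hA.2 ▸ Submodule.mem_top
    have hm : m ∈ gM 0 ⊔ gM 1 := hM.2 ▸ Submodule.mem_top
    obtain ⟨a0, ha0, a1, ha1, rfl⟩ := Submodule.mem_sup.1 ha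
    obtain ⟨m0, hm0, m1, hm1, rfl⟩ := Submodule.mem_sup.1 hm
    have key : ∀ (j k i : ZMod 2) (a : A) (m : M), j + k = i → a ∈ gA j → m ∈ gM k →
        Ind.mk f ρ a m ∈ indGrading f ρ gA gM i := fun j k i a m h ha hm =>
      Submodule.subset_span ⟨j, k, a, m, h, ha, hm, rfl⟩
    have h0 : indGrading f ρ gA gM 0 ≤ indGrading f ρ gA gM 0 ⊔ indGrading f ρ gA gM 1 := le_sup_left
    have h1 : indGrading f ρ gA gM 1 ≤ indGrading f ρ gA gM 0 ⊔ indGrading f ρ gA gM 1 := le_sup_right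
    simp only [map_add, LinearMap.add_apply]
    exact add_mem (add_mem (h0 (key 0 0 0 _ _ (by decide) ha0 hm0)) (h1 (key 1 0 1 _ _ (by decide) ha1 hm0)))
      (add_mem (h1 (key 0 1 1 _ _ (by decide) ha0 hm1)) (h0 (key 1 1 0 _ _ (by decide) ha1 hm1)))

end Induced

/-! ### The parity automorphism of `U_χ(s)`. -/

section RedParity

variable {K : Type*} [Field K] {p n : ℕ} (χ : Module.Dual K (Mat K n)) (s : SubSuper K n p)

/-- The parity automorphism of `U_χ(s)`. -/
def redParity : Red χ s →ₐ[K] Red χ s :=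
  lift χ s (ι₀ χ s) (-ι₁ χ s) (ι₀_mul_ι₀ χ s)
    (fun x y => by
      simp only [LinearMap.neg_apply, mul_neg, neg_mul, ι₀_mul_ι₁ χ s x y, neg_add])
    (fun x y => by simpa only [LinearMap.neg_apply, neg_mul_neg] using ι₁_mul_ι₁ χ s x y)
    (ι₀_pow χ s)

theorem redParity_ι₀ (x : s.even) : redParity χ s (ι₀ χ s x) = ι₀ χ s x :=
  lift_ι₀ χ s _ _ _ _ _ _ x

theorem redParity_ι₁ (x : s.odd) : redParity χ s (ι₁ χ s x) = -ι₁ χ s x :=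
  lift_ι₁ χ s _ _ _ _ _ _ x

theorem isParity_grading : IsParity (redParity χ s).toLinearMap (grading χ s) := by
  refine ⟨fun i x hx => ?_, ?_⟩
  · induction hx using Submodule.span_induction with
    | mem x hx =>
      rw [AlgHom.toLinearMap_apply]
      induction hx with
      | one => simp [eps]
      | even_mul x i u h ih => rw [map_mul, redParity_ι₀, ih, mul_smul_comm]
      | odd_mul y i u h ih =>
        rw [map_mul, redParity_ι₁, ih, mul_smul_comm, eps_add]
        simp [eps]
    | zero => simp
    | add x y _ _ hx hy => rw [map_add, hx, hy, smul_add]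
    | smul c x _ hx => rw [map_smul, hx, smul_comm]
  · rw [eq_top_iff]
    intro r _
    have hmon : ∀ i u, Mono χ s i u → u ∈ grading χ s 0 ⊔ grading χ s 1 := by
      intro i u h
      have hi : ∀ i : ZMod 2, i = 0 ∨ i = 1 := by decide
      rcases hi i with rfl | rfl
      · exact Submodule.mem_sup_left (Submodule.subset_span h)
      · exact Submodule.mem_sup_right (Submodule.subset_span h)
    have hle : grading χ s 0 ⊔ grading χ s 1 ≤ Submodule.span K {u | ∃ i, Mono χ s i u} :=
      sup_le (Submodule.span_mono fun u h => ⟨0, h⟩) (Submodule.span_mono fun u h => ⟨1, h⟩)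
    have hge : Submodule.span K {u | ∃ i, Mono χ s i u} ≤ grading χ s 0 ⊔ grading χ s 1 :=
      Submodule.span_le.2 fun u ⟨i, h⟩ => hmon i u h
    have h := Red.smul_mem_of_stable χ (s := s) (Submodule.span K {u | ∃ i, Mono χ s i u})
      (fun x v hv => by
        induction hv using Submodule.span_induction with
        | mem v hv => obtain ⟨i, h⟩ := hv; exact Submodule.subset_span ⟨i, h.even_mul x⟩
        | zero => rw [smul_zero]; exact zero_mem _
        | add a b _ _ ha hb => rw [smul_add]; exact add_mem ha hb
        | smul c a _ ha => rw [smul_comm]; exact Submodule.smul_mem _ c ha)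
      (fun x v hv => by
        induction hv using Submodule.span_induction with
        | mem v hv => obtain ⟨i, h⟩ := hv; exact Submodule.subset_span ⟨i + 1, h.odd_mul x⟩
        | zero => rw [smul_zero]; exact zero_mem _
        | add a b _ _ ha hb => rw [smul_add]; exact add_mem ha hb
        | smul c a _ ha => rw [smul_comm]; exact Submodule.smul_mem _ c ha)
      r 1 (Submodule.subset_span ⟨0, Mono.one⟩)
    rw [smul_eq_mul, mul_one] at h
    exact hge h

theorem incl_ι₀ {s t : SubSuper K n p} (h₀ : s.even ≤ t.even) (h₁ : s.odd ≤ t.odd) (x : s.even) :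
    incl χ h₀ h₁ (ι₀ χ s x) = ι₀ χ t (Submodule.inclusion h₀ x) :=
  lift_ι₀ χ s _ _ _ _ _ _ x

theorem incl_ι₁ {s t : SubSuper K n p} (h₀ : s.even ≤ t.even) (h₁ : s.odd ≤ t.odd) (x : s.odd) :
    incl χ h₀ h₁ (ι₁ χ s x) = ι₁ χ t (Submodule.inclusion h₁ x) :=
  lift_ι₁ χ s _ _ _ _ _ _ x

theorem redParity_incl {s t : SubSuper K n p} (h₀ : s.even ≤ t.even) (h₁ : s.odd ≤ t.odd)
    (r : Red χ s) : redParity χ t (incl χ h₀ h₁ r) = incl χ h₀ h₁ (redParity χ s r) := by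
  have : (redParity χ t).comp (incl χ h₀ h₁) = (incl χ h₀ h₁).comp (redParity χ s) := by
    refine Red.algHom_ext χ (fun x => ?_) (fun x => ?_)
    · rw [AlgHom.comp_apply, AlgHom.comp_apply, incl_ι₀, redParity_ι₀, redParity_ι₀, incl_ι₀]
    · rw [AlgHom.comp_apply, AlgHom.comp_apply, incl_ι₁, redParity_ι₁, redParity_ι₁, map_neg, incl_ι₁]
  exact DFunLike.congr_fun this r

end RedParity

/-! ### Irreducibility of Clifford modules induced from maximal isotropic subspaces. -/

section Clifford

variable {K : Type*} [Field K] {D M : Type*} [AddCommGroup D] [Module K D] [AddCommGroup M]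
  [Module K M] (B : D → D → K) (c : D →ₗ[K] Module.End K M)

/-- The operators attached to an isotropic subspace anticommute and square to zero. Generators of
`H` are treated one at a time: either `c a` already kills `y`, or `c a y` is a nonzero replacement,
killed by `c a` and still killed by the earlier operators. -/
theorem exists_forall_apply_eq_zero (h2 : (2 : K) ≠ 0)
    (hc : ∀ a b x, c a (c b x) + c b (c a x) = B a b • x) [FiniteDimensional K D]
    (H : Submodule K D) (hH : ∀ a ∈ H, ∀ b ∈ H, B a b = 0) (N : Submodule K M)
    (hN : ∀ a ∈ H, ∀ x ∈ N, c a x ∈ N) {x : M} (hx : x ∈ N) (hx0 : x ≠ 0) :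
    ∃ y ∈ N, y ≠ 0 ∧ ∀ a ∈ H, c a y = 0 := by
  classical
  have key : ∀ s : Finset D, (∀ a ∈ s, a ∈ H) → ∃ y ∈ N, y ≠ 0 ∧ ∀ a ∈ s, c a y = 0 := by
    intro s
    induction s using Finset.induction_on with
    | empty => exact fun _ => ⟨x, hx, hx0, by simp⟩
    | insert a s _ ih =>
      intro hs
      obtain ⟨y, hy, hy0, hk⟩ := ih fun b hb => hs b (Finset.mem_insert_of_mem hb)
      have ha := hs a (Finset.mem_insert_self a s)
      by_cases h : c a y = 0
      · refine ⟨y, hy, hy0, fun b hb => ?_⟩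
        rcases Finset.mem_insert.1 hb with rfl | hb
        · exact h
        · exact hk b hb
      · refine ⟨c a y, hN a ha y hy, h, fun b hb => ?_⟩
        rcases Finset.mem_insert.1 hb with rfl | hb
        · have := hc b b y
          rw [hH b ha b ha, zero_smul, ← two_smul K] at this
          exact (smul_eq_zero.1 this).resolve_left h2
        · have := hc b a y
          rwa [hH b (hs b (Finset.mem_insert_of_mem hb)) a ha, zero_smul, hk b hb, map_zero,
            add_zero] at this
  obtain ⟨s, hs⟩ := (IsNoetherian.noetherian H : H.FG)
  obtain ⟨y, hy, hy0, hk⟩ := key s fun a ha => hs ▸ Submodule.subset_span ha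
  refine ⟨y, hy, hy0, fun a ha => ?_⟩
  rw [← hs] at ha
  induction ha using Submodule.span_induction with
  | mem a ha => exact hk a ha
  | zero => simp
  | add a b _ _ ha hb => rw [map_add, LinearMap.add_apply, ha, hb, add_zero]
  | smul r a _ ha => rw [map_smul, LinearMap.smul_apply, ha, smul_zero]

/-- The smallest subspace that contains `ω` and is stable under the operators in `T`. -/
def stableHull (T : Submodule K D) (ω : M) : Submodule K M :=
  sInf {X | ω ∈ X ∧ ∀ t ∈ T, ∀ x ∈ X, c t x ∈ X}

theorem mem_stableHull (T : Submodule K D) (ω : M) : ω ∈ stableHull c T ω := by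
  rw [stableHull, Submodule.mem_sInf]
  exact fun X hX => hX.1

theorem apply_mem_stableHull (T : Submodule K D) (ω : M) {t : D} (ht : t ∈ T) {x : M}
    (hx : x ∈ stableHull c T ω) : c t x ∈ stableHull c T ω := by
  rw [stableHull, Submodule.mem_sInf] at hx ⊢
  exact fun X hX => hX.2 t ht x (hx X hX)

theorem stableHull_le {T : Submodule K D} {ω : M} {X : Submodule K M} (h : ω ∈ X)
    (h' : ∀ t ∈ T, ∀ x ∈ X, c t x ∈ X) : stableHull c T ω ≤ X :=
  sInf_le ⟨h, h'⟩

/-- Write `T' = T ∩ ker B(a, ·)`, so that `T = T' + K b`, and let `V'` be the hull of `ω` under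
`T'`. The hull under `T` lies in `V' + c b V'`, and `c a` kills `V'`. For `x = v + c b w` one gets
`c a x = B(a, b) w`, so `c a x = 0` forces `w = 0` and `x` lies in `V'`. -/
theorem mem_stableHull_inf_ker (B : LinearMap.BilinForm K D)
    (h2 : (2 : K) ≠ 0) (hc : ∀ a b x, c a (c b x) + c b (c a x) = B a b • x) {ω : M} {a b : D} (ha : c a ω = 0)
    {T : Submodule K D} (hb : b ∈ T) (hab : B a b ≠ 0) {x : M} (hx : x ∈ stableHull c T ω)
    (hax : c a x = 0) : x ∈ stableHull c (T ⊓ LinearMap.ker (B a)) ω := by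
  have hT : ∀ t ∈ T, ∃ t' ∈ T ⊓ LinearMap.ker (B a), ∃ r : K, t = t' + r • b := by
    intro t ht
    refine ⟨t - (B a t / B a b) • b, ⟨sub_mem ht (T.smul_mem _ hb), ?_⟩, B a t / B a b,
      (sub_add_cancel _ _).symm⟩
    refine LinearMap.mem_ker.2 ?_
    rw [map_sub, map_smul, smul_eq_mul, div_mul_cancel₀ _ hab, sub_self]
  set T' := T ⊓ LinearMap.ker (B a)
  set V' := stableHull c T' ω
  have hle : stableHull c T ω ≤ V' ⊔ V'.map (c b) := by
    refine stableHull_le c (Submodule.mem_sup_left (mem_stableHull c _ _)) fun t ht x hx => ?_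
    obtain ⟨v, hv, _, ⟨w, hw, rfl⟩, rfl⟩ := Submodule.mem_sup.1 hx
    obtain ⟨t', ht', r, rfl⟩ := hT t ht
    have h1 : c t' (c b w) = B t' b • w - c b (c t' w) := eq_sub_of_add_eq (hc t' b w)
    have h3 : c b (c b w) = (2⁻¹ * B b b) • w := by
      have := hc b b w
      rw [← two_smul K] at this
      rw [mul_smul, ← this, inv_smul_smul₀ h2]
    have e : c (t' + r • b) = c t' + r • c b := by rw [map_add, map_smul]
    rw [e, LinearMap.add_apply, LinearMap.smul_apply, map_add, map_add, h1, h3]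
    refine add_mem (add_mem (Submodule.mem_sup_left (apply_mem_stableHull c _ _ ht' hv))
      (sub_mem (Submodule.mem_sup_left (V'.smul_mem _ hw)) (Submodule.mem_sup_right
        ⟨_, apply_mem_stableHull c _ _ ht' hw, rfl⟩))) (Submodule.smul_mem _ _
      (add_mem (Submodule.mem_sup_right ⟨v, hv, rfl⟩) (Submodule.mem_sup_left (V'.smul_mem _ hw))))
  have hker : V' ≤ LinearMap.ker (c a) := by
    refine stableHull_le c ha fun t ht x hx => ?_
    have := hc a t x
    rw [LinearMap.mem_ker.1 hx, map_zero, add_zero, LinearMap.mem_ker.1 ht.2, zero_smul] at this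
    exact this
  obtain ⟨v, hv, _, ⟨w, hw, rfl⟩, rfl⟩ := Submodule.mem_sup.1 (hle hx)
  have h1 := hc a b w
  rw [map_add, LinearMap.mem_ker.1 (hker hv), zero_add] at hax
  rw [hax, LinearMap.mem_ker.1 (hker hw), map_zero, add_zero] at h1
  rw [(smul_eq_zero.1 h1.symm).resolve_left hab, map_zero, add_zero]
  exact hv

/-- By maximality, an isotropic vector orthogonal to `H` lies in `H`, so the quotient of the
orthogonal space by `H` is anisotropic. Over an algebraically closed field it has dimension at most
one: if `B(u, u) ≠ 0`, a root `r` of a quadratic equation makes `v - r u` isotropic. -/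
theorem exists_orthogonal_generator [IsAlgClosed K] (B : LinearMap.BilinForm K D)
    (hB : ∀ a b, B a b = B b a) {H : Submodule K D}
    (hH : Maximal (fun H : Submodule K D => ∀ a ∈ H, ∀ b ∈ H, B a b = 0) H) :
    ∃ u, (∀ a ∈ H, B a u = 0) ∧ (B u u ≠ 0 ∨ u = 0) ∧
      ∀ v, (∀ a ∈ H, B a v = 0) → ∃ r : K, v - r • u ∈ H := by
  have hmem : ∀ v, (∀ a ∈ H, B a v = 0) → B v v = 0 → v ∈ H := by
    intro v hv hvv
    have hle : H ⊔ Submodule.span K {v} ≤ H := by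
      refine hH.2 ?_ le_sup_left
      intro a ha b hb
      obtain ⟨a', ha', _, hr, rfl⟩ := Submodule.mem_sup.1 ha
      obtain ⟨b', hb', _, hs, rfl⟩ := Submodule.mem_sup.1 hb
      obtain ⟨r, rfl⟩ := Submodule.mem_span_singleton.1 hr
      obtain ⟨s, rfl⟩ := Submodule.mem_span_singleton.1 hs
      simp [hH.prop a' ha' b' hb', hv a' ha', hB v b', hv b' hb', hvv]
    exact hle (Submodule.mem_sup_right (Submodule.mem_span_singleton_self v))
  by_cases h : ∃ u, (∀ a ∈ H, B a u = 0) ∧ B u u ≠ 0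
  · obtain ⟨u, hu, huu⟩ := h
    refine ⟨u, hu, Or.inl huu, fun v hv => ?_⟩
    obtain ⟨r, hr⟩ : ∃ r : K, B u u * r * r + -(2 * B u v) * r + B v v = 0 := by
      obtain ⟨s, hs⟩ := IsAlgClosed.exists_root
        (Polynomial.C (B u u) * Polynomial.X ^ 2 + Polynomial.C (-(2 * B u v)) * Polynomial.X +
          Polynomial.C (B v v)) (by rw [Polynomial.degree_quadratic huu]; decide)
      refine ⟨s, ?_⟩
      simpa [Polynomial.IsRoot, pow_two, mul_assoc] using hs
    refine ⟨r, hmem _ (fun a ha => by simp [hv a ha, hu a ha]) ?_⟩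
    simp only [map_sub, map_smul, LinearMap.sub_apply, LinearMap.smul_apply, smul_eq_mul, hB v u]
    linear_combination hr
  · push Not at h
    exact ⟨0, by simp, Or.inr rfl, fun v hv => ⟨0, by
      simpa using hmem v hv (h v hv)⟩⟩

/-- A Clifford module that is generated by a vector killed by a maximal isotropic subspace is
irreducible as a supermodule. -/
theorem mem_of_maximal_isotropic [IsAlgClosed K] [FiniteDimensional K D] (h2 : (2 : K) ≠ 0)
    (B : LinearMap.BilinForm K D) (hB : ∀ a b, B a b = B b a)
    (hc : ∀ a b x, c a (c b x) + c b (c a x) = B a b • x) {H : Submodule K D}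
    (hH : Maximal (fun H : Submodule K D => ∀ a ∈ H, ∀ b ∈ H, B a b = 0) H) {ω : M}
    (hω : ∀ a ∈ H, c a ω = 0) (hspan : stableHull c ⊤ ω = ⊤) (θ : M →ₗ[K] M)
    (hθω : θ ω = ω) (hθ : ∀ a x, θ (c a x) = -c a (θ x)) (N : Submodule K M)
    (hN : ∀ a, ∀ x ∈ N, c a x ∈ N) (hNθ : ∀ x ∈ N, θ x ∈ N) (hN0 : N ≠ ⊥) : ω ∈ N := by
  obtain ⟨x₀, hx₀, hx₀'⟩ := Submodule.exists_mem_ne_zero_of_ne_bot hN0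
  obtain ⟨x, hx, hx0, hk⟩ := exists_forall_apply_eq_zero (fun a b => B a b) c h2 hc H hH.prop N
    (fun a _ => hN a) hx₀ hx₀'
  -- A minimal `T` whose hull contains `x` is orthogonal to `H`, since any `t` in `T` not orthogonal
  -- to some `a` in `H` would allow `T` to be cut down to `T ∩ ker B(a, ·)`. Thus `x` is a
  -- combination of `ω` and `c u ω`.
  obtain ⟨T, hT, hmin⟩ : ∃ T : Submodule K D, x ∈ stableHull c T ω ∧
      ∀ T', T' < T → x ∉ stableHull c T' ω := by
    obtain ⟨T, hT, hmin⟩ := (wellFounded_lt (α := Submodule K D)).has_min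
      {T | x ∈ stableHull c T ω} ⟨⊤, by rw [Set.mem_ofPred_eq, hspan]; trivial⟩
    exact ⟨T, hT, fun T' h h' => hmin T' h' h⟩
  have hperp : ∀ t ∈ T, ∀ a ∈ H, B a t = 0 := by
    intro t ht a ha
    by_contra hat
    refine hmin (T ⊓ LinearMap.ker (B a)) (lt_of_le_of_ne inf_le_left fun e => ?_)
      (mem_stableHull_inf_ker c B h2 hc (hω a ha) ht hat hT (hk a ha))
    rw [← e] at ht
    exact hat ht.2
  obtain ⟨u, hu, huu, hgen⟩ := exists_orthogonal_generator B hB hH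
  have hcc : c u (c u ω) = (2⁻¹ * B u u) • ω := by
    have := hc u u ω
    rw [← two_smul K] at this
    rw [mul_smul, ← this, inv_smul_smul₀ h2]
  have hle : stableHull c T ω ≤ Submodule.span K {ω, c u ω} := by
    refine stableHull_le c (Submodule.subset_span (by simp)) fun t ht y hy => ?_
    obtain ⟨α, β, rfl⟩ := Submodule.mem_span_pair.1 hy
    obtain ⟨r, hr⟩ := hgen t (hperp t ht)
    have e : c t = c (t - r • u) + r • c u := by rw [← map_smul, ← map_add, sub_add_cancel]
    have h1 := hc (t - r • u) u ω
    rw [hω _ hr, map_zero, add_zero, hu _ hr, zero_smul] at h1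
    rw [e, LinearMap.add_apply, map_add, map_smul, map_smul, hω _ hr, h1, smul_zero, smul_zero,
      add_zero, zero_add, LinearMap.smul_apply, map_add, map_smul, map_smul, hcc]
    refine Submodule.smul_mem _ _ (Submodule.mem_span_pair.2 ⟨β * (2⁻¹ * B u u), α, ?_⟩)
    rw [mul_smul, add_comm]
  obtain ⟨α, β, rfl⟩ := Submodule.mem_span_pair.1 (hle hT)
  -- The vector `ω` is even and `c u ω` is odd, so averaging with `θ` isolates `α ω`. If `α = 0`,
  -- another application of `c u` turns `β c u ω` into a nonzero multiple of `ω`.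
  have h3 := hNθ _ hx
  rw [map_add, map_smul, map_smul, hθ, hθω, smul_neg] at h3
  have h4 := N.smul_mem (2 : K)⁻¹ (add_mem hx h3)
  rw [show α • ω + β • c u ω + (α • ω + -(β • c u ω)) = (2 : K) • (α • ω) by
    rw [two_smul]; abel, inv_smul_smul₀ h2] at h4
  by_cases hα : α = 0
  · subst hα
    rw [zero_smul, zero_add] at hx hx0
    have hβ : β ≠ 0 := fun h => hx0 (by rw [h, zero_smul])
    have hu0 : u ≠ 0 := fun h => hx0 (by rw [h, map_zero, LinearMap.zero_apply, smul_zero])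
    have h5 := hN u _ hx
    rw [map_smul, hcc, smul_smul] at h5
    exact (N.smul_mem_iff (mul_ne_zero hβ (mul_ne_zero (inv_ne_zero h2)
      (huu.resolve_right hu0)))).1 h5
  · exact (N.smul_mem_iff hα).1 h4

end Clifford

/-! ### The module `V_χ(wt)` of the Cartan subalgebra. -/

section HighWeight

variable {K : Type*} [Field K] {p n : ℕ} (χ : Module.Dual K (Mat K n))
  (wt : Module.Dual K (diagSub K n)) (hwt : wt ∈ weights p χ) (H : Submodule K (diagSub K n))
  (hH : IsIsotropic p wt H)

theorem inclCartan_ι₀ (x : diagSub K n) :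
    inclCartan p χ H (ι₀ χ (cartanSub p H) x) = ι₀ χ (cartan K n p) x :=
  incl_ι₀ χ (s := cartanSub p H) (t := cartan K n p) _ _ x

theorem inclCartan_ι₁ (x : (cartanSub p H).odd) :
    inclCartan p χ H (ι₁ χ (cartanSub p H) x) =
      ι₁ χ (cartan K n p) ⟨x, Submodule.map_subtype_le (diagSub K n) H x.2⟩ :=
  incl_ι₁ χ (s := cartanSub p H) (t := cartan K n p) _ _ x

theorem oneDim_ι₀ (x : diagSub K n) (k : K) :
    oneDim p χ wt hwt H hH (ι₀ χ (cartanSub p H) x) k = wt x * k := by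
  exact congrArg (· * k) (lift_ι₀ χ (cartanSub p H) (A := K) wt 0 _ _ _ _ x)

theorem oneDim_ι₁ (x : (cartanSub p H).odd) (k : K) :
    oneDim p χ wt hwt H hH (ι₁ χ (cartanSub p H) x) k = 0 := by
  exact (congrArg (· * k) (lift_ι₁ χ (cartanSub p H) (A := K) wt 0 _ _ _ _ x)).trans (zero_mul k)

theorem oneDim_apply (r : Red χ (cartanSub p H)) (k : K) :
    oneDim p χ wt hwt H hH r k = k * oneDim p χ wt hwt H hH r 1 := by
  rw [← smul_eq_mul, ← map_smul, smul_eq_mul, mul_one]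

theorem ι₀_cartan_comm (x : diagSub K n) (r : Red χ (cartan K n p)) :
    ι₀ χ (cartan K n p) x * r = r * ι₀ χ (cartan K n p) x := by
  have hr : r ∈ Algebra.adjoin K (Set.range (ι₀ χ (cartan K n p)) ∪ Set.range (ι₁ χ (cartan K n p))) :=
    adjoin_ι χ (cartan K n p) ▸ Algebra.mem_top
  induction hr using Algebra.adjoin_induction with
  | mem r hr =>
    rcases hr with ⟨y, rfl⟩ | ⟨y, rfl⟩
    · have h := ι₀_mul_ι₀ χ (cartan K n p) x y
      have e : (cartan K n p).br₀₀ x y = 0 := Subtype.ext (sub_eq_zero.2 (diag_mul_comm x.2 y.2))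
      rwa [e, map_zero, add_zero] at h
    · have h := ι₀_mul_ι₁ χ (cartan K n p) x y
      have e : (cartan K n p).br₀₁ x y = 0 := Subtype.ext (sub_eq_zero.2 (diag_mul_comm x.2 y.2))
      rwa [e, map_zero, add_zero] at h
  | algebraMap c => exact (Algebra.commutes c _).symm
  | add a b _ _ ha hb => rw [mul_add, add_mul, ha, hb]
  | mul a b _ _ ha hb => rw [← mul_assoc, ha, mul_assoc, hb, mul_assoc]

/-- The highest weight vector of `V_χ(wt)`. -/
def highVec : HighWeight p χ wt hwt H hH :=
  Ind.mk (inclCartan p χ H) (oneDim p χ wt hwt H hH) 1 1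

theorem mk_eq_smul_highVec (r : Red χ (cartan K n p)) (k : K) :
    Ind.mk (inclCartan p χ H) (oneDim p χ wt hwt H hH) r k = (k • r) • highVec χ wt hwt H hH := by
  rw [highVec, Ind.smul_mk, mul_one, map_smul, LinearMap.smul_apply, ← map_smul, smul_eq_mul, mul_one]

theorem exists_smul_highVec (v : HighWeight p χ wt hwt H hH) :
    ∃ r : Red χ (cartan K n p), v = r • highVec χ wt hwt H hH := by
  have hv : v ∈ Submodule.span K {z | ∃ a m, z =
      Ind.mk (inclCartan p χ H) (oneDim p χ wt hwt H hH) a m} := by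
    rw [Ind.span_mk]; trivial
  induction hv using Submodule.span_induction with
  | mem v hv => obtain ⟨a, m, rfl⟩ := hv; exact ⟨_, mk_eq_smul_highVec χ wt hwt H hH a m⟩
  | zero => exact ⟨0, (zero_smul _ _).symm⟩
  | add x y _ _ hx hy =>
    obtain ⟨r, rfl⟩ := hx
    obtain ⟨s, rfl⟩ := hy
    exact ⟨r + s, (add_smul _ _ _).symm⟩
  | smul c x _ hx =>
    obtain ⟨r, rfl⟩ := hx
    exact ⟨c • r, (smul_assoc c r _).symm⟩

theorem ι₀_smul_highWeight (x : diagSub K n) (v : HighWeight p χ wt hwt H hH) :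
    ι₀ χ (cartan K n p) x • v = wt x • v := by
  obtain ⟨r, rfl⟩ := exists_smul_highVec χ wt hwt H hH v
  have h : ι₀ χ (cartan K n p) x • highVec χ wt hwt H hH = wt x • highVec χ wt hwt H hH := by
    rw [highVec, Ind.smul_mk, mul_one, ← one_mul (ι₀ χ (cartan K n p) x), ← inclCartan_ι₀ χ H x,
      Ind.mk_mul, oneDim_ι₀, ← smul_eq_mul, map_smul]
  rw [smul_smul, ι₀_cartan_comm, mul_smul, h, smul_comm]

theorem ι₁_smul_highVec {a : diagSub K n} (ha : a ∈ H) :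
    ι₁ χ (cartan K n p) a • highVec χ wt hwt H hH = 0 := by
  have h := inclCartan_ι₁ (p := p) χ H ⟨a, a, ha, rfl⟩
  have h' : ι₁ χ (cartan K n p) a = inclCartan p χ H (ι₁ χ (cartanSub p H) ⟨a, a, ha, rfl⟩) := h.symm
  rw [highVec, Ind.smul_mk, mul_one, ← one_mul (ι₁ χ (cartan K n p) a), h', Ind.mk_mul, oneDim_ι₁,
    map_zero]

/-- The bilinear form `(a, b) ↦ wt([a, b])` on the odd part of the Cartan subalgebra. -/
def pairing : LinearMap.BilinForm K (diagSub K n) :=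
  LinearMap.mk₂ K (fun a b : diagSub K n => wt ⟨(a : Mat K n) * b + b * a,
      add_mem (diag_mul_mem a.2 b.2) (diag_mul_mem b.2 a.2)⟩)
    (fun a b c => by
      rw [← map_add]; congr 1; ext1
      simp only [Submodule.coe_add, add_mul, mul_add]; abel)
    (fun r a b => by
      rw [← map_smul]; congr 1; ext1
      simp)
    (fun a b c => by
      rw [← map_add]; congr 1; ext1
      simp only [Submodule.coe_add, add_mul, mul_add]; abel)
    (fun r a b => by
      rw [← map_smul]; congr 1; ext1
      simp)

theorem pairing_comm (a b : diagSub K n) : pairing wt a b = pairing wt b a := by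
  exact congrArg wt (Subtype.ext (add_comm _ _))

/-- The action of the odd part of the Cartan subalgebra on `V_χ(wt)`. -/
def oddAction : diagSub K n →ₗ[K] Module.End K (HighWeight p χ wt hwt H hH) :=
  (Algebra.lsmul K K (HighWeight p χ wt hwt H hH)).toLinearMap ∘ₗ ι₁ χ (cartan K n p)

theorem oddAction_apply (a : diagSub K n) (v : HighWeight p χ wt hwt H hH) :
    oddAction χ wt hwt H hH a v = ι₁ χ (cartan K n p) a • v := rfl

theorem oddAction_anticomm (a b : diagSub K n) (v : HighWeight p χ wt hwt H hH) :
    oddAction χ wt hwt H hH a (oddAction χ wt hwt H hH b v) +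
      oddAction χ wt hwt H hH b (oddAction χ wt hwt H hH a v) = pairing wt a b • v := by
  rw [oddAction_apply, oddAction_apply, oddAction_apply, oddAction_apply, smul_smul, smul_smul,
    ← add_smul]
  have := ι₁_mul_ι₁ χ (cartan K n p) a b
  rw [this]
  exact ι₀_smul_highWeight χ wt hwt H hH _ v

theorem eq_top_of_highVec_mem {N : Submodule K (HighWeight p χ wt hwt H hH)}
    (hN : ∀ a : diagSub K n, ∀ x ∈ N, ι₁ χ (cartan K n p) a • x ∈ N)
    (h : highVec χ wt hwt H hH ∈ N) : N = ⊤ := by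
  rw [eq_top_iff]
  rintro v -
  obtain ⟨r, rfl⟩ := exists_smul_highVec χ wt hwt H hH v
  refine Red.smul_mem_of_stable χ N (fun x v hv => ?_) (fun x v hv => hN x v hv) r _ h
  have := ι₀_smul_highWeight χ wt hwt H hH x v
  rw [this]
  exact N.smul_mem _ hv

theorem oneDim_redParity (r : Red χ (cartanSub p H)) :
    oneDim p χ wt hwt H hH (redParity χ (cartanSub p H) r) = oneDim p χ wt hwt H hH r := by
  have : (oneDim p χ wt hwt H hH).comp (redParity χ (cartanSub p H)) = oneDim p χ wt hwt H hH := by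
    refine Red.algHom_ext χ (fun x => ?_) (fun x => ?_)
    · rw [AlgHom.comp_apply, redParity_ι₀]
    · rw [AlgHom.comp_apply, redParity_ι₁, map_neg]
      ext
      rw [LinearMap.neg_apply, oneDim_ι₁, neg_zero]
  exact DFunLike.congr_fun this r

/-- The parity operator of `V_χ(wt)`. -/
def highParity : HighWeight p χ wt hwt H hH →ₗ[K] HighWeight p χ wt hwt H hH :=
  Ind.parity (redParity χ (cartan K n p)) (redParity χ (cartanSub p H)) LinearMap.id
    (redParity_incl χ _ _) (fun b m => by
      rw [oneDim_redParity]; rfl)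

theorem highParity_smul (r : Red χ (cartan K n p)) (v : HighWeight p χ wt hwt H hH) :
    highParity χ wt hwt H hH (r • v) = redParity χ _ r • highParity χ wt hwt H hH v :=
  Ind.parity_smul _ _ _ _ _ r v

theorem highParity_highVec : highParity χ wt hwt H hH (highVec χ wt hwt H hH) =
    highVec χ wt hwt H hH := by
  refine (Ind.parity_mk _ _ _ _ _ _ _).trans ?_
  rw [map_one]; rfl

theorem isParity_highWeightGrading :
    IsParity (highParity χ wt hwt H hH) (highWeightGrading p χ wt hwt H hH) := by
  refine IsParity.ind _ _ (isParity_grading χ (cartan K n p)) ⟨fun i x hx => ?_, ?_⟩ _ _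
  · by_cases h : i = 0
    · simp [eps, h]
    · rw [if_neg h, Submodule.mem_bot] at hx
      simp [hx]
  · rw [if_pos rfl, top_sup_eq]

theorem eq_bot_or_eq_top_of_stable [IsAlgClosed K] (h2 : (2 : K) ≠ 0)
    (hmax : Maximal (IsIsotropic p wt) H) (N : Submodule K (HighWeight p χ wt hwt H hH))
    (hN : ∀ a : diagSub K n, ∀ x ∈ N, ι₁ χ (cartan K n p) a • x ∈ N)
    (hθ : ∀ x ∈ N, highParity χ wt hwt H hH x ∈ N) : N = ⊥ ∨ N = ⊤ := by
  refine or_iff_not_imp_left.2 fun h0 => eq_top_of_highVec_mem χ wt hwt H hH hN ?_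
  refine mem_of_maximal_isotropic (oddAction χ wt hwt H hH) h2 (pairing wt) (pairing_comm wt)
    (oddAction_anticomm χ wt hwt H hH) hmax (fun a ha => ι₁_smul_highVec χ wt hwt H hH ha) ?_
    (highParity χ wt hwt H hH) (highParity_highVec χ wt hwt H hH) (fun a x => ?_) N hN hθ h0
  · exact eq_top_of_highVec_mem χ wt hwt H hH
      (fun a x hx => apply_mem_stableHull (oddAction χ wt hwt H hH) ⊤ _ (t := a) trivial hx)
      (mem_stableHull _ _ _)
  · have h := redParity_ι₁ χ (cartan K n p) a
    rw [oddAction_apply, highParity_smul, oddAction_apply, ← neg_smul]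
    exact congrArg (· • _) h

/-- The Clifford algebra of the quadratic form `a ↦ wt([a, a]) / 2` is a module for `U_χ(h)`.
Isotropy of `H` yields a nonzero `y` in it that is killed by `H`, and `r ⊗ k ↦ k r y` is then well
defined and sends the highest weight vector to `y`. -/
theorem highVec_ne_zero (h2 : (2 : K) ≠ 0) : highVec χ wt hwt H hH ≠ 0 := by
  let Q : QuadraticForm K (diagSub K n) :=
    LinearMap.BilinMap.toQuadraticMap ((2 : K)⁻¹ • pairing wt)
  have : Invertible (2 : K) := invertibleOfNonzero h2
  let C := CliffordAlgebra Q
  have hQ : ∀ a b : diagSub K n, CliffordAlgebra.ι Q a * CliffordAlgebra.ι Q b +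
      CliffordAlgebra.ι Q b * CliffordAlgebra.ι Q a = algebraMap K C (pairing wt a b) := by
    intro a b
    rw [CliffordAlgebra.ι_mul_ι_add_swap]
    congr 1
    simp only [Q, LinearMap.BilinMap.polar_toQuadraticMap, LinearMap.smul_apply, smul_eq_mul,
      pairing_comm wt b a]
    rw [← two_mul, mul_inv_cancel_left₀ h2]
  let ρ : Red χ (cartan K n p) →ₐ[K] C := lift χ (cartan K n p) (A := C)
    ((Algebra.linearMap K C) ∘ₗ wt) (CliffordAlgebra.ι Q)
    (fun x y => by
      have e : (cartan K n p).br₀₀ x y = 0 := Subtype.ext (sub_eq_zero.2 (diag_mul_comm x.2 y.2))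
      rw [e]
      refine (Algebra.commutes (R := K) (A := C) (wt x) _).trans ?_
      exact (add_eq_left.2 (map_zero (Algebra.linearMap K C ∘ₗ wt))).symm)
    (fun x y => by
      have e : (cartan K n p).br₀₁ x y = 0 := Subtype.ext (sub_eq_zero.2 (diag_mul_comm x.2 y.2))
      rw [e]
      refine (Algebra.commutes (R := K) (A := C) (wt x) _).trans ?_
      exact (add_eq_left.2 (map_zero (CliffordAlgebra.ι Q))).symm)
    (fun x y => hQ x y)
    (fun x => by
      have h := hwt x
      have h' := congrArg (algebraMap K C) (sub_eq_iff_eq_add'.1 h)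
      rw [map_pow, map_add] at h'
      exact h')
  have hρ₀ : ∀ x : diagSub K n, ρ (ι₀ χ (cartan K n p) x) = algebraMap K C (wt x) := fun x => lift_ι₀ χ (cartan K n p) _ _ _ _ _ _ x
  have hρ₁ : ∀ x : diagSub K n, ρ (ι₁ χ (cartan K n p) x) = CliffordAlgebra.ι Q x := fun x => lift_ι₁ χ (cartan K n p) _ _ _ _ _ _ x
  obtain ⟨y, -, hy0, hy⟩ := exists_forall_apply_eq_zero (fun a b => pairing wt a b)
    ((Algebra.lmul K C).toLinearMap ∘ₗ CliffordAlgebra.ι Q) h2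
    (fun a b x => by
      simp only [LinearMap.comp_apply, AlgHom.toLinearMap_apply, Algebra.coe_lmul_eq_mul,
        LinearMap.mul_apply', ← mul_assoc, ← add_mul, hQ, Algebra.smul_def]) H hH ⊤
    (fun _ _ _ _ => trivial) (x := (1 : C)) trivial one_ne_zero
  have hb : ∀ b, ρ (inclCartan p χ H b) * y = oneDim p χ wt hwt H hH b 1 • y := by
    intro b
    have hb : b ∈ Algebra.adjoin K (Set.range (ι₀ χ (cartanSub p H)) ∪
        Set.range (ι₁ χ (cartanSub p H))) := adjoin_ι χ (cartanSub p H) ▸ Algebra.mem_top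
    induction hb using Algebra.adjoin_induction with
    | mem r hr =>
      rcases hr with ⟨x, rfl⟩ | ⟨x, rfl⟩
      · have h1 := inclCartan_ι₀ (p := p) χ H x
        have h3 := oneDim_ι₀ χ wt hwt H hH x 1
        rw [mul_one] at h3
        have h4 := hρ₀ x
        rw [h1]
        refine (congrArg (· * y) h4).trans ?_
        rw [← Algebra.smul_def]
        exact congrArg (· • y) h3.symm
      · have h1 := inclCartan_ι₁ (p := p) χ H x
        have h3 := oneDim_ι₁ χ wt hwt H hH x 1
        obtain ⟨_, a, ha, rfl⟩ := x
        rw [h1, h3, zero_smul]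
        exact (congrArg (· * y) (hρ₁ a)).trans (hy a ha)
    | algebraMap c =>
      rw [AlgHom.commutes, AlgHom.commutes, AlgHom.commutes, ← Algebra.smul_def]
      simp
    | add a b _ _ ha hb => rw [map_add, map_add, add_mul, ha, hb, map_add, LinearMap.add_apply, add_smul]
    | mul a b _ _ ha hb =>
      rw [map_mul, map_mul, mul_assoc, hb, mul_smul_comm, ha, smul_smul, map_mul, Module.End.mul_apply,
        oneDim_apply χ wt hwt H hH a (oneDim p χ wt hwt H hH b 1)]
  let ψ : HighWeight p χ wt hwt H hH →ₗ[K] C := Ind.lift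
    (((LinearMap.lsmul K C).flip ∘ₗ (LinearMap.mulRight K y)) ∘ₗ ρ.toLinearMap)
    (fun a b m => by
      simp only [LinearMap.comp_apply, AlgHom.toLinearMap_apply, map_mul, LinearMap.mulRight_apply,
        LinearMap.flip_apply, LinearMap.lsmul_apply, mul_assoc, hb]
      rw [oneDim_apply χ wt hwt H hH b m, mul_smul_comm, smul_smul])
  intro h
  have h1 : ψ (highVec χ wt hwt H hH) = y := by
    refine (Ind.lift_mk _ _ _ _).trans ?_
    simp
  rw [h, map_zero] at h1
  exact hy0 h1.symm

end HighWeight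

/-! ### Unique expansions in induced modules. -/

section Expansion

variable {K R S : Type*} [Field K] [Ring R] [Algebra K R] [Ring S] [Algebra K S]
  (f : S →ₐ[K] R) {M : Type*} [AddCommGroup M] [Module K M] (ρ : S →ₐ[K] Module.End K M)
  {A C : Type*} [Fintype A] [Fintype C] (x : A → R) (y : C → S)

/-- The map `(m a) ↦ ∑ x a ⊗ m a` into an induced module. -/
def Ind.expand : (A → M) →ₗ[K] Ind f ρ := ∑ a, Ind.mk f ρ (x a) ∘ₗ LinearMap.proj a

theorem Ind.expand_apply (v : A → M) : Ind.expand f ρ x v = ∑ a, Ind.mk f ρ (x a) (v a) := by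
  simp [Ind.expand]

/-- If the products `x a * f (y c)` form a basis of `R`, and the `y c` span `S`, then every element
of a module induced from `S` to `R` is uniquely a sum `∑ x a ⊗ m a`. -/
theorem Ind.expand_bijective (hli : LinearIndependent K fun z : A × C => x z.1 * f (y z.2))
    (hsp : Submodule.span K (Set.range fun z : A × C => x z.1 * f (y z.2)) = ⊤)
    (hy : Submodule.span K (Set.range y) = ⊤) : Function.Bijective (Ind.expand f ρ x) := by
  classical
  -- The hypotheses say that `R` is a free right `S`-module on the `x a`, with `Θ` the coordinate
  -- isomorphism. Its inverse is right `S`-linear, so applying `ρ` to the coordinates gives a left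
  -- inverse of the expansion map.
  let Θ : (A → S) →ₗ[K] R := ∑ a, LinearMap.mulLeft K (x a) ∘ₗ f.toLinearMap ∘ₗ LinearMap.proj a
  have hΘ : ∀ u, Θ u = ∑ a, x a * f (u a) := fun u => by simp [Θ]
  let L : (A → C → K) → (A → S) := fun c a => ∑ k, c a k • y k
  have hL : Function.Surjective L := by
    intro u
    have : ∀ a, ∃ c : C → K, ∑ k, c k • y k = u a := fun a => by
      have h : u a ∈ Submodule.span K (Set.range y) := hy ▸ Submodule.mem_top
      exact (Submodule.mem_span_range_iff_exists_fun K).1 h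
    choose c hc using this
    exact ⟨c, funext hc⟩
  have hΘL : ∀ c : A → C → K, Θ (L c) = ∑ z : A × C, c z.1 z.2 • (x z.1 * f (y z.2)) := by
    intro c
    rw [hΘ, Fintype.sum_prod_type]
    refine Finset.sum_congr rfl fun a _ => ?_
    simp only [L, map_sum, map_smul, Finset.mul_sum, mul_smul_comm]
  have hbij : Function.Bijective Θ := by
    constructor
    · rw [injective_iff_map_eq_zero]
      intro u hu
      obtain ⟨c, rfl⟩ := hL u
      rw [hΘL] at hu
      have h0 := Fintype.linearIndependent_iff.1 hli (fun z => c z.1 z.2) hu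
      funext a
      exact Finset.sum_eq_zero fun k _ => by rw [h0 (a, k), zero_smul]
    · intro r
      have h : r ∈ Submodule.span K (Set.range fun z : A × C => x z.1 * f (y z.2)) :=
        hsp ▸ Submodule.mem_top
      obtain ⟨c, rfl⟩ := (Submodule.mem_span_range_iff_exists_fun K).1 h
      exact ⟨L fun a k => c (a, k), hΘL _⟩
  let e := LinearEquiv.ofBijective Θ hbij
  have he : ∀ u, e u = ∑ a, x a * f (u a) := hΘ
  have hmul : ∀ r s a, e.symm (r * f s) a = e.symm r a * s := by
    intro r s a
    have : e.symm (r * f s) = fun a => e.symm r a * s := by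
      rw [LinearEquiv.symm_apply_eq, he]
      simp only [map_mul, ← mul_assoc, ← Finset.sum_mul]
      rw [← he, LinearEquiv.apply_symm_apply]
    rw [this]
  have hx : ∀ a, e.symm (x a) = Pi.single a 1 := by
    intro a
    rw [LinearEquiv.symm_apply_eq, he, Finset.sum_eq_single a]
    · simp
    · intro b _ hb; simp [hb]
    · simp
  let φ : R →ₗ[K] M →ₗ[K] (A → M) := LinearMap.mk₂ K (fun r m a => ρ (e.symm r a) m)
    (fun r r' m => by ext a; simp) (fun c r m => by ext a; simp) (fun r m m' => by ext a; simp)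
    (fun c r m => by ext a; simp)
  have hφ : ∀ r m a, φ r m a = ρ (e.symm r a) m := fun _ _ _ => rfl
  let G : Ind f ρ →ₗ[K] (A → M) := Ind.lift φ fun r s m => by
    ext a
    rw [hφ, hφ, hmul, map_mul]; rfl
  constructor
  · refine Function.LeftInverse.injective (g := G) fun v => ?_
    rw [Ind.expand_apply, map_sum]
    ext b
    rw [Finset.sum_apply, Finset.sum_eq_single b]
    · rw [Ind.lift_mk, hφ, hx, Pi.single_eq_same, map_one]; rfl
    · intro a _ hab
      rw [Ind.lift_mk, hφ, hx, Pi.single_eq_of_ne hab.symm, map_zero]; rfl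
    · simp
  · rw [← LinearMap.range_eq_top, eq_top_iff, ← Ind.span_mk f ρ, Submodule.span_le]
    rintro _ ⟨r, m, rfl⟩
    obtain ⟨u, rfl⟩ := hbij.2 r
    refine ⟨fun a => ρ (u a) m, ?_⟩
    rw [Ind.expand_apply, hΘ, map_sum, LinearMap.sum_apply]
    exact Finset.sum_congr rfl fun a _ => (Ind.mk_mul f ρ _ _ _).symm

end Expansion

/-! ### Matrix units sorted along triangular decompositions. -/

section Families

variable {n : ℕ} (K : Type*) [Field K] (p : ℕ) (σ : Equiv.Perm (Fin n))

/-- The positive roots `ε_(τ a) - ε_(τ b)`, where `a < b` and `τ = σ⁻¹`. -/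
abbrev Root (n : ℕ) := {r : Fin n × Fin n // r.1 < r.2}

/-- The matrix units of the cartan subalgebra. -/
def cartanFamily : UnitFamily (cartan K n p) (Fin n × Bool) where
  q j := (j.2, j.1, j.1)
  mem_even j i k h := Matrix.single_apply_of_ne _ _ _ _ _ (fun e => h (e.1.symm.trans e.2))
  mem_odd j i k h := Matrix.single_apply_of_ne _ _ _ _ _ (fun e => h (e.1.symm.trans e.2))
  cover_even x hx i k h := ⟨(i, false), by
    have : i = k := by_contra fun e => h (hx i k e)
    rw [this]⟩
  cover_odd x hx i k h := ⟨(i, true), by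
    have : i = k := by_contra fun e => h (hx i k e)
    rw [this]⟩

theorem single_mem_borelSub {a b : Fin n} (h : a ≤ b) :
    Matrix.single (σ.symm a) (σ.symm b) (1 : K) ∈ borelSub K σ := by
  intro i k hik
  refine Matrix.single_apply_of_ne _ _ _ _ _ ?_
  rintro ⟨rfl, rfl⟩
  rw [Equiv.apply_symm_apply, Equiv.apply_symm_apply] at hik
  exact absurd h (not_le_of_gt hik)

/-- The matrix units of the Borel subalgebra. -/
def borelFamily : UnitFamily (borel K p σ) ({r : Fin n × Fin n // r.1 ≤ r.2} × Bool) where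
  q j := (j.2, σ.symm j.1.1.1, σ.symm j.1.1.2)
  mem_even j := single_mem_borelSub K σ j.1.2
  mem_odd j := single_mem_borelSub K σ j.1.2
  cover_even x hx i k h := ⟨(⟨(σ i, σ k), not_lt.1 fun e => h (hx i k e)⟩, false), by simp⟩
  cover_odd x hx i k h := ⟨(⟨(σ i, σ k), not_lt.1 fun e => h (hx i k e)⟩, true), by simp⟩

/-- The matrix units of `q(n)`, divided into those of `n⁻` and those of the Borel subalgebra. -/
def negBorelFamily : UnitFamily (queer K n p)
    (Root n × Bool ⊕ {r : Fin n × Fin n // r.1 ≤ r.2} × Bool) where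
  q := Sum.elim (fun j => (j.2, σ.symm j.1.1.2, σ.symm j.1.1.1))
    (fun j => (j.2, σ.symm j.1.1.1, σ.symm j.1.1.2))
  mem_even _ := trivial
  mem_odd _ := trivial
  cover_even x _ i k _ := (lt_or_ge (σ k) (σ i)).elim
    (fun h => ⟨Sum.inl (⟨(σ k, σ i), h⟩, false), by simp⟩)
    (fun h => ⟨Sum.inr (⟨(σ i, σ k), h⟩, false), by simp⟩)
  cover_odd x _ i k _ := (lt_or_ge (σ k) (σ i)).elim
    (fun h => ⟨Sum.inl (⟨(σ k, σ i), h⟩, true), by simp⟩)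
    (fun h => ⟨Sum.inr (⟨(σ i, σ k), h⟩, true), by simp⟩)

theorem negBorelFamily_injective : Function.Injective (negBorelFamily K p σ).q := by
  rintro (⟨⟨⟨a, b⟩, h⟩, s⟩ | ⟨⟨⟨a, b⟩, h⟩, s⟩) (⟨⟨⟨a', b'⟩, h'⟩, s'⟩ | ⟨⟨⟨a', b'⟩, h'⟩, s'⟩) e <;>
    simp only [negBorelFamily, Sum.elim_inl, Sum.elim_inr, Prod.mk.injEq,
      EmbeddingLike.apply_eq_iff_eq] at e <;> obtain ⟨rfl, rfl, rfl⟩ := e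
  · rfl
  · exact absurd h (not_lt_of_ge h')
  · exact absurd h' (not_lt_of_ge h)
  · rfl

/-- The matrix units of `q(n)`, divided into those of `n⁺`, the Cartan subalgebra and `n⁻`. -/
def triangularFamily : UnitFamily (queer K n p) (Root n × Bool ⊕ Fin n × Bool ⊕ Root n × Bool) where
  q := Sum.elim (fun j => (j.2, σ.symm j.1.1.1, σ.symm j.1.1.2)) (Sum.elim
    (fun j => (j.2, j.1, j.1)) (fun j => (j.2, σ.symm j.1.1.2, σ.symm j.1.1.1)))
  mem_even _ := trivial
  mem_odd _ := trivial
  cover_even x _ i k _ := by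
    rcases lt_trichotomy (σ i) (σ k) with h | h | h
    · exact ⟨Sum.inl (⟨(σ i, σ k), h⟩, false), by simp⟩
    · obtain rfl := σ.injective h
      exact ⟨Sum.inr (Sum.inl (i, false)), by simp⟩
    · exact ⟨Sum.inr (Sum.inr (⟨(σ k, σ i), h⟩, false)), by simp⟩
  cover_odd x _ i k _ := by
    rcases lt_trichotomy (σ i) (σ k) with h | h | h
    · exact ⟨Sum.inl (⟨(σ i, σ k), h⟩, true), by simp⟩
    · obtain rfl := σ.injective h
      exact ⟨Sum.inr (Sum.inl (i, true)), by simp⟩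
    · exact ⟨Sum.inr (Sum.inr (⟨(σ k, σ i), h⟩, true)), by simp⟩

end Families

/-! ### Matrix units as elements of `U_χ(q(n))`. -/

section Units

variable {K : Type*} [Field K] {p n : ℕ} (p) (χ : Module.Dual K (Mat K n)) (σ : Equiv.Perm (Fin n))

/-- The even (`false`) and odd (`true`) matrix units in `U_χ(q(n))`, indexed by positions in the
order given by `σ`. -/
def un (s : Bool) (a b : Fin n) : Red χ (queer K n p) :=
  if s then ι₁ χ (queer K n p) ⟨Matrix.single (σ.symm a) (σ.symm b) 1, trivial⟩
  else ι₀ χ (queer K n p) ⟨Matrix.single (σ.symm a) (σ.symm b) 1, trivial⟩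

theorem inclBorel_gen (j : {r : Fin n × Fin n // r.1 ≤ r.2} × Bool) :
    inclBorel p σ χ ((borelFamily K p σ).gen χ j) = (negBorelFamily K p σ).gen χ (Sum.inr j) := by
  obtain ⟨r, _ | _⟩ := j
  · exact incl_ι₀ χ (s := borel K p σ) (t := queer K n p) _ _ _
  · exact incl_ι₁ χ (s := borel K p σ) (t := queer K n p) _ _ _

end Units

/-! ### Expansion of the baby Verma module over `n⁻`. -/

section Verma

variable {K : Type*} [Field K] {p n : ℕ} [Fact p.Prime] [CharP K p]
  (χ : Module.Dual K (Mat K n)) (σ : Equiv.Perm (Fin n))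

/-- The exponents of the restricted monomials in the root vectors. -/
abbrev Expo (p n : ℕ) := (j : Root n × Bool) → Fin (bd p j.2)

/-- The restricted monomials in the negative root vectors. -/
def negMono (p : ℕ) (χ : Module.Dual K (Mat K n)) (σ : Equiv.Perm (Fin n))
    (l : List (Root n × Bool)) (a : Expo p n) : Red χ (queer K n p) :=
  mono (fun j : Root n × Bool => un p χ σ j.2 j.1.1.2 j.1.1.1) l fun j => a j

/-- Listing the matrix units of `n⁻` before those of the Borel subalgebra makes every restricted PBW
monomial a product of a negative monomial and a Borel monomial. Hence `U_χ(q(n))` is free over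
`U_χ(b)` on the negative monomials, in any order of the negative roots. -/
theorem expand_negMono_bijective (hp : 2 < p) {l : List (Root n × Bool)} (hl : l.Nodup) (hl' : ∀ j, j ∈ l)
    {M : Type*} [AddCommGroup M] [Module K M] (ρ : Red χ (borel K p σ) →ₐ[K] Module.End K M) :
    Function.Bijective (Ind.expand (inclBorel p σ χ) ρ (negMono p χ σ l)) := by
  classical
  let BI := {r : Fin n × Fin n // r.1 ≤ r.2} × Bool
  let lB : List BI := (Finset.univ : Finset BI).toList
  have hB : lB.Nodup := Finset.nodup_toList _
  have hB' : ∀ j, j ∈ lB := fun j => by simp [lB]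
  let l2 : List (Root n × Bool ⊕ BI) := l.map Sum.inl ++ lB.map Sum.inr
  have hl2 : l2.Nodup := by
    rw [List.nodup_append]
    refine ⟨hl.map Sum.inl_injective, hB.map Sum.inr_injective, ?_⟩
    simp
  have hl2' : ∀ j, j ∈ l2 := by
    rintro (j | j)
    · simp [l2, hl']
    · simp [l2, hB']
  let y : ((j : BI) → Fin (bd p j.2)) → Red χ (borel K p σ) := fun c =>
    mono ((borelFamily K p σ).gen χ) lB fun j => c j
  let E : ((j : Root n × Bool ⊕ BI) → Fin (bd p ((negBorelFamily K p σ).q j).1)) ≃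
      Expo p n × ((j : BI) → Fin (bd p j.2)) := Equiv.sumPiEquivProdPi _
  have key : (fun z : Expo p n × ((j : BI) → Fin (bd p j.2)) =>
      negMono p χ σ l z.1 * inclBorel p σ χ (y z.2)) =
      (fun a : (j : _) → Fin (bd p ((negBorelFamily K p σ).q j).1) =>
        mono ((negBorelFamily K p σ).gen χ) l2 fun j => a j) ∘ E.symm := by
    funext z
    refine Eq.trans ?_ (mono_append _ _ _ _).symm
    rw [mono_map, mono_map]
    refine congrArg (negMono p χ σ l z.1 * ·) ?_
    refine (map_mono (inclBorel p σ χ).toRingHom.toMonoidHom _ _ _).trans ?_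
    refine congrArg (fun g => mono g lB fun j => (z.2 j : ℕ)) ?_
    funext j
    exact inclBorel_gen p χ σ j
  refine Ind.expand_bijective (inclBorel p σ χ) ρ (negMono p χ σ l) y ?_ ?_ ?_
  · rw [key]
    exact (linearIndependent_mono_gen χ hp (negBorelFamily K p σ) (negBorelFamily_injective K p σ)
      l2 hl2 hl2').comp _ E.symm.injective
  · rw [key, Set.range_comp, E.symm.surjective.range_eq, Set.image_univ]
    exact (negBorelFamily K p σ).span_mono χ hp l2 hl2 hl2'
  · exact (borelFamily K p σ).span_mono χ hp lB hB hB'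

end Verma

/-! ### Relations among the matrix units. -/

section UnitRelations

variable {K : Type*} [Field K] (p : ℕ) {n : ℕ} (χ : Module.Dual K (Mat K n)) (σ : Equiv.Perm (Fin n))

/-- The element of `U_χ(q(n))` of the given parity that is attached to a matrix. -/
def elt (s : Bool) : Mat K n →ₗ[K] Red χ (queer K n p) :=
  match s with
  | true => ι₁ χ (queer K n p) ∘ₗ (Submodule.topEquiv (R := K) (M := Mat K n)).symm.toLinearMap
  | false => ι₀ χ (queer K n p) ∘ₗ (Submodule.topEquiv (R := K) (M := Mat K n)).symm.toLinearMap

theorem un_eq (s : Bool) (a b : Fin n) :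
    un p χ σ s a b = elt p χ s (Matrix.single (σ.symm a) (σ.symm b) 1) := by
  cases s <;> rfl

theorem elt_mul (s t : Bool) (M N : Mat K n) : elt p χ s M * elt p χ t N =
    sg K s t • (elt p χ t N * elt p χ s M) + elt p χ (s ^^ t) (M * N - sg K s t • (N * M)) := by
  cases s <;> cases t
  · have h := ι₀_mul_ι₀ χ (queer K n p) ⟨M, trivial⟩ ⟨N, trivial⟩
    simp only [sg, Bool.false_eq_true, and_self, if_false, one_smul]
    exact h
  · have h := ι₀_mul_ι₁ χ (queer K n p) ⟨M, trivial⟩ ⟨N, trivial⟩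
    simp only [sg, Bool.false_eq_true, false_and, if_false, one_smul]
    exact h
  · have h := ι₀_mul_ι₁ χ (queer K n p) ⟨N, trivial⟩ ⟨M, trivial⟩
    simp only [sg, Bool.false_eq_true, and_false, if_false, one_smul]
    have e : elt p χ true (M * N - N * M) = - elt p χ true (N * M - M * N) := by
      rw [← map_neg, neg_sub]
    have h' : elt p χ false N * elt p χ true M =
      elt p χ true M * elt p χ false N + elt p χ true (N * M - M * N) := h
    change _ = _ + elt p χ true _
    rw [h', e, add_neg_cancel_right]
  · have h := ι₁_mul_ι₁ χ (queer K n p) ⟨M, trivial⟩ ⟨N, trivial⟩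
    simp only [sg, and_self, if_true, neg_smul, one_smul, sub_neg_eq_add]
    rw [neg_add_eq_sub, eq_sub_iff_add_eq]
    exact h

theorem un_mul_un (s t : Bool) (a b c d : Fin n) : un p χ σ s a b * un p χ σ t c d =
    sg K s t • (un p χ σ t c d * un p χ σ s a b) + (if b = c then un p χ σ (s ^^ t) a d else 0) -
      sg K s t • (if d = a then un p χ σ (s ^^ t) c b else 0) := by
  have h : ∀ i j k l : Fin n, Matrix.single (σ.symm i) (σ.symm j) (1 : K) *
      Matrix.single (σ.symm k) (σ.symm l) 1 =
      if j = k then Matrix.single (σ.symm i) (σ.symm l) 1 else 0 := by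
    intro i j k l
    split_ifs with h
    · subst h; rw [Matrix.single_mul_single_same, mul_one]
    · exact Matrix.single_mul_single_of_ne _ _ _ _ (fun e => h (σ.symm.injective e)) _
  rw [un_eq, un_eq, elt_mul, h, h, map_sub, map_smul, add_sub_assoc, un_eq, un_eq]
  congr 2
  · split_ifs
    · rfl
    · exact map_zero _
  · congr 1
    split_ifs
    · rfl
    · exact map_zero _

theorem un_true_mul_self (h2 : (2 : K) ≠ 0) {a b : Fin n} (h : a ≠ b) :
    un p χ σ true a b * un p χ σ true a b = 0 := by
  have := un_mul_un p χ σ true true a b a b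
  simp only [sg, and_self, if_true, if_neg h.symm, smul_zero, neg_smul, one_smul, add_zero,
    sub_zero] at this
  rw [eq_neg_iff_add_eq_zero, ← two_smul K] at this
  exact (smul_eq_zero.1 this).resolve_left h2

theorem un_false_pow (hp : 2 < p) {a b : Fin n} (h : a ≠ b)
    (hχ : χ (Matrix.single (σ.symm a) (σ.symm b) 1) = 0) : un p χ σ false a b ^ p = 0 := by
  have h1 := ι₀_pow χ (queer K n p) ⟨Matrix.single (σ.symm a) (σ.symm b) 1, trivial⟩
  have h3 : Matrix.single (σ.symm a) (σ.symm b) (1 : K) ^ p = 0 := by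
    obtain ⟨q, rfl⟩ : ∃ q, p = q + 2 := ⟨p - 2, by omega⟩
    rw [pow_add, pow_two, Matrix.single_mul_single_of_ne _ _ _ _ (fun e => h (σ.symm.injective e.symm)),
      mul_zero]
  have h4 : (queer K n p).pmap ⟨Matrix.single (σ.symm a) (σ.symm b) 1, trivial⟩ = 0 :=
    Subtype.ext h3
  have h5 : χ (Matrix.single (σ.symm a) (σ.symm b) 1) ^ p = 0 := by rw [hχ, zero_pow (by omega)]
  refine h1.trans ?_
  rw [h4]
  change _ + algebraMap K _ (χ (Matrix.single (σ.symm a) (σ.symm b) 1) ^ p) = 0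
  rw [h5, (algebraMap K _).map_zero]
  exact (add_zero _).trans (map_zero (ι₀ χ (queer K n p)))

theorem redParity_un (s : Bool) (a b : Fin n) : redParity χ (queer K n p) (un p χ σ s a b) =
    (if s then -1 else 1 : K) • un p χ σ s a b := by
  cases s
  · rw [if_neg Bool.false_ne_true, one_smul]
    exact redParity_ι₀ χ (queer K n p) _
  · rw [if_pos rfl, neg_smul, one_smul]
    exact redParity_ι₁ χ (queer K n p) _

end UnitRelations

/-! ### The rank one computation. -/

section RankOne

variable {K : Type*} [Field K] {p n : ℕ} {χ : Module.Dual K (Mat K n)}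
  {σ : Equiv.Perm (Fin n)} {M : Type*} [AddCommGroup M] [Module K M]
  [Module (Red χ (queer K n p)) M] [IsScalarTower K (Red χ (queer K n p)) M]

theorem smul_rel {R : Type*} [Ring R] [Module R M] {x y z : R} (h : x * y = z) (v : M) :
    x • y • v = z • v := by rw [smul_smul, h]

local notation "G" => un p χ σ

theorem diag_mul_even (a b c : Fin n) : G false c c * G false b a =
    G false b a * G false c c + ((if c = b then 1 else 0) - (if a = c then 1 else 0) : K) • G false b a := by
  rw [un_mul_un]
  simp only [sg, Bool.false_eq_true, and_self, if_false, one_smul, Bool.xor_false]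
  rw [sub_smul, add_sub_assoc]
  congr 2
  · split_ifs with h
    · rw [h, one_smul]
    · rw [zero_smul]
  · split_ifs with h
    · rw [h, one_smul]
    · rw [zero_smul]

theorem diag_mul_odd (a b c : Fin n) : G false c c * G true b a =
    G true b a * G false c c + ((if c = b then 1 else 0) - (if a = c then 1 else 0) : K) • G true b a := by
  rw [un_mul_un]
  simp only [sg, Bool.false_eq_true, false_and, if_false, one_smul, Bool.false_xor]
  rw [sub_smul, add_sub_assoc]
  congr 2
  · split_ifs with h
    · rw [h, one_smul]
    · rw [zero_smul]
  · split_ifs with h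
    · rw [h, one_smul]
    · rw [zero_smul]

theorem odd_diag_mul_even (a b c : Fin n) : G true c c * G false b a =
    G false b a * G true c c + ((if c = b then 1 else 0) - (if a = c then 1 else 0) : K) • G true b a := by
  rw [un_mul_un]
  simp only [sg, Bool.false_eq_true, and_false, if_false, one_smul, Bool.xor_false]
  rw [sub_smul, add_sub_assoc]
  congr 2
  · split_ifs with h
    · rw [h, one_smul]
    · rw [zero_smul]
  · split_ifs with h
    · rw [h, one_smul]
    · rw [zero_smul]

theorem odd_diag_mul_odd (a b c : Fin n) : G true c c * G true b a =
    -(G true b a * G true c c) + ((if c = b then 1 else 0) + (if a = c then 1 else 0) : K) • G false b a := by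
  rw [un_mul_un]
  simp only [sg, and_self, if_true, neg_smul, one_smul, Bool.xor_true, Bool.not_true]
  rw [add_smul, sub_neg_eq_add, add_assoc]
  congr 2
  · split_ifs with h
    · rw [h, one_smul]
    · rw [zero_smul]
  · split_ifs with h
    · rw [h, one_smul]
    · rw [zero_smul]

theorem even_comm_odd {a b : Fin n} (h : a ≠ b) : G true a b * G false a b = G false a b * G true a b := by
  rw [un_mul_un]
  simp [sg, h.symm]

/-- If `x y = y x + c y`, then `x yᵏ = yᵏ x + k c yᵏ`. -/
theorem mul_pow_of_eigen {R : Type*} [Ring R] [Algebra K R] {x y : R} {c : K}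
    (h : x * y = y * x + c • y) (k : ℕ) : x * y ^ k = y ^ k * x + ((k : K) * c) • y ^ k := by
  induction k with
  | zero => simp
  | succ k ih =>
    rw [pow_succ, ← mul_assoc, ih, add_mul, mul_assoc, h, mul_add, smul_mul_assoc, mul_smul_comm,
      ← mul_assoc, add_assoc, ← add_smul]
    push_cast
    congr 2
    ring

variable [CharP K p]

/-- The product `f^(p-1) F` has weight `p` times a root, which vanishes in characteristic `p`. -/
theorem diag_comm_pair (hp : 2 < p) (a b c : Fin n) :
    G false c c * (G false b a ^ (p - 1) * G true b a) =
      (G false b a ^ (p - 1) * G true b a) * G false c c := by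
  have hp1 : ((p - 1 : ℕ) : K) = -1 := by
    rw [Nat.cast_sub (by omega), CharP.cast_eq_zero, Nat.cast_one, zero_sub]
  rw [← mul_assoc, mul_pow_of_eigen (diag_mul_even a b c), add_mul, mul_assoc, diag_mul_odd, mul_add,
    mul_smul_comm, smul_mul_assoc, add_assoc, ← add_smul, hp1, neg_one_mul, add_neg_cancel, zero_smul,
    add_zero, mul_assoc]

/-- Moving the odd diagonal element through a factor `f` produces an `F`, which dies against the
final `F` because `F² = 0`. Moving it through `F` produces an `f`, which completes `f^p = 0`. -/
theorem odd_diag_comm_pair (hp : 2 < p) {a b : Fin n} (hab : b ≠ a) (c : Fin n)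
    (hF : G true b a * G true b a = 0) (hf : G false b a ^ p = 0) :
    G true c c * (G false b a ^ (p - 1) * G true b a) =
      -((G false b a ^ (p - 1) * G true b a) * G true c c) := by
  have hcomm := even_comm_odd (p := p) (χ := χ) (σ := σ) hab
  have h : ∀ k, G true c c * (G false b a ^ k * G true b a) =
      G false b a ^ k * (G true c c * G true b a) := by
    intro k
    induction k with
    | zero => simp
    | succ k ih =>
      have hk : G true b a * G false b a ^ k = G false b a ^ k * G true b a :=
        (Commute.pow_right hcomm k)
      rw [pow_succ', mul_assoc, ← mul_assoc, odd_diag_mul_even, add_mul, mul_assoc, ih, smul_mul_assoc,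
        ← mul_assoc (G true b a), hk, mul_assoc _ (G true b a), hF, mul_zero, smul_zero, add_zero,
        mul_assoc]
  rw [h, odd_diag_mul_odd, mul_add, mul_smul_comm, ← pow_succ, Nat.sub_add_cancel (by omega), hf,
    smul_zero, add_zero, mul_neg, mul_assoc]

/-- The constant in the rank one computation. -/
def rankOneConst (K : Type*) [Field K] (p : ℕ) : K := -∏ k ∈ Finset.range (p - 2), ((k + 1 : ℕ) : K)

theorem rankOneConst_ne_zero (hp : 2 < p) : rankOneConst K p ≠ 0 := by
  refine neg_ne_zero.2 (Finset.prod_ne_zero_iff.2 fun k hk => ?_)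
  rw [Ne, CharP.cast_eq_zero_iff K p]
  intro h
  have := Nat.le_of_dvd (Nat.succ_pos k) h
  have := Finset.mem_range.1 hk
  omega

/-- With `D = [e, F]`, the vectors `F v` and `w = D v` satisfy `e F v = w` and `e w = 0`. Hence `e`
maps the combinations `W k` of `f^k F v` and `f^(k+1) w` to multiples of one another. Descending
from `f^(p-1) F v` to `W 0` collects the factors `x - 2, …, x - (p-1)` for `x = la - lb`, and the
last application of `E` gives `(x - 1)(la + lb)`. -/
theorem rankOne (hp : 2 < p) {a b : Fin n} (hab : a ≠ b) {la lb : K} {v : M}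
    (ha : G false a a • v = la • v) (hb : G false b b • v = lb • v) (he : G false a b • v = 0)
    (hE : G true a b • v = 0) :
    (G true a b * G false a b ^ (p - 1)) • (G false b a ^ (p - 1) * G true b a) • v =
      (rankOneConst K p * phi p la lb) • v := by
  set e := G false a b with e_def
  set E := G true a b with E_def
  set f := G false b a with f_def
  set F := G true b a with F_def
  set h := G false a a - G false b b with h_def
  set D := G true a a - G true b b with D_def
  have hba := hab.symm
  have ef : e * f = f * e + h := by
    rw [e_def, f_def, un_mul_un]; simp [sg, h_def, add_sub_assoc]
  have eF : e * F = F * e + D := by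
    rw [e_def, F_def, un_mul_un]; simp [sg, D_def, add_sub_assoc]
  have Ef : E * f = f * E + D := by
    rw [E_def, f_def, un_mul_un]; simp [sg, D_def, add_sub_assoc]
  have EF : E * F = -(F * E) + (G false a a + G false b b) := by
    rw [E_def, F_def, un_mul_un]; simp [sg, add_assoc]
  have hf : h * f = f * h + (-2 : K) • f := by
    rw [h_def, sub_mul, f_def, diag_mul_even, diag_mul_even]
    simp only [hab, if_true, if_false, mul_sub, zero_sub, sub_zero, neg_smul, one_smul, two_smul]
    abel
  have hF : h * F = F * h + (-2 : K) • F := by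
    rw [h_def, sub_mul, F_def, diag_mul_odd, diag_mul_odd]
    simp only [hab, if_true, if_false, mul_sub, zero_sub, sub_zero, neg_smul, one_smul, two_smul]
    abel
  have hDE : D * E = -(E * D) := by
    rw [D_def, sub_mul, E_def, odd_diag_mul_odd, odd_diag_mul_odd]
    simp only [hba, if_true, if_false, mul_sub, zero_add, add_zero, one_smul]
    abel
  have hDe : D * e = e * D + (2 : K) • E := by
    rw [D_def, sub_mul, e_def, odd_diag_mul_even, odd_diag_mul_even]
    simp only [hba, if_true, if_false, mul_sub, zero_sub, sub_zero, neg_smul, one_smul, two_smul]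
    abel
  have hDh : D * h = h * D := by
    have : ∀ i j, G true i i * G false j j = G false j j * G true i i := by
      intro i j
      rw [odd_diag_mul_even, sub_eq_zero.2, zero_smul, add_zero]
      simp only [eq_comm]
    simp only [D_def, h_def, mul_sub, sub_mul, this]
    abel
  have hDD : (2 : K) • (D * D) = (2 : K) • (G false a a + G false b b) := by
    have h1 := odd_diag_mul_odd (p := p) (χ := χ) (σ := σ) a a a
    have h2 := odd_diag_mul_odd (p := p) (χ := χ) (σ := σ) b b b
    have h3 := odd_diag_mul_odd (p := p) (χ := χ) (σ := σ) b b a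
    simp only [hab, hba, if_true, if_false, add_zero, zero_smul] at h1 h2 h3
    rw [eq_neg_add_iff_add_eq] at h1 h2
    rw [eq_neg_iff_add_eq_zero] at h3
    have : (2 : K) • (D * D) = (G true a a * G true a a + G true a a * G true a a) +
        (G true b b * G true b b + G true b b * G true b b) -
        (2 : K) • (G true a a * G true b b + G true b b * G true a a) := by
      simp only [D_def, mul_sub, sub_mul, two_smul]
      abel
    rw [this, h1, h2, h3, smul_zero, sub_zero, ← smul_add]
    norm_num
  have h2 : (2 : K) ≠ 0 := by
    have := CharP.cast_eq_zero_iff K p 2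
    rw [Nat.cast_ofNat] at this
    exact fun h => absurd (Nat.le_of_dvd two_pos (this.1 h)) (by omega)
  -- The two odd diagonal elements anticommute and square to the even ones. This is the source of
  -- the factor `la + lb`.
  have hDD' : D * D = G false a a + G false b b := by
    have := congrArg ((2 : K)⁻¹ • ·) hDD
    simpa only [inv_smul_smul₀ h2] using this
  set x := la - lb with x_def
  obtain ⟨w, w_def⟩ : ∃ w, w = D • v := ⟨_, rfl⟩
  have sc : ∀ (c : K) (r : Red χ (queer K n p)) (u : M), r • c • u = c • r • u := fun c r u =>
    smul_comm r c u
  have hv : h • v = x • v := by rw [h_def, sub_smul, ha, hb, x_def, sub_smul]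
  have hsum : (G false a a + G false b b) • v = (la + lb) • v := by rw [add_smul, ha, hb, add_smul]
  have hw : h • w = x • w := by rw [w_def, smul_smul, ← hDh, mul_smul, hv, sc]
  have ew : e • w = 0 := by
    have := smul_rel hDe v
    rw [he, smul_zero, add_smul, smul_assoc, hE, smul_zero, add_zero, mul_smul, ← w_def] at this
    exact this.symm
  have Ew : E • w = 0 := by
    have := smul_rel hDE v
    rw [hE, smul_zero, neg_smul, mul_smul, ← w_def, eq_comm, neg_eq_zero] at this
    exact this
  have hFv : h • F • v = (x - 2) • F • v := by
    rw [smul_rel hF, add_smul, mul_smul, hv, sc, smul_assoc, ← add_smul, sub_eq_add_neg]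
  have eFv : e • F • v = w := by
    rw [smul_rel eF, add_smul, mul_smul, he, smul_zero, zero_add, w_def]
  have hpow : ∀ (u : M) (c : K), h • u = c • u → ∀ k : ℕ, h • f ^ k • u = (c - 2 * k) • f ^ k • u := by
    intro u c hu k
    rw [smul_rel (mul_pow_of_eigen hf k), add_smul, mul_smul, hu, sc, smul_assoc, ← add_smul]
    congr 1
    ring
  have epow : ∀ (u : M) (c : K), h • u = c • u → ∀ k : ℕ, e • f ^ (k + 1) • u =
      f ^ (k + 1) • e • u + ((k + 1 : ℕ) * (c - k)) • f ^ k • u := by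
    intro u c hu k
    induction k with
    | zero =>
      rw [zero_add, pow_one, smul_rel ef, add_smul, mul_smul, hu]
      simp
    | succ k ih =>
      rw [pow_succ', mul_smul, smul_rel ef, add_smul, mul_smul, ih, hpow u c hu, smul_add, sc,
        smul_smul f, ← pow_succ', smul_smul f, ← pow_succ', add_assoc, ← add_smul]
      congr 2
      push_cast
      ring
  -- The coefficients are chosen so that `W 0 = x F v - f w` is killed by `e`, and `W k = f^k W 0`.
  set W : ℕ → M := fun k => x • f ^ k • F • v - f ^ (k + 1) • w with W_def
  have eW : ∀ k : ℕ, e • W (k + 1) = ((k + 1 : ℕ) * (x - 1 - (k + 1 : ℕ)) : K) • W k := by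
    intro k
    simp only [W_def]
    rw [smul_sub, sc, epow _ _ hFv, epow _ _ hw, eFv, ew, smul_zero, zero_add]
    push_cast
    generalize f ^ (k + 1) • w = A
    generalize f ^ k • F • v = B
    module
  -- Modulo `p`, the coefficient `(p - 1)((x - 2) - (p - 2))` equals `-x`; this is where `f^(p-1) F
  -- v` enters the string.
  have eTop : e • f ^ (p - 1) • F • v = -W (p - 2) := by
    have c1 : ((p - 2 : ℕ) : K) = -2 := by
      rw [Nat.cast_sub hp.le, CharP.cast_eq_zero, Nat.cast_ofNat, zero_sub]
    simp only [W_def]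
    rw [show p - 1 = p - 2 + 1 by omega, epow _ _ hFv, eFv, Nat.cast_succ, c1]
    generalize f ^ (p - 2 + 1) • w = A
    generalize f ^ (p - 2) • F • v = B
    module
  have eWpow : ∀ k : ℕ, e ^ k • W k =
      (∏ i ∈ Finset.range k, ((i + 1 : ℕ) * (x - 1 - (i + 1 : ℕ)) : K)) • W 0 := by
    intro k
    induction k with
    | zero => simp
    | succ k ih => rw [pow_succ, mul_smul, eW, sc, ih, smul_smul, Finset.prod_range_succ, mul_comm]
  have EW : E • W 0 = ((x - 1) * (la + lb)) • v := by
    simp only [W_def]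
    have e1 : E • F • v = (la + lb) • v := by
      rw [smul_rel EF, add_smul, neg_smul, mul_smul, hE, smul_zero, neg_zero, zero_add, hsum]
    have e2 : E • f • w = (la + lb) • v := by
      rw [smul_rel Ef, add_smul, mul_smul, Ew, smul_zero, zero_add, w_def, smul_rel hDD', hsum]
    rw [zero_add, pow_one, pow_zero, one_smul, smul_sub, sc, e1, e2]
    module
  rw [mul_smul, mul_smul, show p - 1 = p - 2 + 1 by omega, pow_succ e, mul_smul,
    show p - 2 + 1 = p - 1 by omega, eTop, smul_neg, smul_neg, eWpow, sc, EW, smul_smul, ← neg_smul]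
  congr 1
  have h3 : ∏ k ∈ Finset.Ico 1 p, (la - lb - (k : K)) =
      (∏ i ∈ Finset.range (p - 2), (x - 1 - ((i + 1 : ℕ) : K))) * (x - 1) := by
    rw [Finset.prod_Ico_eq_prod_range, show p - 1 = p - 2 + 1 by omega, Finset.prod_range_succ']
    congr 1
    · refine Finset.prod_congr rfl fun i _ => ?_
      push_cast
      ring
    · simp [x_def]
  rw [phi, h3, Finset.prod_mul_distrib, rankOneConst]
  ring

end RankOne

/-! ### Reflection along a chain of positive systems. -/

section Chain

variable {K : Type*} [Field K] {p n : ℕ} {χ : Module.Dual K (Mat K n)}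
  {σ : Equiv.Perm (Fin n)} {M : Type*} [AddCommGroup M] [Module K M]
  [Module (Red χ (queer K n p)) M] [IsScalarTower K (Red χ (queer K n p)) M]

/-- The lexicographic order on the roots. -/
def rootKey (r : Root n) : Fin n ×ₗ Fin n := toLex r.1

theorem rootKey_injective : Function.Injective (rootKey (n := n)) :=
  fun _ _ h => Subtype.ext (toLex.injective h)

theorem rootKey_lt {r s : Root n} :
    rootKey r < rootKey s ↔ r.1.1 < s.1.1 ∨ r.1.1 = s.1.1 ∧ r.1.2 < s.1.2 :=
  Prod.Lex.toLex_lt_toLex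

variable (n) in
theorem exists_sorted_roots : ∃ l : List (Root n), l.Pairwise (fun r s => rootKey r < rootKey s) ∧
    ∀ r, r ∈ l := by
  classical
  let l0 := (Finset.univ : Finset (Fin n ×ₗ Fin n)).sort (· ≤ ·)
  have h0 : l0.Pairwise (· < ·) := Finset.sortedLT_sort _ |>.pairwise
  let g : Fin n ×ₗ Fin n → Option (Root n) := fun x =>
    if h : (ofLex x).1 < (ofLex x).2 then some ⟨ofLex x, h⟩ else none
  have hg : ∀ x r, g x = some r → x = rootKey r := by
    intro x r h
    by_cases hx : (ofLex x).1 < (ofLex x).2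
    · rw [show g x = some ⟨ofLex x, hx⟩ from dif_pos hx, Option.some.injEq] at h
      rw [← h]; rfl
    · rw [show g x = none from dif_neg hx] at h
      exact absurd h (by simp)
  refine ⟨l0.filterMap g, ?_, fun r => ?_⟩
  · refine List.Pairwise.filterMap g (fun a b hab r hr s hs => ?_) h0
    rw [hg a r hr, hg b s hs] at hab
    exact hab
  · rw [List.mem_filterMap]
    exact ⟨rootKey r, by simp [l0], dif_pos r.2⟩

/-- The negative root vectors. -/
def negVec (p : ℕ) (χ : Module.Dual K (Mat K n)) (σ : Equiv.Perm (Fin n)) (j : Root n × Bool) :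
    Red χ (queer K n p) := un p χ σ j.2 j.1.1.2 j.1.1.1

/-- The positive root vectors. -/
def posVec (p : ℕ) (χ : Module.Dual K (Mat K n)) (σ : Equiv.Perm (Fin n)) (j : Root n × Bool) :
    Red χ (queer K n p) := un p χ σ j.2 j.1.1.1 j.1.1.2

/-- The order of the negative root vectors. -/
def negList (l : List (Root n)) : List (Root n × Bool) :=
  l.reverse.flatMap fun r => [(r, false), (r, true)]

/-- The order of the positive root vectors. -/
def posList (l : List (Root n)) : List (Root n × Bool) :=
  l.flatMap fun r => [(r, true), (r, false)]

theorem mem_negList {l : List (Root n)} {j : Root n × Bool} : j ∈ negList l ↔ j.1 ∈ l := by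
  obtain ⟨r, _ | _⟩ := j <;> simp [negList]

theorem mem_posList {l : List (Root n)} {j : Root n × Bool} : j ∈ posList l ↔ j.1 ∈ l := by
  obtain ⟨r, _ | _⟩ := j <;> simp [posList]

/-- The product of the negative root vectors with the largest exponents. -/
def negTop (p : ℕ) (χ : Module.Dual K (Mat K n)) (σ : Equiv.Perm (Fin n)) (l : List (Root n)) :
    Red χ (queer K n p) := topMono (negVec p χ σ) (fun j => bd p j.2) (negList l)

/-- The product of the positive root vectors with the largest exponents. -/
def posTop (p : ℕ) (χ : Module.Dual K (Mat K n)) (σ : Equiv.Perm (Fin n)) (l : List (Root n)) :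
    Red χ (queer K n p) := topMono (posVec p χ σ) (fun j => bd p j.2) (posList l)

theorem negTop_cons (r : Root n) (l : List (Root n)) : negTop p χ σ (r :: l) = negTop p χ σ l *
    (un p χ σ false r.1.2 r.1.1 ^ (p - 1) * un p χ σ true r.1.2 r.1.1) := by
  simp [negTop, negList, topMono, mono, negVec, bd]

theorem posTop_cons (r : Root n) (l : List (Root n)) : posTop p χ σ (r :: l) =
    (un p χ σ true r.1.1 r.1.2 * un p χ σ false r.1.1 r.1.2 ^ (p - 1)) * posTop p χ σ l := by
  simp [posTop, posList, topMono, mono, posVec, bd, mul_assoc]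

/-- The vector `v` has the weight `wt` and is killed by the root vectors of the roots in `l` and of
the negatives of the roots outside of `l`. -/
def IsChainVector (p : ℕ) (χ : Module.Dual K (Mat K n)) (σ : Equiv.Perm (Fin n))
    [Module (Red χ (queer K n p)) M] (wt : Fin n → K) (l : List (Root n)) (v : M) : Prop :=
  (∀ a, un p χ σ false a a • v = wt a • v) ∧ ∀ s r,
    (r ∈ l → un p χ σ s r.1.1 r.1.2 • v = 0) ∧ (r ∉ l → un p χ σ s r.1.2 r.1.1 • v = 0)

variable [CharP K p]

/-- A family of matrix units that kills a vector and is stable under the bracket with `x` kills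
the multiples by `x`. -/
theorem smul_eq_zero_of_stable (P : Fin n → Fin n → Prop) {a b : Fin n}
    (hP : ∀ c d, P c d → (d = b → P c a) ∧ (c = a → P b d)) (t : Bool) {v : M}
    (hv : ∀ s c d, P c d → un p χ σ s c d • v = 0) (s : Bool) {c d : Fin n} (h : P c d) :
    un p χ σ s c d • un p χ σ t b a • v = 0 := by
  rw [smul_smul, un_mul_un, sub_smul, add_smul, smul_assoc, mul_smul, hv s c d h, smul_zero,
    smul_zero, zero_add, smul_assoc]
  have h1 : (if d = b then un p χ σ (s ^^ t) c a else 0) • v = 0 := by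
    split_ifs with e
    · exact hv _ _ _ ((hP c d h).1 e)
    · exact zero_smul _ _
  have h2 : (if a = c then un p χ σ (s ^^ t) b d else 0) • v = 0 := by
    split_ifs with e
    · exact hv _ _ _ ((hP c d h).2 e.symm)
    · exact zero_smul _ _
  rw [h1, h2, smul_zero, sub_zero]

/-- The positive system formed by the roots of `r :: l` and the negatives of the other roots has `r`
as a simple root. Its root vectors other than those of `r` form a family stable under brackets with
those of `-r`, so they still kill `f^(p-1) F v`. The vectors of `-r` kill it because `f^p = 0` and
`F² = 0`, and its weight is unchanged. -/
theorem IsChainVector.step (hp : 2 < p) {wt : Fin n → K} {r : Root n} {l : List (Root n)} {v : M}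
    (hF : un p χ σ true r.1.2 r.1.1 * un p χ σ true r.1.2 r.1.1 = 0)
    (hf : un p χ σ false r.1.2 r.1.1 ^ p = 0)
    (hl : ∀ s, s ∈ l ↔ rootKey r < rootKey s) (h : IsChainVector p χ σ wt (r :: l) v) :
    IsChainVector p χ σ wt l
      ((un p χ σ false r.1.2 r.1.1 ^ (p - 1) * un p χ σ true r.1.2 r.1.1) • v) := by
  obtain ⟨hwt, hk⟩ := h
  refine ⟨fun c => ?_, ?_⟩
  · rw [smul_smul, diag_comm_pair hp, mul_smul, hwt, smul_comm]
  have hmem : ∀ s, s ∈ r :: l ↔ rootKey r ≤ rootKey s := by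
    intro s
    rw [List.mem_cons, hl, le_iff_lt_or_eq, or_comm, eq_comm, rootKey_injective.eq_iff]
  -- The positions of the root vectors that kill `v`, with `r` and `-r` left out. The lexicographic
  -- order gives the closure `hP`, which expresses that `r` is simple.
  let P : Fin n → Fin n → Prop := fun c d =>
    (∃ h : c < d, rootKey r < rootKey ⟨(c, d), h⟩) ∨ (∃ h : d < c, rootKey ⟨(d, c), h⟩ < rootKey r)
  obtain ⟨⟨a, b⟩, hab⟩ := r
  have hab' : a < b := hab
  have hP : ∀ c d, P c d → (d = b → P c a) ∧ (c = a → P b d) := by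
    rintro c d (⟨h, h'⟩ | ⟨h, h'⟩) <;> rw [rootKey_lt] at h' <;> refine ⟨?_, ?_⟩ <;> rintro rfl <;>
      simp only [P, rootKey_lt] at h' ⊢
    · exact Or.inr ⟨by omega, Or.inr ⟨trivial, h⟩⟩
    · exact Or.inl ⟨by omega, by omega⟩
    · omega
    · exact Or.inr ⟨by omega, by omega⟩
  have hv0 : ∀ s c d, P c d → un p χ σ s c d • v = 0 := by
    rintro s c d (⟨h, h'⟩ | ⟨h, h'⟩)
    · exact (hk s ⟨(c, d), h⟩).1 ((hmem _).2 h'.le)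
    · exact (hk s ⟨(d, c), h⟩).2 fun e => absurd ((hmem _).1 e) (not_le_of_gt h')
  have hv1 : ∀ k : ℕ, ∀ s c d, P c d →
      un p χ σ s c d • un p χ σ false b a ^ k • un p χ σ true b a • v = 0 := by
    intro k
    induction k with
    | zero =>
      intro s c d h
      rw [pow_zero, one_smul]
      exact smul_eq_zero_of_stable P hP true hv0 s h
    | succ k ih =>
      intro s c d h
      rw [pow_succ', mul_smul]
      exact smul_eq_zero_of_stable P hP false ih s h
  intro s r
  rw [mul_smul]
  refine ⟨fun h => hv1 _ s _ _ (Or.inl ⟨r.2, (hl r).1 h⟩), fun h => ?_⟩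
  rw [hl, not_lt, le_iff_lt_or_eq] at h
  rcases h with h | h
  · exact hv1 _ s _ _ (Or.inr ⟨r.2, h⟩)
  · obtain rfl := rootKey_injective h
    cases s
    · rw [smul_smul, ← pow_succ', Nat.sub_add_cancel (by omega), hf, zero_smul]
    · have hcomm : un p χ σ true b a * un p χ σ false b a ^ (p - 1) =
          un p χ σ false b a ^ (p - 1) * un p χ σ true b a :=
        Commute.pow_right (even_comm_odd (ne_of_gt hab)) (p - 1)
      rw [smul_smul, smul_smul, hcomm, mul_assoc, hF, mul_zero, zero_smul]

/-- The product of the top monomials acts on a highest weight vector by a scalar. -/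
theorem posTop_smul_negTop_smul (hp : 2 < p) {wt : Fin n → K}
    (hF : ∀ r : Root n, un p χ σ true r.1.2 r.1.1 * un p χ σ true r.1.2 r.1.1 = 0)
    (hf : ∀ r : Root n, un p χ σ false r.1.2 r.1.1 ^ p = 0) {l : List (Root n)}
    (hs : l.Pairwise fun r s => rootKey r < rootKey s)
    (hl : ∀ r ∈ l, ∀ s, rootKey r < rootKey s → s ∈ l) {v : M} (hv : IsChainVector p χ σ wt l v) :
    posTop p χ σ l • negTop p χ σ l • v =
      (l.map fun r => rankOneConst K p * phi p (wt r.1.1) (wt r.1.2)).prod • v := by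
  induction l generalizing v with
  | nil => simp [posTop, negTop, topMono, posList, negList]
  | cons r l ih =>
    obtain ⟨h1, h2⟩ := List.pairwise_cons.1 hs
    have hl' : ∀ s, s ∈ l ↔ rootKey r < rootKey s := by
      refine fun s => ⟨h1 s, fun h => ?_⟩
      rcases List.mem_cons.1 (hl r (by simp) s h) with rfl | h'
      · exact absurd h (lt_irrefl _)
      · exact h'
    have hstep := hv.step hp (hF r) (hf r) hl'
    have := ih h2 (fun s hs t ht => (hl' t).2 (((hl' s).1 hs).trans ht)) hstep
    -- The factors for the smallest root `r` are the innermost on the negative side and the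
    -- outermost on the positive side. The induction hypothesis at `f^(p-1) F v` disposes of
    -- everything in between, and `rankOne` finishes.
    rw [negTop_cons, posTop_cons, mul_smul, mul_smul, mul_smul (negTop p χ σ l)]
    rw [this, smul_comm _ (List.prod _), smul_comm _ (List.prod _), ← mul_smul,
      rankOne hp (ne_of_lt r.2) (hv.1 _) (hv.1 _) ((hv.2 _ r).1 (by simp)) ((hv.2 _ r).1 (by simp)),
      smul_smul, List.map_cons, List.prod_cons, mul_comm]

theorem even_diag_mul_negTop (hp : 2 < p) (c : Fin n) (l : List (Root n)) :
    un p χ σ false c c * negTop p χ σ l = negTop p χ σ l * un p χ σ false c c := by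
  induction l with
  | nil => simp [negTop, topMono, negList]
  | cons r l ih => rw [negTop_cons, ← mul_assoc, ih, mul_assoc, diag_comm_pair hp, ← mul_assoc]

theorem odd_diag_mul_negTop (hp : 2 < p) (c : Fin n)
    (hF : ∀ r : Root n, un p χ σ true r.1.2 r.1.1 * un p χ σ true r.1.2 r.1.1 = 0)
    (hf : ∀ r : Root n, un p χ σ false r.1.2 r.1.1 ^ p = 0) (l : List (Root n)) :
    ∃ s : K, un p χ σ true c c * negTop p χ σ l = s • (negTop p χ σ l * un p χ σ true c c) := by
  induction l with
  | nil => exact ⟨1, by simp [negTop, topMono, negList]⟩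
  | cons r l ih =>
    obtain ⟨s, hs⟩ := ih
    refine ⟨-s, ?_⟩
    rw [negTop_cons, ← mul_assoc, hs, smul_mul_assoc, mul_assoc,
      odd_diag_comm_pair hp (ne_of_gt r.2) c (hF r) (hf r), mul_neg, smul_neg, neg_smul, ← mul_assoc]

/-- The lexicographic order is convex: a sum of two roots `(a, b)` and `(b, d)` is `(a, d)`, which
lies strictly between them. The second key component only separates the even and odd vectors of one
root, which commute. -/
theorem conv_negList {l : List (Root n)} (hs : l.Pairwise fun r s => rootKey r < rootKey s)
    (hl : ∀ r, r ∈ l) : Conv (negVec p χ σ) K (negList l) := by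
  let key : Root n × Bool → (Fin n ×ₗ Fin n) ×ₗ Bool := fun j => toLex (rootKey j.1, !j.2)
  refine conv_of_pairwise key _ ?_ ?_
  · rw [negList, List.pairwise_flatMap]
    refine ⟨fun r _ => ?_, (List.pairwise_reverse.2 hs).imp fun {r s} h => ?_⟩
    · simp [key, Prod.Lex.toLex_lt_toLex]
    · simp [key, Prod.Lex.toLex_lt_toLex, h]
  · rintro ⟨⟨⟨a, b⟩, hab⟩, s⟩ - ⟨⟨⟨c, d⟩, hcd⟩, t⟩ - h
    refine ⟨sg K s t, sg_ne_zero K s t, ?_⟩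
    have hab' : a < b := hab
    have hcd' : c < d := hcd
    have h' : a < c ∨ a = c ∧ b ≤ d := by
      rcases Prod.Lex.toLex_lt_toLex.1 h with h | h
      · exact (rootKey_lt.1 h).imp id fun h => ⟨h.1, h.2.le⟩
      · have := congrArg Subtype.val (rootKey_injective h.1)
        simp only [Prod.mk.injEq] at this
        exact Or.inr ⟨this.1, this.2.le⟩
    simp only [negVec]
    rw [un_mul_un, add_sub_assoc, add_sub_cancel_left, if_neg (by omega : ¬ a = d), zero_sub]
    refine neg_mem (Submodule.smul_mem _ _ ?_)
    split_ifs with e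
    · subst e
      refine Submodule.subset_span ⟨(⟨(a, d), hab'.trans hcd'⟩, s ^^ t), ⟨mem_negList.2 (hl _), ?_, ?_⟩, rfl⟩
      · exact Prod.Lex.toLex_lt_toLex.2 (Or.inl (rootKey_lt.2 (Or.inr ⟨rfl, hcd⟩)))
      · exact Prod.Lex.toLex_lt_toLex.2 (Or.inl (rootKey_lt.2 (Or.inl hab)))
    · exact zero_mem _

theorem nodup_negList {l : List (Root n)} (hs : l.Pairwise fun r s => rootKey r < rootKey s) :
    (negList l).Nodup := by
  rw [negList, List.nodup_flatMap]
  refine ⟨by simp, ?_⟩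
  refine (List.pairwise_reverse.2 hs).imp fun {r s} h => ?_
  have : r ≠ s := fun e => absurd h (by rw [e]; exact lt_irrefl _)
  simp [this.symm]

theorem nodup_posList {l : List (Root n)} (hs : l.Pairwise fun r s => rootKey r < rootKey s) :
    (posList l).Nodup := by
  rw [posList, List.nodup_flatMap]
  refine ⟨by simp, ?_⟩
  refine hs.imp fun {r s} h => ?_
  have : r ≠ s := fun e => absurd h (by rw [e]; exact lt_irrefl _)
  simp [this.symm]

end Chain

/-! ### Independence of the condition from the positive system. -/

section Phi

variable {K : Type*} [Field K] {p : ℕ} [CharP K p]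

/-- Interchanging the arguments matches the factor for `k` with minus the factor for `p - k`. -/
theorem phi_ne_zero_symm {x y : K} (h : phi p x y ≠ 0) : phi p y x ≠ 0 := by
  rw [phi, mul_ne_zero_iff, Finset.prod_ne_zero_iff] at h ⊢
  refine ⟨by rw [add_comm]; exact h.1, fun k hk e => ?_⟩
  rw [Finset.mem_Ico] at hk
  refine h.2 (p - k) (Finset.mem_Ico.2 (by omega)) ?_
  rw [Nat.cast_sub hk.2.le, CharP.cast_eq_zero]
  linear_combination -e

theorem Phi_ne_zero_iff {n : ℕ} (σ : Equiv.Perm (Fin n)) (wt : Module.Dual K (diagSub K n)) :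
    Phi p wt ≠ 0 ↔ ∀ r : Root n, phi p (coord wt (σ.symm r.1.1)) (coord wt (σ.symm r.1.2)) ≠ 0 := by
  have h1 : Phi p wt ≠ 0 ↔ ∀ i j : Fin n, i ≠ j → phi p (coord wt i) (coord wt j) ≠ 0 := by
    rw [Phi, Finset.prod_ne_zero_iff]
    simp only [Finset.prod_ne_zero_iff, Finset.mem_Ioi, Finset.mem_univ, true_imp_iff]
    refine ⟨fun h i j hij => ?_, fun h i j hij => h i j hij.ne⟩
    rcases lt_or_gt_of_ne hij with h' | h'
    · exact h i j h'
    · exact phi_ne_zero_symm (h j i h')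
  rw [h1]
  refine ⟨fun h r => h _ _ fun e => absurd (σ.symm.injective e) r.2.ne, fun h i j hij => ?_⟩
  rcases lt_or_gt_of_ne (σ.injective.ne hij) with h' | h'
  · simpa using h ⟨(σ i, σ j), h'⟩
  · simpa using phi_ne_zero_symm (h ⟨(σ j, σ i), h'⟩)

end Phi

/-! ### The criterion for the baby Verma module. -/

section Simplicity

variable {K : Type*} [Field K] {p n : ℕ} {σ : Equiv.Perm (Fin n)} {χ : Module.Dual K (Mat K n)}
  {hχ : ∀ x ∈ posSub K σ, χ x = 0} {wt : Module.Dual K (diagSub K n)} {hwt : wt ∈ weights p χ}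
  {H : Submodule K (diagSub K n)} {hH : IsIsotropic p wt H}

theorem inflate_ι₀ (x : borelSub K σ) : inflate p σ χ hχ (ι₀ χ (borel K p σ) x) =
    ι₀ χ (cartan K n p) (diagPart (x : Mat K n)) :=
  lift_ι₀ χ (borel K p σ) _ _ _ _ _ _ x

theorem inflate_ι₁ (x : borelSub K σ) : inflate p σ χ hχ (ι₁ χ (borel K p σ) x) =
    ι₁ χ (cartan K n p) (diagPart (x : Mat K n)) :=
  lift_ι₁ χ (borel K p σ) _ _ _ _ _ _ x

theorem redParity_inflate (r : Red χ (borel K p σ)) :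
    redParity χ _ (inflate p σ χ hχ r) = inflate p σ χ hχ (redParity χ _ r) := by
  have : (redParity χ _).comp (inflate p σ χ hχ) = (inflate p σ χ hχ).comp (redParity χ _) := by
    refine Red.algHom_ext χ (fun x => ?_) (fun x => ?_)
    · have h1 := inflate_ι₀ (p := p) (hχ := hχ) x
      rw [AlgHom.comp_apply, AlgHom.comp_apply, redParity_ι₀, h1]
      exact redParity_ι₀ χ (cartan K n p) _
    · have h1 := inflate_ι₁ (p := p) (hχ := hχ) x
      rw [AlgHom.comp_apply, AlgHom.comp_apply, redParity_ι₁, map_neg, h1]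
      exact redParity_ι₁ χ (cartan K n p) _
  exact DFunLike.congr_fun this r

/-- The parity operator of the baby Verma module. -/
def vermaParity : BabyVerma p σ χ hχ wt hwt H hH →ₗ[K] BabyVerma p σ χ hχ wt hwt H hH :=
  Ind.parity (redParity χ (queer K n p)) (redParity χ (borel K p σ)) (highParity χ wt hwt H hH)
    (redParity_incl χ _ _) (fun b v => by
      refine (highParity_smul χ wt hwt H hH _ v).trans ?_
      exact congrArg (· • highParity χ wt hwt H hH v) (redParity_inflate b))

theorem isParity_babyVermaGrading :
    IsParity (vermaParity (hwt := hwt) (hH := hH)) (babyVermaGrading p σ χ hχ wt hwt H hH) :=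
  IsParity.ind _ _ (isParity_grading χ (queer K n p)) (isParity_highWeightGrading χ wt hwt H hH) _ _

theorem vermaParity_smul (r : Red χ (queer K n p)) (z : BabyVerma p σ χ hχ wt hwt H hH) :
    vermaParity (r • z) = redParity χ _ r • vermaParity z :=
  Ind.parity_smul _ _ _ _ _ r z

variable (p σ χ hχ wt hwt H hH) in
/-- The inclusion of `V_χ(wt)` into the baby Verma module. -/
def toVerma : HighWeight p χ wt hwt H hH →ₗ[K] BabyVerma p σ χ hχ wt hwt H hH :=
  Ind.mk (inclBorel p σ χ) (highWeightRep p σ χ hχ wt hwt H hH) 1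

theorem mk_eq_smul_toVerma (r : Red χ (queer K n p)) (v : HighWeight p χ wt hwt H hH) :
    Ind.mk (inclBorel p σ χ) (highWeightRep p σ χ hχ wt hwt H hH) r v =
      r • toVerma p σ χ hχ wt hwt H hH v := by
  rw [toVerma, Ind.smul_mk, mul_one]

theorem vermaParity_toVerma (v : HighWeight p χ wt hwt H hH) :
    vermaParity (toVerma p σ χ hχ wt hwt H hH v) =
      toVerma p σ χ hχ wt hwt H hH (highParity χ wt hwt H hH v) := by
  refine (Ind.parity_mk _ _ _ _ _ _ _).trans ?_
  rw [map_one]; rfl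

theorem inclBorel_smul_toVerma (r : Red χ (borel K p σ)) (v : HighWeight p χ wt hwt H hH) :
    inclBorel p σ χ r • toVerma p σ χ hχ wt hwt H hH v =
      toVerma p σ χ hχ wt hwt H hH (inflate p σ χ hχ r • v) := by
  have := Ind.mk_mul (inclBorel p σ χ) (highWeightRep p σ χ hχ wt hwt H hH) 1 r v
  rw [toVerma, Ind.smul_mk, mul_one]
  rw [one_mul] at this
  exact this

theorem elt_smul_toVerma {x : Mat K n} (hx : x ∈ borelSub K σ) (s : Bool)
    (v : HighWeight p χ wt hwt H hH) : elt p χ s x • toVerma p σ χ hχ wt hwt H hH v =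
      toVerma p σ χ hχ wt hwt H hH ((if s then ι₁ χ (cartan K n p) (diagPart x)
        else ι₀ χ (cartan K n p) (diagPart x)) • v) := by
  cases s
  · have h1 : elt p χ false x = inclBorel p σ χ (ι₀ χ (borel K p σ) ⟨x, hx⟩) :=
      (incl_ι₀ χ (s := borel K p σ) (t := queer K n p) le_top le_top ⟨x, hx⟩).symm
    have h2 := inflate_ι₀ (p := p) (hχ := hχ) ⟨x, hx⟩
    rw [h1, inclBorel_smul_toVerma]
    exact congrArg (fun r => toVerma p σ χ hχ wt hwt H hH (r • v)) h2
  · have h1 : elt p χ true x = inclBorel p σ χ (ι₁ χ (borel K p σ) ⟨x, hx⟩) :=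
      (incl_ι₁ χ (s := borel K p σ) (t := queer K n p) le_top le_top ⟨x, hx⟩).symm
    have h2 := inflate_ι₁ (p := p) (hχ := hχ) ⟨x, hx⟩
    rw [h1, inclBorel_smul_toVerma]
    exact congrArg (fun r => toVerma p σ χ hχ wt hwt H hH (r • v)) h2

theorem un_smul_toVerma_of_lt (s : Bool) {a b : Fin n} (h : a < b)
    (v : HighWeight p χ wt hwt H hH) :
    un p χ σ s a b • toVerma p σ χ hχ wt hwt H hH v = 0 := by
  have hd : diagPart (Matrix.single (σ.symm a) (σ.symm b) (1 : K)) = 0 := by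
    ext i j
    by_cases hij : i = j
    · subst hij
      simp only [diagPart, LinearMap.coe_mk, AddHom.coe_mk, Matrix.diagonal_apply_eq, Matrix.diag_apply]
      refine Matrix.single_apply_of_ne _ _ _ _ _ ?_
      rintro ⟨h1, h2⟩
      exact h.ne (σ.symm.injective (h1.trans h2.symm))
    · exact Matrix.diagonal_apply_ne _ hij
  rw [un_eq, elt_smul_toVerma (single_mem_borelSub K σ h.le), hd]
  have : (if s then ι₁ χ (cartan K n p) (0 : diagSub K n) else ι₀ χ (cartan K n p) (0 : diagSub K n)) = 0 := by
    cases s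
    · exact map_zero (ι₀ χ (cartan K n p))
    · exact map_zero (ι₁ χ (cartan K n p))
  exact (congrArg (fun r => toVerma p σ χ hχ wt hwt H hH (r • v)) this).trans (by
    rw [zero_smul, map_zero])

theorem un_false_smul_toVerma (a : Fin n) (v : HighWeight p χ wt hwt H hH) :
    un p χ σ false a a • toVerma p σ χ hχ wt hwt H hH v =
      coord wt (σ.symm a) • toVerma p σ χ hχ wt hwt H hH v := by
  rw [un_eq, elt_smul_toVerma (single_mem_borelSub K σ le_rfl), ← map_smul]
  exact congrArg _ (ι₀_smul_highWeight χ wt hwt H hH _ v)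

theorem un_true_smul_toVerma (a : Fin n) (v : HighWeight p χ wt hwt H hH) :
    ∃ w, un p χ σ true a a • toVerma p σ χ hχ wt hwt H hH v = toVerma p σ χ hχ wt hwt H hH w := by
  rw [un_eq, elt_smul_toVerma (single_mem_borelSub K σ le_rfl)]
  exact ⟨_, rfl⟩

theorem toVerma_ι₁_smul (a : diagSub K n) (v : HighWeight p χ wt hwt H hH) :
    toVerma p σ χ hχ wt hwt H hH (ι₁ χ (cartan K n p) a • v) =
      elt p χ true (a : Mat K n) • toVerma p σ χ hχ wt hwt H hH v := by
  have hd : diagPart (a : Mat K n) = a := by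
    ext i j
    by_cases hij : i = j
    · subst hij; simp [diagPart]
    · rw [a.2 i j hij]; exact Matrix.diagonal_apply_ne _ hij
  rw [elt_smul_toVerma (diag_le_borel σ a.2), hd]
  rfl

theorem isChainVector_toVerma {l : List (Root n)} (hl : ∀ r, r ∈ l)
    (v : HighWeight p χ wt hwt H hH) :
    IsChainVector p χ σ (fun a => coord wt (σ.symm a)) l (toVerma p σ χ hχ wt hwt H hH v) :=
  ⟨fun a => un_false_smul_toVerma a v, fun s r =>
    ⟨fun _ => un_smul_toVerma_of_lt s r.2 v, fun h => absurd (hl r) h⟩⟩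

variable [Fact p.Prime] [CharP K p]

variable (χ wt hwt H hH) in
theorem finite_highWeight (hp : 2 < p) : Module.Finite K (HighWeight p χ wt hwt H hH) := by
  have h := (cartanFamily K p).span_mono χ hp (Finset.univ : Finset (Fin n × Bool)).toList
    (Finset.nodup_toList _) (fun j => by simp)
  have : Module.Finite K (Red χ (cartan K n p)) :=
    ⟨Submodule.fg_def.2 ⟨_, Set.finite_range _, h⟩⟩
  refine Module.Finite.of_surjective ((LinearMap.toSpanSingleton (Red χ (cartan K n p)) _
    (highVec χ wt hwt H hH)).restrictScalars K) fun v => ?_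
  obtain ⟨r, rfl⟩ := exists_smul_highVec χ wt hwt H hH v
  exact ⟨r, rfl⟩

theorem two_ne_zero_of_charP (hp : 2 < p) : (2 : K) ≠ 0 := by
  have := CharP.cast_eq_zero_iff K p 2
  rw [Nat.cast_ofNat] at this
  exact fun h => absurd (Nat.le_of_dvd two_pos (this.1 h)) (by omega)

theorem negVec_odd_mul_self (hp : 2 < p) (r : Root n) :
    un p χ σ true r.1.2 r.1.1 * un p χ σ true r.1.2 r.1.1 = 0 :=
  un_true_mul_self p χ σ (two_ne_zero_of_charP hp) (ne_of_gt r.2)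

theorem negVec_even_pow (hp : 2 < p) (hneg : ∀ x ∈ negSub K σ, χ x = 0) (r : Root n) :
    un p χ σ false r.1.2 r.1.1 ^ p = 0 := by
  refine un_false_pow p χ σ hp (ne_of_gt r.2) (hneg _ fun i j hij => ?_)
  refine Matrix.single_apply_of_ne _ _ _ _ _ ?_
  rintro ⟨rfl, rfl⟩
  rw [Equiv.apply_symm_apply, Equiv.apply_symm_apply] at hij
  exact absurd r.2 (not_lt_of_ge hij)

theorem negVec_pow (hp : 2 < p) (hneg : ∀ x ∈ negSub K σ, χ x = 0) (j : Root n × Bool) :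
    negVec p χ σ j ^ bd p j.2 = 0 := by
  obtain ⟨r, _ | _⟩ := j
  · exact negVec_even_pow hp hneg r
  · exact (pow_two _).trans (negVec_odd_mul_self hp r)

theorem posTop_smul_negTop_smul_toVerma (hp : 2 < p) (hneg : ∀ x ∈ negSub K σ, χ x = 0)
    {l : List (Root n)} (hs : l.Pairwise fun r s => rootKey r < rootKey s) (hl : ∀ r, r ∈ l)
    (v : HighWeight p χ wt hwt H hH) :
    posTop p χ σ l • negTop p χ σ l • toVerma p σ χ hχ wt hwt H hH v =
      (l.map fun r => rankOneConst K p *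
        phi p (coord wt (σ.symm r.1.1)) (coord wt (σ.symm r.1.2))).prod •
      toVerma p σ χ hχ wt hwt H hH v :=
  posTop_smul_negTop_smul (wt := fun a => coord wt (σ.symm a)) hp (negVec_odd_mul_self hp) (negVec_even_pow hp hneg) hs
    (fun _ _ s _ => hl s) (isChainVector_toVerma hl v)

/-- A nonzero `N` contains `y_top v` for some nonzero `v` in `V_χ(wt)`; since `e_top y_top` acts by
a nonzero scalar, it contains `v`. Irreducibility of `V_χ(wt)` then puts all of it in `N`, and it
generates the module. -/
theorem eq_bot_or_eq_top_of_Phi_ne_zero [IsAlgClosed K] (hp : 2 < p)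
    (hneg : ∀ x ∈ negSub K σ, χ x = 0) (hmax : Maximal (IsIsotropic p wt) H)
    (hPhi : Phi p wt ≠ 0) (N : Submodule (Red χ (queer K n p)) (BabyVerma p σ χ hχ wt hwt H hH))
    (hN : ∀ x ∈ N, vermaParity x ∈ N) : N = ⊥ ∨ N = ⊤ := by
  obtain ⟨l, hs, hl⟩ := exists_sorted_roots n
  refine or_iff_not_imp_left.2 fun h0 => ?_
  obtain ⟨x, hx, hx0⟩ := Submodule.exists_mem_ne_zero_of_ne_bot h0
  have hbij := expand_negMono_bijective χ σ hp (nodup_negList hs) (fun j => mem_negList.2 (hl j.1))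
    (highWeightRep p σ χ hχ wt hwt H hH)
  have hxV : x ∈ monoSpan (negVec p χ σ) (fun j => bd p j.2)
      (LinearMap.range (toVerma p σ χ hχ wt hwt H hH)) (negList l) := by
    obtain ⟨v, rfl⟩ := hbij.2 x
    rw [Ind.expand_apply]
    refine sum_mem fun a _ => ?_
    rw [mk_eq_smul_toVerma]
    exact mono_smul_mem_monoSpan (g := negVec p χ σ) (fun j => bd p j.2) _
      (LinearMap.mem_range_self _ (v a)) (negList l) (fun j => a j) fun j => (a j).2
  obtain ⟨_, ⟨v, rfl⟩, hv0, hv⟩ := exists_topMono_smul_mem (fun j => bd p j.2)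
    (fun j => two_le_bd hp _) (negVec_pow hp hneg) N _ (negList l) []
    (conv_negList hs hl) hxV hx0 (by simpa [topMono] using hx)
  have hc : (l.map fun r => rankOneConst K p *
      phi p (coord wt (σ.symm r.1.1)) (coord wt (σ.symm r.1.2))).prod ≠ 0 := by
    refine List.prod_ne_zero fun h => ?_
    obtain ⟨r, -, hr⟩ := List.mem_map.1 h
    exact mul_ne_zero (rankOneConst_ne_zero hp) ((Phi_ne_zero_iff σ wt).1 hPhi r) hr
  have hvN : toVerma p σ χ hχ wt hwt H hH v ∈ N.restrictScalars K := by
    have h1 : _ ∈ N.restrictScalars K := N.smul_mem (posTop p χ σ l) hv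
    have h2 := posTop_smul_negTop_smul_toVerma (hχ := hχ) hp hneg hs hl v
    rw [List.nil_append] at h1
    rw [negTop] at h2
    rw [h2] at h1
    exact (Submodule.smul_mem_iff _ hc).1 h1
  -- The preimage of `N` in `V_χ(wt)` is stable under the odd Cartan elements and under parity, and
  -- it contains `v ≠ 0`.
  have htop : (N.restrictScalars K).comap (toVerma p σ χ hχ wt hwt H hH) = ⊤ := by
    refine (eq_bot_or_eq_top_of_stable χ wt hwt H hH (two_ne_zero_of_charP hp) hmax _
      (fun a w hw => ?_) (fun w hw => ?_)).resolve_left fun h => ?_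
    · rw [Submodule.mem_comap, toVerma_ι₁_smul]
      exact N.smul_mem _ hw
    · rw [Submodule.mem_comap, ← vermaParity_toVerma]
      exact hN _ hw
    · have : v ∈ (N.restrictScalars K).comap (toVerma p σ χ hχ wt hwt H hH) := hvN
      rw [h, Submodule.mem_bot] at this
      exact hv0 (by rw [this, map_zero])
  rw [← Submodule.restrictScalars_eq_top_iff K, eq_top_iff, ← Ind.span_mk, Submodule.span_le]
  rintro _ ⟨r, w, rfl⟩
  rw [mk_eq_smul_toVerma]
  have : w ∈ (N.restrictScalars K).comap (toVerma p σ χ hχ wt hwt H hH) := by rw [htop]; trivial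
  exact N.smul_mem r this

theorem mono_smul_mem {R J X : Type*} [Ring R] [Algebra K R] [AddCommGroup X] [Module K X]
    [Module R X] {g : J → R} (Y : Submodule K X) (l : List J) (h : ∀ j ∈ l, ∀ y ∈ Y, g j • y ∈ Y)
    (a : J → ℕ) {y : X} (hy : y ∈ Y) : mono g l a • y ∈ Y := by
  induction l with
  | nil => rwa [mono_nil, one_smul]
  | cons j l ih =>
    rw [mono_cons, mul_smul]
    have h1 := ih fun i hi => h i (List.mem_cons_of_mem j hi)
    generalize a j = k
    induction k with
    | zero => rwa [pow_zero, one_smul]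
    | succ k ih => rw [pow_succ', mul_smul]; exact h j (by simp) _ ih

theorem exists_redParity_mono (l : List (Root n × Bool)) (a : Root n × Bool → ℕ) :
    ∃ s : K, redParity χ (queer K n p) (mono (negVec p χ σ) l a) = s • mono (negVec p χ σ) l a := by
  induction l with
  | nil => exact ⟨1, by rw [mono_nil, map_one, one_smul]⟩
  | cons j l ih =>
    obtain ⟨s, hs⟩ := ih
    refine ⟨(if j.2 then -1 else 1) ^ a j * s, ?_⟩
    rw [mono_cons, map_mul, map_pow, hs, negVec, redParity_un, smul_pow, smul_mul_smul_comm]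

/-- The map `v ↦ y v` from `V_χ(wt)` to the baby Verma module, where `y` is the product of the
negative root vectors with the largest exponents. -/
def bottom (p : ℕ) (σ : Equiv.Perm (Fin n)) (χ : Module.Dual K (Mat K n))
    (hχ : ∀ x ∈ posSub K σ, χ x = 0) (wt : Module.Dual K (diagSub K n)) (hwt : wt ∈ weights p χ)
    (H : Submodule K (diagSub K n)) (hH : IsIsotropic p wt H) (l : List (Root n)) :
    HighWeight p χ wt hwt H hH →ₗ[K] BabyVerma p σ χ hχ wt hwt H hH :=
  Algebra.lsmul K K (BabyVerma p σ χ hχ wt hwt H hH) (negTop p χ σ l) ∘ₗ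
    toVerma p σ χ hχ wt hwt H hH

theorem bottom_apply (l : List (Root n)) (v : HighWeight p χ wt hwt H hH) :
    bottom p σ χ hχ wt hwt H hH l v = negTop p χ σ l • toVerma p σ χ hχ wt hwt H hH v := rfl

theorem negVec_smul_bottom (hp : 2 < p) (hneg : ∀ x ∈ negSub K σ, χ x = 0)
    {l : List (Root n)} (hs : l.Pairwise fun r s => rootKey r < rootKey s) (hl : ∀ r, r ∈ l)
    (j : Root n × Bool) (v : HighWeight p χ wt hwt H hH) :
    negVec p χ σ j • bottom p σ χ hχ wt hwt H hH l v = 0 := by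
  rw [bottom_apply, smul_smul, negTop, mul_topMono_eq_zero (K := K) (fun j => bd p j.2)
    (fun j => two_le_bd hp _) (negVec_pow hp hneg) (conv_negList hs hl) j (mem_negList.2 (hl _)),
    zero_smul]

theorem un_diag_smul_bottom (hp : 2 < p) (hneg : ∀ x ∈ negSub K σ, χ x = 0)
    (l : List (Root n)) (s : Bool) (c : Fin n) (v : HighWeight p χ wt hwt H hH) :
    un p χ σ s c c • bottom p σ χ hχ wt hwt H hH l v ∈
      LinearMap.range (bottom p σ χ hχ wt hwt H hH l) := by
  cases s
  · refine ⟨coord wt (σ.symm c) • v, ?_⟩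
    rw [bottom_apply, bottom_apply, smul_smul, even_diag_mul_negTop hp, mul_smul, un_false_smul_toVerma,
      map_smul]
  · obtain ⟨s, hs⟩ := odd_diag_mul_negTop (K := K) hp c (negVec_odd_mul_self hp)
      (negVec_even_pow hp hneg) l
    obtain ⟨w, hw⟩ := un_true_smul_toVerma (hχ := hχ) c v
    refine ⟨s • w, ?_⟩
    rw [bottom_apply, bottom_apply, smul_smul, hs, smul_assoc, mul_smul, hw, map_smul, smul_comm]

/-- The map `(v a) ↦ ∑ eᵃ y v a`, where the `eᵃ` are the restricted monomials in the positive root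
vectors. -/
def posExpand (p : ℕ) (σ : Equiv.Perm (Fin n)) (χ : Module.Dual K (Mat K n))
    (hχ : ∀ x ∈ posSub K σ, χ x = 0) (wt : Module.Dual K (diagSub K n)) (hwt : wt ∈ weights p χ)
    (H : Submodule K (diagSub K n)) (hH : IsIsotropic p wt H) (l : List (Root n)) :
    (Expo p n → HighWeight p χ wt hwt H hH) →ₗ[K] BabyVerma p σ χ hχ wt hwt H hH :=
  ∑ a : Expo p n, Algebra.lsmul K K (BabyVerma p σ χ hχ wt hwt H hH)
    (mono (posVec p χ σ) (posList l) fun j => a j) ∘ₗ bottom p σ χ hχ wt hwt H hH l ∘ₗ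
      LinearMap.proj a

theorem posExpand_single [DecidableEq (Expo p n)] (l : List (Root n)) (a : Expo p n)
    (v : HighWeight p χ wt hwt H hH) : posExpand p σ χ hχ wt hwt H hH l (Pi.single a v) =
      (mono (posVec p χ σ) (posList l) fun j => a j) • bottom p σ χ hχ wt hwt H hH l v := by
  rw [posExpand, LinearMap.sum_apply, Finset.sum_eq_single a]
  · simp
  · intro b _ hb; simp [hb]
  · simp

/-- In PBW monomials ordered as `n⁺`, `h`, `n⁻`, the negative factors kill the bottom layer and the
Cartan factors preserve it, so only the positive monomials remain. -/
theorem smul_bottom_mem_range (hp : 2 < p) (hneg : ∀ x ∈ negSub K σ, χ x = 0)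
    {l : List (Root n)} (hs : l.Pairwise fun r s => rootKey r < rootKey s) (hl : ∀ r, r ∈ l)
    (r : Red χ (queer K n p)) (v : HighWeight p χ wt hwt H hH) :
    r • bottom p σ χ hχ wt hwt H hH l v ∈ LinearMap.range (posExpand p σ χ hχ wt hwt H hH l) := by
  classical
  let lh : List (Fin n × Bool) := (Finset.univ : Finset (Fin n × Bool)).toList
  let l3 : List (Root n × Bool ⊕ Fin n × Bool ⊕ Root n × Bool) := (posList l).map Sum.inl ++
    (lh.map Sum.inl ++ (negList l).map Sum.inr).map Sum.inr
  have hl3 : l3.Nodup := by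
    rw [List.nodup_append]
    refine ⟨(nodup_posList hs).map Sum.inl_injective, List.Nodup.map Sum.inr_injective ?_, by simp⟩
    rw [List.nodup_append]
    exact ⟨(Finset.nodup_toList _).map Sum.inl_injective,
      (nodup_negList hs).map Sum.inr_injective, by simp⟩
  have hl3' : ∀ j, j ∈ l3 := by
    rintro (j | j | j)
    · simp [l3, mem_posList, hl]
    · simp [l3, lh]
    · simp [l3, mem_negList, hl]
  have hr : r ∈ Submodule.span K (Set.range fun a : (j : _) → Fin (bd p ((triangularFamily K p σ).q j).1) =>
      mono ((triangularFamily K p σ).gen χ) l3 fun j => a j) := by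
    rw [(triangularFamily K p σ).span_mono χ hp l3 hl3 hl3']; trivial
  induction hr using Submodule.span_induction with
  | mem r hr =>
    obtain ⟨a, rfl⟩ := hr
    have h1 : mono ((triangularFamily K p σ).gen χ ∘ Sum.inr)
        (lh.map Sum.inl ++ (negList l).map Sum.inr) (fun j => (a (Sum.inr j) : ℕ)) •
        bottom p σ χ hχ wt hwt H hH l v ∈ LinearMap.range (bottom p σ χ hχ wt hwt H hH l) := by
      refine mono_smul_mem _ _ ?_ _ ⟨v, rfl⟩
      rintro (j | j) - _ ⟨w, rfl⟩
      · have := un_diag_smul_bottom (hχ := hχ) hp hneg l j.2 (σ j.1) w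
        have e : un p χ σ j.2 (σ j.1) (σ j.1) = (triangularFamily K p σ).gen χ (Sum.inr (Sum.inl j)) := by
          obtain ⟨i, _ | _⟩ := j <;> simp only [un, Equiv.symm_apply_apply] <;> rfl
        rw [e] at this
        exact this
      · have h0 : (triangularFamily K p σ).gen χ (Sum.inr (Sum.inr j)) •
            bottom p σ χ hχ wt hwt H hH l w = 0 := negVec_smul_bottom hp hneg hs hl j w
        exact ⟨0, (map_zero _).trans h0.symm⟩
    obtain ⟨w, hw⟩ := h1
    change mono _ (_ ++ _) _ • _ ∈ _
    rw [mono_append, mono_map, mono_map, mul_smul]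
    let b : Expo p n := fun j => a (Sum.inl j)
    refine ⟨Pi.single b w, ?_⟩
    rw [posExpand_single, hw]
    rfl
  | zero => rw [zero_smul]; exact zero_mem _
  | add x y _ _ hx hy => rw [add_smul]; exact add_mem hx hy
  | smul c x _ hx => rw [smul_assoc]; exact Submodule.smul_mem _ c hx

variable (χ hχ wt hwt H hH) in
-- The submodule generated by the bottom layer `y_top V_χ(wt)` works. It is nonzero by uniqueness of
-- expansions over `n⁻`. Were it everything, positive monomials applied to the bottom layer would
-- give unique expansions as well, whereas the top positive monomial annihilates that layer when
-- `Phi` vanishes.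
theorem exists_proper_of_Phi_eq_zero (hp : 2 < p) (hneg : ∀ x ∈ negSub K σ, χ x = 0)
    (hPhi : Phi p wt = 0) :
    ∃ N : Submodule (Red χ (queer K n p)) (BabyVerma p σ χ hχ wt hwt H hH),
      (∀ x ∈ N, vermaParity x ∈ N) ∧ N ≠ ⊥ ∧ N ≠ ⊤ := by
  classical
  obtain ⟨l, hs, hl⟩ := exists_sorted_roots n
  have hbij := expand_negMono_bijective χ σ hp (nodup_negList hs) (fun j => mem_negList.2 (hl j.1))
    (highWeightRep p σ χ hχ wt hwt H hH)
  have hω := highVec_ne_zero χ wt hwt H hH (two_ne_zero_of_charP hp)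
  let top : Expo p n := fun j => ⟨bd p j.2 - 1, by have := two_le_bd hp j.2; omega⟩
  have hsingle : (Pi.single top (highVec χ wt hwt H hH) : Expo p n → HighWeight p χ wt hwt H hH) ≠ 0 :=
    fun h => hω (Pi.single_eq_zero_iff.1 h)
  refine ⟨Submodule.span _ (Set.range (bottom p σ χ hχ wt hwt H hH l)), fun x hx => ?_, fun h => ?_,
    fun h => ?_⟩
  · induction hx using Submodule.span_induction with
    | mem x hx =>
      obtain ⟨v, rfl⟩ := hx
      obtain ⟨s, h⟩ := exists_redParity_mono (K := K) (χ := χ) (σ := σ) (p := p) (negList l)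
        fun j => bd p j.2 - 1
      refine Submodule.subset_span ⟨s • highParity χ wt hwt H hH v, ?_⟩
      rw [bottom_apply, bottom_apply, vermaParity_smul, vermaParity_toVerma, negTop, topMono, h, map_smul,
        smul_assoc, smul_comm]
    | zero => rw [map_zero]; exact zero_mem _
    | add x y _ _ hx hy => rw [map_add]; exact add_mem hx hy
    | smul r x _ hx => rw [vermaParity_smul]; exact Submodule.smul_mem _ _ hx
  · have h1 : bottom p σ χ hχ wt hwt H hH l (highVec χ wt hwt H hH) = 0 := by
      rw [← Submodule.mem_bot (Red χ (queer K n p)), ← h]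
      exact Submodule.subset_span ⟨_, rfl⟩
    refine hsingle (hbij.1 ?_)
    rw [map_zero, Ind.expand_apply, Finset.sum_eq_single top]
    · rw [Pi.single_eq_same, mk_eq_smul_toVerma]
      exact h1
    · intro b _ hb; rw [Pi.single_eq_of_ne hb, map_zero]
    · simp
  · have hfin := finite_highWeight χ wt hwt H hH hp
    have hsurj : Function.Surjective (posExpand p σ χ hχ wt hwt H hH l) := by
      intro z
      have hz : z ∈ Submodule.span (Red χ (queer K n p))
        (Set.range (bottom p σ χ hχ wt hwt H hH l)) := h ▸ Submodule.mem_top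
      have key : ∀ r : Red χ (queer K n p), r • z ∈
          LinearMap.range (posExpand p σ χ hχ wt hwt H hH l) := by
        induction hz using Submodule.span_induction with
        | mem z hz =>
          obtain ⟨v, rfl⟩ := hz
          exact fun r => smul_bottom_mem_range hp hneg hs hl r v
        | zero => intro r; rw [smul_zero]; exact zero_mem _
        | add x y _ _ hx hy => intro r; rw [smul_add]; exact add_mem (hx r) (hy r)
        | smul r' x _ hx => intro r; rw [smul_smul]; exact hx _
      have := key 1
      rwa [one_smul] at this
    let e := LinearEquiv.ofBijective _ hbij
    -- Positive and negative restricted monomials have the same set of exponents. Composing with the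
    -- inverse of the expansion over `n⁻` thus gives a surjective endomorphism of a
    -- finite-dimensional space, which is injective.
    have hinj : Function.Injective (posExpand p σ χ hχ wt hwt H hH l) := by
      have h1 : Function.Surjective (e.symm.toLinearMap ∘ₗ posExpand p σ χ hχ wt hwt H hH l) :=
        e.symm.surjective.comp hsurj
      have h2 := LinearMap.injective_iff_surjective.2 h1
      exact Function.Injective.of_comp h2
    obtain ⟨r, hr⟩ : ∃ r : Root n, phi p (coord wt (σ.symm r.1.1)) (coord wt (σ.symm r.1.2)) = 0 := by
      by_contra hcon
      push Not at hcon
      exact (Phi_ne_zero_iff σ wt).2 hcon hPhi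
    refine hsingle (hinj ?_)
    rw [map_zero, posExpand_single, bottom_apply]
    have h2 := posTop_smul_negTop_smul_toVerma (hχ := hχ) hp hneg hs hl (highVec χ wt hwt H hH)
    rw [List.prod_eq_zero (List.mem_map.2 ⟨r, hl r, by rw [hr, mul_zero]⟩), zero_smul] at h2
    exact h2

theorem nontrivial_babyVerma (hp : 2 < p) :
    Nontrivial (BabyVerma p σ χ hχ wt hwt H hH) := by
  obtain ⟨l, hs, hl⟩ := exists_sorted_roots n
  have hbij := expand_negMono_bijective χ σ hp (nodup_negList hs) (fun j => mem_negList.2 (hl j.1))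
    (highWeightRep p σ χ hχ wt hwt H hH)
  have : Nontrivial (HighWeight p χ wt hwt H hH) :=
    ⟨_, 0, highVec_ne_zero χ wt hwt H hH (two_ne_zero_of_charP hp)⟩
  have : Nonempty (Expo p n) := ⟨fun j => ⟨0, by have := two_le_bd hp j.2; omega⟩⟩
  exact hbij.1.nontrivial

end Simplicity

end Queer

end

theorem theoremA {K : Type*} [Field K] [IsAlgClosed K] (p : ℕ) [Fact p.Prime] [CharP K p]
    (hp : 2 < p) (n : ℕ) (σ : Equiv.Perm (Fin n))
    (χ : Module.Dual K (Queer.Mat K n)) (hss : Queer.IsSemisimpleChar σ χ)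
    (hpos : ∀ x ∈ Queer.posSub K σ, χ x = 0) (hneg : ∀ x ∈ Queer.negSub K σ, χ x = 0)
    (wt : Module.Dual K (Queer.diagSub K n)) (hwt : wt ∈ Queer.weights p χ)
    (H : Submodule K (Queer.diagSub K n)) (hH : Maximal (Queer.IsIsotropic p wt) H) :
    Queer.IsIrreducibleSuper (Queer.Red χ (Queer.queer K n p))
      (Queer.babyVermaGrading p σ χ hpos wt hwt H hH.prop) ↔ Queer.Phi p wt ≠ 0 := by
  rw [Queer.IsIrreducibleSuper]
  -- As `2` is invertible, graded submodules are those stable under the parity operator.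
  simp only [Queer.isGradedSubmodule_iff (Queer.two_ne_zero_of_charP hp)
    Queer.isParity_babyVermaGrading]
  constructor
  · rintro ⟨-, h⟩ hPhi
    obtain ⟨N, hN, h1, h2⟩ :=
      Queer.exists_proper_of_Phi_eq_zero χ hpos wt hwt H hH.prop hp hneg hPhi
    exact (h N hN).elim h1 h2
  · exact fun hPhi => ⟨Queer.nontrivial_babyVerma hp,
      Queer.eq_bot_or_eq_top_of_Phi_ne_zero hp hneg hH hPhi⟩
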